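/- For a finite simple graph $G$, a vertex cover is a set of vertices meeting every edge, and a minimum vertex cover is a vertex cover of least cardinality. PAU-VC (Pre-assignment for Uniquification of Minimum Vertex Cover) is the following problem: given a finite simple graph $G$, find a set $S \subseteq V(G)$ of least cardinality such that exactly one minimum vertex cover of $G$ contains $S$. A graph is a unit interval graph if it is the intersection graph of a family of closed intervals of length one on the real line, and a split graph if its vertex set is the disjoint union of a clique and an independent set (either may be empty). Theorem. PAU-VC can be solved in linear time on unit interval graphs, and PAU-VC can be solved in linear time on split graphs. That is, for each of the two classes there are a program of a unit-cost random access machine (with addition and truncated subtraction as its only arithmetic operations) and a constant $c$ such that, for every graph $G$ of the class with $n$ vertices and $m$ edges, given by its adjacency lists (in any order, and with neither an interval representation nor a partition into a clique and an independent set being given), the program halts after at most $c\,(n+m+1)$ steps and outputs a solution of PAU-VC on $G$, while every number and every address that it writes is at most $c\,(n+m+1)$. -/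

import Mathlib

namespace PAUVC

/-! ## The problem and the two graph classes -/

section Graphs

/-- `C` is a minimum vertex cover of `G`: a vertex cover of the least cardinality. -/
def IsMinVertexCover {V : Type*} (G : SimpleGraph V) (C : Finset V) : Prop :=
  G.IsVertexCover (C : Set V) ∧
    ∀ D : Finset V, G.IsVertexCover (D : Set V) → C.card ≤ D.card

/-- Exactly one minimum vertex cover of `G` contains `S`. -/
def ForcesUnique {V : Type*} (G : SimpleGraph V) (S : Finset V) : Prop :=
  ∃! C : Finset V, IsMinVertexCover G C ∧ S ⊆ C

/-- `S` is a solution of PAU-VC on `G`: a set of the least cardinality among the sets that are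
contained in exactly one minimum vertex cover of `G`. -/
def IsSolution {V : Type*} (G : SimpleGraph V) (S : Finset V) : Prop :=
  ForcesUnique G S ∧ ∀ T : Finset V, ForcesUnique G T → S.card ≤ T.card

/-- `G` is the intersection graph of a family of intervals of length one on the real line;
`f v` is the left end point of the interval of `v`. -/
def IsUnitInterval {V : Type*} (G : SimpleGraph V) : Prop :=
  ∃ f : V → ℝ, ∀ u v : V,
    G.Adj u v ↔ u ≠ v ∧ (Set.Icc (f u) (f u + 1) ∩ Set.Icc (f v) (f v + 1)).Nonempty

/-- The vertex set of `G` is the disjoint union of a clique and an independent set. -/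
def IsSplit {V : Type*} (G : SimpleGraph V) : Prop :=
  ∃ A B : Set V, Disjoint A B ∧ A ∪ B = Set.univ ∧ G.IsClique A ∧ G.IsIndepSet B

end Graphs

/-! ## The machine: a random access machine with structured programs

The memory consists of registers and of arrays, all of whose cells hold natural numbers. A program
mentions finitely many registers and arrays, by fixed names. The only arithmetic operations are
addition and truncated subtraction. Every operation costs one step, and every number and every
address that is written has to be at most a given bound `W` (the words have `O(log W)` bits). -/

section Machine

/-- The contents of the registers and of the arrays. -/
structure State where
  reg : ℕ → ℕ
  arr : ℕ → ℕ → ℕ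

/-- Arithmetic expressions: constants, registers, array cells, sums and truncated differences. -/
inductive Expr where
  | const (k : ℕ)
  | reg (x : ℕ)
  | get (a : ℕ) (i : Expr)
  | add (e f : Expr)
  | sub (e f : Expr)

/-- The value of an expression. -/
def Expr.eval (s : State) : Expr → ℕ
  | .const k => k
  | .reg x => s.reg x
  | .get a i => s.arr a (i.eval s)
  | .add e f => e.eval s + f.eval s
  | .sub e f => e.eval s - f.eval s

/-- The number of steps taken by the evaluation of an expression, one for each operation. -/
def Expr.cost : Expr → ℕ
  | .const _ => 1
  | .reg _ => 1
  | .get _ i => i.cost + 1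
  | .add e f => e.cost + f.cost + 1
  | .sub e f => e.cost + f.cost + 1

/-- Programs. `ite e p q` runs `p` if the value of `e` is nonzero and `q` otherwise; `loop e p`
runs `p` as long as the value of `e` is nonzero. -/
inductive Prog where
  | skip
  | set (x : ℕ) (e : Expr)
  | put (a : ℕ) (i e : Expr)
  | seq (p q : Prog)
  | ite (e : Expr) (p q : Prog)
  | loop (e : Expr) (p : Prog)

/-- Write the value `k` into the register `x`. -/
def State.setReg (s : State) (x k : ℕ) : State :=
  { s with reg := Function.update s.reg x k }

/-- Write the value `k` into the cell `i` of the array `a`. -/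
def State.setArr (s : State) (a i k : ℕ) : State :=
  { s with arr := Function.update s.arr a (Function.update (s.arr a) i k) }

/-- `Exec W p s t s'`: started in the state `s`, the program `p` halts in the state `s'` after
exactly `t` steps, and it never writes a number, or uses an address for writing, above `W`. -/
inductive Exec (W : ℕ) : Prog → State → ℕ → State → Prop where
  | skip (s : State) : Exec W .skip s 1 s
  | set (s : State) (x : ℕ) (e : Expr) (he : e.eval s ≤ W) :
      Exec W (.set x e) s (e.cost + 1) (s.setReg x (e.eval s))
  | put (s : State) (a : ℕ) (i e : Expr) (hi : i.eval s ≤ W) (he : e.eval s ≤ W) :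
      Exec W (.put a i e) s (i.cost + e.cost + 1) (s.setArr a (i.eval s) (e.eval s))
  | seq (p q : Prog) (s₁ s₂ s₃ : State) (t₁ t₂ : ℕ)
      (hp : Exec W p s₁ t₁ s₂) (hq : Exec W q s₂ t₂ s₃) :
      Exec W (.seq p q) s₁ (t₁ + t₂) s₃
  | ite_true (e : Expr) (p q : Prog) (s s' : State) (t : ℕ)
      (he : e.eval s ≠ 0) (hp : Exec W p s t s') :
      Exec W (.ite e p q) s (e.cost + 1 + t) s'
  | ite_false (e : Expr) (p q : Prog) (s s' : State) (t : ℕ)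
      (he : e.eval s = 0) (hq : Exec W q s t s') :
      Exec W (.ite e p q) s (e.cost + 1 + t) s'
  | loop_false (e : Expr) (p : Prog) (s : State) (he : e.eval s = 0) :
      Exec W (.loop e p) s (e.cost + 1) s
  | loop_true (e : Expr) (p : Prog) (s₁ s₂ s₃ : State) (t₁ t₂ : ℕ)
      (he : e.eval s₁ ≠ 0) (hp : Exec W p s₁ t₁ s₂) (hl : Exec W (.loop e p) s₂ t₂ s₃) :
      Exec W (.loop e p) s₁ (e.cost + 1 + t₁ + t₂) s₃

/-- A program has at most one execution from a given state. -/
theorem Exec.deterministic {W : ℕ} {p : Prog} {s s₁ s₂ : State} {t₁ t₂ : ℕ}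
    (h₁ : Exec W p s t₁ s₁) (h₂ : Exec W p s t₂ s₂) : t₁ = t₂ ∧ s₁ = s₂ := by
  induction h₁ generalizing t₂ s₂ with
  | skip s => cases h₂; exact ⟨rfl, rfl⟩
  | set s x e he => cases h₂; exact ⟨rfl, rfl⟩
  | put s a i e hi he => cases h₂; exact ⟨rfl, rfl⟩
  | seq p q a b c m k hp hq ihp ihq =>
    cases h₂ with
    | seq _ _ _ b' _ _ _ hp' hq' =>
      obtain ⟨rfl, rfl⟩ := ihp hp'
      obtain ⟨rfl, rfl⟩ := ihq hq'
      exact ⟨rfl, rfl⟩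
  | ite_true e p q s s' t he hp ih =>
    cases h₂ with
    | ite_true _ _ _ _ _ _ he' hp' =>
      obtain ⟨rfl, rfl⟩ := ih hp'
      exact ⟨rfl, rfl⟩
    | ite_false _ _ _ _ _ _ he' hq' => exact absurd he' he
  | ite_false e p q s s' t he hq ih =>
    cases h₂ with
    | ite_true _ _ _ _ _ _ he' hp' => exact absurd he he'
    | ite_false _ _ _ _ _ _ he' hq' =>
      obtain ⟨rfl, rfl⟩ := ih hq'
      exact ⟨rfl, rfl⟩
  | loop_false e p s he =>
    cases h₂ with
    | loop_false _ _ _ he' => exact ⟨rfl, rfl⟩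
    | loop_true _ _ _ _ _ _ _ he' hp' hl' => exact absurd he he'
  | loop_true e p a b c m k he hp hl ihp ihl =>
    cases h₂ with
    | loop_false _ _ _ he' => exact absurd he' he
    | loop_true _ _ _ _ _ _ _ he' hp' hl' =>
      obtain ⟨rfl, rfl⟩ := ihp hp'
      obtain ⟨rfl, rfl⟩ := ihl hl'
      exact ⟨rfl, rfl⟩

end Machine

/-! ## Input, output and linear time -/

section LinearTime

/-- A representation of `G` by adjacency lists: the list of each vertex contains each of its
neighbours exactly once, in any order. -/
structure AdjLists {n : ℕ} (G : SimpleGraph (Fin n)) where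
  nbrs : Fin n → List (Fin n)
  nodup : ∀ v, (nbrs v).Nodup
  mem_nbrs : ∀ v u, u ∈ nbrs v ↔ G.Adj v u

/-- The concatenation of the adjacency lists of the first `k` vertices. -/
def AdjLists.concat {n : ℕ} {G : SimpleGraph (Fin n)} (L : AdjLists G) (k : ℕ) : List (Fin n) :=
  ((List.finRange n).take k).flatMap L.nbrs

/-- The initial state. Register `0` holds the number `n` of vertices. Array `1` holds the
concatenation of all adjacency lists, and array `0` holds, in its cell `v` for `v ≤ n`, the position
in array `1` where the list of the vertex `v` begins (for `v = n`: the total length). All other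
registers and cells are zero. -/
def AdjLists.init {n : ℕ} {G : SimpleGraph (Fin n)} (L : AdjLists G) : State where
  reg x := if x = 0 then n else 0
  arr a i :=
    if a = 0 then (if i ≤ n then (L.concat i).length else 0)
    else if a = 1 then ((L.concat n).map Fin.val).getD i 0
    else 0

/-- The set of vertices that a state describes: array `2` holds its characteristic vector. -/
def State.output (s : State) (n : ℕ) : Finset (Fin n) :=
  Finset.univ.filter fun v => s.arr 2 v = 1

/-- PAU-VC can be solved in linear time on the class `𝒢` of graphs: there are one program and one
constant `c` such that on every graph of the class, given by adjacency lists, the program halts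
after at most `c * (n + m + 1)` steps with a solution as output, where `n` is the number of vertices
and `m` the number of edges. The numbers and the addresses that it writes are at most
`c * (n + m + 1)`. -/
def SolvableInLinearTime (𝒢 : ∀ n : ℕ, SimpleGraph (Fin n) → Prop) : Prop :=
  ∃ (p : Prog) (c : ℕ), ∀ (n : ℕ) (G : SimpleGraph (Fin n)), 𝒢 n G → ∀ L : AdjLists G,
    ∃ (t : ℕ) (s : State),
      Exec (c * (n + G.edgeSet.ncard + 1)) p L.init t s ∧
      t ≤ c * (n + G.edgeSet.ncard + 1) ∧
      IsSolution G (s.output n)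

end LinearTime

end PAUVC

/-! A minimum vertex cover is the complement of a maximum independent set `X`, so a preassigned set
for `Xᶜ` has to exclude every other maximum independent set.

Unit interval graphs. Sorting by left end points gives an umbrella order: the neighbours of a vertex
on one side of it are pairwise adjacent. Hence a vertex outside `X` has one or two neighbours in
`X`. If it has exactly one, the two can be exchanged, so it must be preassigned
(`privateNbrs_subset`). Conversely these private neighbours suffice
(`IsUmbrellaOrder.eq_of_disjoint_privateNbrs`): a second maximum independent set avoiding them would
make the symmetric difference 2-regular, which fails at its first vertex. Double counting shows that
their number is twice the size of `Xᶜ` minus the degree sum of `X`. What is needed is therefore a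
maximum independent set of largest degree sum, that is, a maximum weight independent set for the
weights `N + degree` with `N` large. A primal-dual argument finds it along a perfect elimination
order (`isMaxWeight_of_elimination`), and breadth first levels together with low degrees give such
an order without any interval representation (`IsLayering.isPerfectElimination`).

Split graphs. With `A` a maximal clique of a split partition, a vertex cover contains `A` or the
neighbourhood of some `a ∈ A`. If some clique vertices have no neighbour outside, the minimum covers
are `A` minus one of them, and all of them but one have to be preassigned. Otherwise the minimum
covers are `A` and the neighbourhoods of the clique vertices with exactly one outside neighbour.
These vertices fall into classes according to that neighbour, and a solution is empty if there is no
class; else it has the size of a smallest class. The size of `A` can be read off the degrees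
(`IsSplitClique.threshold_eq`).

The programs are verified in a Hoare logic with a clock. Time is linear because the work at a vertex
is bounded by a constant plus a multiple of its degree, and the degrees sum to `2m`. -/

set_option linter.unusedSectionVars false

namespace PAUVC

/-! ## A program logic with an elapsed-time clock -/

section ProgramLogic

infixr:60 " ;; " => Prog.seq

/-- Started in the state `s` when `k` steps have elapsed, `p` halts in a state and at a time that
satisfy `Q`. -/
def wp (W : ℕ) (p : Prog) (s : State) (k : ℕ) (Q : State → ℕ → Prop) : Prop :=
  ∃ t s', Exec W p s t s' ∧ Q s' (k + t)

/-- Whether the program may write to the register `x`. -/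
def Prog.setsReg (x : ℕ) : Prog → Bool
  | .skip => false
  | .set y _ => x == y
  | .put _ _ _ => false
  | .seq p q => p.setsReg x || q.setsReg x
  | .ite _ p q => p.setsReg x || q.setsReg x
  | .loop _ p => p.setsReg x

/-- Whether the program may write to the array `a`. -/
def Prog.setsArr (a : ℕ) : Prog → Bool
  | .skip => false
  | .set _ _ => false
  | .put b _ _ => a == b
  | .seq p q => p.setsArr a || q.setsArr a
  | .ite _ p q => p.setsArr a || q.setsArr a
  | .loop _ p => p.setsArr a

/-- `s'` agrees with `s` on all registers and arrays to which `p` does not write. -/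
structure Frame (p : Prog) (s s' : State) : Prop where
  reg : ∀ x, p.setsReg x = false → s'.reg x = s.reg x
  arr : ∀ a, p.setsArr a = false → s'.arr a = s.arr a

theorem Frame.refl (p : Prog) (s : State) : Frame p s s := ⟨fun _ _ => rfl, fun _ _ => rfl⟩

theorem Frame.trans {p : Prog} {s₁ s₂ s₃ : State} (h : Frame p s₁ s₂) (h' : Frame p s₂ s₃) :
    Frame p s₁ s₃ :=
  ⟨fun x hx => (h'.reg x hx).trans (h.reg x hx), fun a ha => (h'.arr a ha).trans (h.arr a ha)⟩

theorem Frame.mono {p q : Prog} {s s' : State} (h : Frame p s s')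
    (hr : ∀ x, q.setsReg x = false → p.setsReg x = false)
    (ha : ∀ x, q.setsArr x = false → p.setsArr x = false) : Frame q s s' :=
  ⟨fun x hx => h.reg x (hr x hx), fun a hx => h.arr a (ha a hx)⟩

@[simp] theorem State.reg_setReg (s : State) (x k y : ℕ) :
    (s.setReg x k).reg y = if y = x then k else s.reg y := by
  simp [State.setReg, Function.update_apply]

@[simp] theorem State.arr_setReg (s : State) (x k : ℕ) : (s.setReg x k).arr = s.arr := rfl

@[simp] theorem State.reg_setArr (s : State) (a i k : ℕ) : (s.setArr a i k).reg = s.reg := rfl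

@[simp] theorem State.arr_setArr (s : State) (a i k b : ℕ) :
    (s.setArr a i k).arr b = if b = a then Function.update (s.arr a) i k else s.arr b := by
  by_cases h : b = a
  · subst h; simp [State.setArr]
  · simp [State.setArr, h]

theorem Exec.frame {W : ℕ} {p : Prog} {s s' : State} {t : ℕ} (h : Exec W p s t s') :
    Frame p s s' := by
  induction h with
  | skip s => exact Frame.refl _ _
  | set s x e he =>
    refine ⟨fun y hy => ?_, fun a _ => rfl⟩
    have : y ≠ x := by simpa [Prog.setsReg] using hy
    simp [this]
  | put s a i e hi he =>
    refine ⟨fun y _ => rfl, fun b hb => ?_⟩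
    have : b ≠ a := by simpa [Prog.setsArr] using hb
    simp [this]
  | seq p q _ _ _ _ _ _ _ ihp ihq =>
    exact (ihp.mono (by simp +contextual [Prog.setsReg])
      (by simp +contextual [Prog.setsArr])).trans
      (ihq.mono (by simp +contextual [Prog.setsReg]) (by simp +contextual [Prog.setsArr]))
  | ite_true _ _ _ _ _ _ _ _ ih =>
    exact ih.mono (by simp +contextual [Prog.setsReg]) (by simp +contextual [Prog.setsArr])
  | ite_false _ _ _ _ _ _ _ _ ih =>
    exact ih.mono (by simp +contextual [Prog.setsReg]) (by simp +contextual [Prog.setsArr])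
  | loop_false => exact Frame.refl _ _
  | loop_true _ _ _ _ _ _ _ _ _ _ ihp ihl =>
    exact Frame.trans (ihp.mono (by simp [Prog.setsReg]) (by simp [Prog.setsArr])) ihl

variable {W : ℕ} {s : State} {k : ℕ} {Q : State → ℕ → Prop}

theorem wp.mono {p : Prog} {R : State → ℕ → Prop} (h : wp W p s k R)
    (hRQ : ∀ s' k', Frame p s s' → R s' k' → Q s' k') : wp W p s k Q := by
  obtain ⟨t, s', he, hR⟩ := h
  exact ⟨t, s', he, hRQ _ _ he.frame hR⟩

theorem wp_skip : wp W .skip s k Q ↔ Q s (k + 1) := by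
  constructor
  · rintro ⟨t, s', h, hQ⟩; cases h; exact hQ
  · exact fun h => ⟨_, _, .skip s, h⟩

theorem wp_set {x : ℕ} {e : Expr} :
    wp W (.set x e) s k Q ↔ e.eval s ≤ W ∧ Q (s.setReg x (e.eval s)) (k + (e.cost + 1)) := by
  constructor
  · rintro ⟨t, s', h, hQ⟩; cases h; exact ⟨by assumption, hQ⟩
  · exact fun h => ⟨_, _, .set s x e h.1, h.2⟩

theorem wp_put {a : ℕ} {i e : Expr} :
    wp W (.put a i e) s k Q ↔ i.eval s ≤ W ∧ e.eval s ≤ W ∧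
      Q (s.setArr a (i.eval s) (e.eval s)) (k + (i.cost + e.cost + 1)) := by
  constructor
  · rintro ⟨t, s', h, hQ⟩; cases h; exact ⟨by assumption, by assumption, hQ⟩
  · exact fun h => ⟨_, _, .put s a i e h.1 h.2.1, h.2.2⟩

theorem wp_seq {p q : Prog} :
    wp W (.seq p q) s k Q ↔ wp W p s k fun s' k' => wp W q s' k' Q := by
  constructor
  · rintro ⟨t, s', h, hQ⟩
    cases h with
    | seq _ _ _ s₂ _ t₁ t₂ hp hq => exact ⟨t₁, s₂, hp, t₂, s', hq, by rwa [Nat.add_assoc]⟩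
  · rintro ⟨t₁, s₂, hp, t₂, s', hq, hQ⟩
    exact ⟨_, _, .seq _ _ _ _ _ _ _ hp hq, by rwa [← Nat.add_assoc]⟩

theorem wp_ite {e : Expr} {p q : Prog} :
    wp W (.ite e p q) s k Q ↔ (e.eval s ≠ 0 → wp W p s (k + (e.cost + 1)) Q) ∧
      (e.eval s = 0 → wp W q s (k + (e.cost + 1)) Q) := by
  constructor
  · rintro ⟨t, s', h, hQ⟩
    cases h with
    | ite_true _ _ _ _ _ t he hp =>
      exact ⟨fun _ => ⟨t, s', hp, by rwa [Nat.add_assoc]⟩, fun h => absurd h he⟩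
    | ite_false _ _ _ _ _ t he hp =>
      exact ⟨fun h => absurd he h, fun _ => ⟨t, s', hp, by rwa [Nat.add_assoc]⟩⟩
  · rintro ⟨h₁, h₂⟩
    by_cases he : e.eval s = 0
    · obtain ⟨t, s', hp, hQ⟩ := h₂ he
      exact ⟨_, s', .ite_false _ _ _ _ _ _ he hp, by rwa [← Nat.add_assoc]⟩
    · obtain ⟨t, s', hp, hQ⟩ := h₁ he
      exact ⟨_, s', .ite_true _ _ _ _ _ _ he hp, by rwa [← Nat.add_assoc]⟩

/-- Termination comes from the decreasing measure `μ`, and the running time is part of the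
invariant. The frame relative to the start is supplied in both obligations, so an invariant need not
mention memory that the body leaves alone. -/
theorem wp_loop {e : Expr} {p : Prog} (Inv : State → ℕ → Prop) (μ : State → ℕ) (h0 : Inv s k)
    (hstep : ∀ s' k', Frame p s s' → Inv s' k' → e.eval s' ≠ 0 →
      wp W p s' (k' + (e.cost + 1)) fun s'' k'' => Inv s'' k'' ∧ μ s'' < μ s')
    (hend : ∀ s' k', Frame p s s' → Inv s' k' → e.eval s' = 0 → Q s' (k' + (e.cost + 1))) :
    wp W (.loop e p) s k Q := by
  suffices H : ∀ (m : ℕ) (s' : State) (k' : ℕ), μ s' = m → Frame p s s' → Inv s' k' →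
      wp W (.loop e p) s' k' Q from H _ s k rfl (Frame.refl _ _) h0
  intro m
  induction m using Nat.strong_induction_on with
  | _ m ih =>
    intro s' k' hm hf hI
    by_cases he : e.eval s' = 0
    · exact ⟨_, _, .loop_false e p s' he, hend _ _ hf hI he⟩
    · obtain ⟨t, s'', hp, hI', hlt⟩ := hstep s' k' hf hI he
      obtain ⟨t', s₃, hl, hQ⟩ := ih _ (hm ▸ hlt) s'' _ rfl (hf.trans hp.frame) hI'
      refine ⟨_, _, .loop_true e p _ _ _ _ _ he hp hl, ?_⟩
      rwa [← Nat.add_assoc, ← Nat.add_assoc]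

/-- Run `p` for all values of the register `x` from `a` up to, and not including, `b`. -/
def Prog.forRange (x : ℕ) (a b : Expr) (p : Prog) : Prog :=
  .set x a ;; .loop (.sub b (.reg x)) (p ;; .set x (.add (.reg x) (.const 1)))

/-- A round pays `T i` for the body, `b.cost + 3` for the guard and `4` for the increment; the
remaining `a.cost + b.cost + 4` pays for the first assignment and the last guard. The bound `b` is
evaluated anew in every round, hence `hb`. -/
theorem wp_forRange {x : ℕ} {a b : Expr} {p : Prog} (Inv : ℕ → State → Prop) (T : ℕ → ℕ)
    {lo hi : ℕ} (ha : a.eval s = lo) (hle : lo ≤ hi) (hW : hi ≤ W)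
    (hb : ∀ s', Frame (.forRange x a b p) s s' → b.eval s' = hi)
    (hx : p.setsReg x = false)
    (hI : ∀ i s' v, Inv i s' → Inv i (s'.setReg x v))
    (h0 : Inv lo s)
    (hstep : ∀ i s' k', lo ≤ i → i < hi → s'.reg x = i → Frame (.forRange x a b p) s s' →
      Inv i s' → wp W p s' k' fun s'' k'' => k'' ≤ k' + T i ∧ Inv (i + 1) s'')
    (hQ : ∀ s' k', Frame (.forRange x a b p) s s' → Inv hi s' →
      k' ≤ k + (a.cost + b.cost + 4) + ∑ i ∈ Finset.Ico lo hi, (T i + (b.cost + 7)) → Q s' k') :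
    wp W (.forRange x a b p) s k Q := by
  have hfr : ∀ {s₁ s₂ : State}, Frame (p ;; .set x (.add (.reg x) (.const 1))) s₁ s₂ →
      Frame (.forRange x a b p) s₁ s₂ := fun h =>
    h.mono (by simp +contextual [Prog.forRange, Prog.setsReg])
      (by simp +contextual [Prog.forRange, Prog.setsArr])
  have hfx : Frame (.forRange x a b p) s (s.setReg x lo) := by
    refine ⟨fun y hy => ?_, fun _ _ => rfl⟩
    have : y ≠ x := by
      rintro rfl
      simp [Prog.forRange, Prog.setsReg] at hy
    simp [this]
  unfold Prog.forRange
  rw [wp_seq, wp_set, ha]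
  refine ⟨hle.trans hW, ?_⟩
  refine wp_loop (fun s' k' => ∃ i, lo ≤ i ∧ i ≤ hi ∧ s'.reg x = i ∧ Inv i s' ∧
      k' ≤ k + (a.cost + 1) + ∑ i ∈ Finset.Ico lo i, (T i + (b.cost + 7)))
    (fun s' => hi - s'.reg x) ?_ ?_ ?_
  · exact ⟨lo, le_rfl, hle, by simp, hI _ _ _ h0, by simp⟩
  · rintro s' k' hf ⟨i, hli, hih, hxi, hinv, hk⟩ hne
    have hF := hfx.trans (hfr hf)
    have hlt : i < hi := by
      simp only [Expr.eval, hb s' hF, hxi] at hne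
      omega
    rw [wp_seq]
    refine (hstep i s' _ hli hlt hxi hF hinv).mono ?_
    rintro s'' k'' hf'' ⟨hk'', hinv''⟩
    have hxi' : s''.reg x = i := (hf''.reg x hx).trans hxi
    rw [wp_set]
    simp only [Expr.eval, Expr.cost, hxi', State.reg_setReg, if_true] at hk'' ⊢
    refine ⟨by omega, ⟨i + 1, by omega, by omega, rfl, hI _ _ _ hinv'', ?_⟩, by omega⟩
    rw [Finset.sum_Ico_succ_top hli]
    omega
  · rintro s' k' hf ⟨i, hli, hih, hxi, hinv, hk⟩ he
    have hF := hfx.trans (hfr hf)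
    have hi' : i = hi := by
      simp only [Expr.eval, hb s' hF, hxi] at he
      omega
    subst hi'
    refine hQ _ _ hF hinv ?_
    simp only [Expr.cost]
    omega

end ProgramLogic

/-! ## Adjacency lists in memory -/

section Adjacency

variable {n : ℕ} {G : SimpleGraph (Fin n)} (L : AdjLists G)

/-- The position at which the list of the vertex `k` begins. -/
def AdjLists.off (k : ℕ) : ℕ := (L.concat k).length

theorem AdjLists.concat_succ (v : Fin n) :
    L.concat (v + 1) = L.concat v ++ L.nbrs v := by
  unfold AdjLists.concat
  rw [List.take_succ_eq_append_getElem (by simp)]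
  simp

theorem AdjLists.off_zero : L.off 0 = 0 := by simp [AdjLists.off, AdjLists.concat]

theorem AdjLists.off_succ (v : Fin n) : L.off (v + 1) = L.off v + (L.nbrs v).length := by
  simp [AdjLists.off, L.concat_succ]

theorem AdjLists.concat_prefix {i j : ℕ} (h : i ≤ j) : L.concat i <+: L.concat j := by
  unfold AdjLists.concat
  obtain ⟨l, hl⟩ := List.take_prefix_take_left (l := List.finRange n) h
  rw [← hl, List.flatMap_append]
  exact List.prefix_append _ _

theorem AdjLists.off_mono {i j : ℕ} (h : i ≤ j) : L.off i ≤ L.off j :=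
  (L.concat_prefix h).length_le

theorem AdjLists.getD_concat (v : Fin n) {t : ℕ} (ht : t < (L.nbrs v).length) :
    ((L.concat n).map Fin.val).getD (L.off v + t) 0 = (L.nbrs v)[t] := by
  obtain ⟨l, hl⟩ := L.concat_prefix (i := v + 1) (j := n) v.2
  rw [← hl, L.concat_succ, AdjLists.off, List.getD_eq_getElem _ _ (by simp; omega)]
  simp [ht]

theorem AdjLists.length_nbrs [DecidableRel G.Adj] (v : Fin n) :
    (L.nbrs v).length = G.degree v := by
  rw [← List.toFinset_card_of_nodup (L.nodup v), SimpleGraph.degree]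
  congr 1
  ext u
  simp [L.mem_nbrs]

theorem AdjLists.sum_length_nbrs : ∑ v, (L.nbrs v).length = L.off n := by
  have h : ∀ k (hk : k ≤ n), L.off k = ∑ i ∈ Finset.range k,
      if h : i < n then (L.nbrs ⟨i, h⟩).length else 0 := by
    intro k
    induction k with
    | zero => intro _; simp [L.off_zero]
    | succ k ih =>
      intro hk
      rw [Finset.sum_range_succ, ← ih (by omega), dif_pos (show k < n by omega)]
      exact L.off_succ ⟨k, by omega⟩
  rw [h n le_rfl, Finset.sum_range]
  simp

theorem AdjLists.off_eq : L.off n = 2 * G.edgeSet.ncard := by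
  classical
  rw [← L.sum_length_nbrs, Finset.sum_congr rfl fun v _ => L.length_nbrs v,
    G.sum_degrees_eq_twice_card_edges, ← SimpleGraph.coe_edgeFinset, Set.ncard_coe_finset]

/-- The input is in memory. -/
structure Input (s : State) : Prop where
  reg : s.reg 0 = n
  arr0 : s.arr 0 = L.init.arr 0
  arr1 : s.arr 1 = L.init.arr 1

variable {L}

theorem AdjLists.input_init : Input L L.init := ⟨by simp [AdjLists.init], rfl, rfl⟩

theorem Input.off {s : State} (h : Input L s) {i : ℕ} (hi : i ≤ n) : s.arr 0 i = L.off i := by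
  rw [h.arr0]; simp [AdjLists.init, hi, AdjLists.off]

theorem Input.nbr {s : State} (h : Input L s) (v : Fin n) {t : ℕ} (ht : t < (L.nbrs v).length) :
    s.arr 1 (L.off v + t) = (L.nbrs v)[t] := by
  rw [h.arr1, ← L.getD_concat v ht]; simp [AdjLists.init]

theorem Input.frame {p : Prog} {s s' : State} (h : Input L s) (hf : Frame p s s')
    (h0 : p.setsReg 0 = false) (h1 : p.setsArr 0 = false) (h2 : p.setsArr 1 = false) :
    Input L s' :=
  ⟨(hf.reg 0 h0).trans h.reg, (hf.arr 0 h1).trans h.arr0, (hf.arr 1 h2).trans h.arr1⟩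

theorem Input.setReg {s : State} (h : Input L s) {x k : ℕ} (hx : x ≠ 0) :
    Input L (s.setReg x k) :=
  ⟨by simp [hx.symm, h.reg], h.arr0, h.arr1⟩

theorem Input.setArr {s : State} (h : Input L s) {a i k : ℕ} (h0 : a ≠ 0) (h1 : a ≠ 1) :
    Input L (s.setArr a i k) :=
  ⟨h.reg, by simp [h0.symm, h.arr0], by simp [h1.symm, h.arr1]⟩

/-- Run `p` with the register `3` holding the neighbours of the vertex in the register `1`, one
after the other. -/
def Prog.forNbrs (p : Prog) : Prog :=
  .forRange 2 (.get 0 (.reg 1)) (.get 0 (.add (.reg 1) (.const 1))) (.set 3 (.get 1 (.reg 2)) ;; p)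

/-- The program leaves the input and the registers that control `Prog.forNbrs` alone. -/
def Prog.Gentle (p : Prog) : Prop :=
  p.setsReg 0 = false ∧ p.setsReg 1 = false ∧ p.setsReg 2 = false ∧
    p.setsArr 0 = false ∧ p.setsArr 1 = false

/-- The invariant is indexed by the prefix of the adjacency list already treated, so that clients
reason about lists of vertices and never about positions in the array `1`. -/
theorem wp_forNbrs {W : ℕ} {s : State} {k : ℕ} {Q : State → ℕ → Prop} {p : Prog}
    (Inv : List (Fin n) → State → Prop) (C : ℕ) (hin : Input L s) (v : Fin n) (hv : s.reg 1 = v)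
    (hW : n + L.off n ≤ W) (hp : p.Gentle)
    (hI : ∀ l s' x m, x = 2 ∨ x = 3 → Inv l s' → Inv l (s'.setReg x m))
    (h0 : Inv [] s)
    (hstep : ∀ l (u : Fin n) s' k', l ++ [u] <+: L.nbrs v → Input L s' → s'.reg 1 = v → s'.reg 3 = u →
      Frame p.forNbrs s s' → Inv l s' →
      wp W p s' k' fun s'' k'' => k'' ≤ k' + C ∧ Inv (l ++ [u]) s'')
    (hQ : ∀ s' k', Frame p.forNbrs s s' → Input L s' → Inv (L.nbrs v) s' →
      k' ≤ k + 10 + (C + 14) * (L.nbrs v).length → Q s' k') :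
    wp W p.forNbrs s k Q := by
  obtain ⟨hp0, hp1, hp2, hp3, hp4⟩ := hp
  have hin' : ∀ s', Frame p.forNbrs s s' → Input L s' ∧ s'.reg 1 = v := fun s' hf =>
    ⟨hin.frame hf (by simp [Prog.forNbrs, Prog.forRange, Prog.setsReg, hp0])
      (by simp [Prog.forNbrs, Prog.forRange, Prog.setsArr, hp3])
      (by simp [Prog.forNbrs, Prog.forRange, Prog.setsArr, hp4]),
      (hf.reg 1 (by simp [Prog.forNbrs, Prog.forRange, Prog.setsReg, hp1])).trans hv⟩
  have hoff := L.off_succ v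
  have hoffn := L.off_mono (i := v + 1) (j := n) v.2
  refine wp_forRange (fun i s' => Inv ((L.nbrs v).take (i - L.off v)) s') (fun _ => C + 3)
    (lo := L.off v) (hi := L.off (v + 1)) ?_ ?_ ?_ ?_ ?_ ?_ ?_ ?_ ?_
  · simp only [Expr.eval, hv]; exact hin.off v.2.le
  · omega
  · omega
  · intro s' hf
    obtain ⟨h, h'⟩ := hin' s' hf
    simp only [Expr.eval, h']; exact h.off v.2
  · simp [Prog.setsReg, hp2]
  · exact fun i s' m h => hI _ _ _ _ (.inl rfl) h
  · simpa using h0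
  · intro i s' k' hlo hhi hi2 hf hinv
    obtain ⟨h, h'⟩ := hin' s' hf
    have ht : i - L.off v < (L.nbrs v).length := by omega
    have hval : s'.arr 1 i = (L.nbrs v)[i - L.off v] := by
      rw [← h.nbr v ht]; congr 1; omega
    have htake : (L.nbrs v).take (i + 1 - L.off v) =
        (L.nbrs v).take (i - L.off v) ++ [(L.nbrs v)[i - L.off v]] := by
      rw [show i + 1 - L.off v = i - L.off v + 1 by omega, List.take_succ_eq_append_getElem ht]
    rw [wp_seq, wp_set]
    simp only [Expr.eval, Expr.cost, hi2, hval, htake]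
    refine ⟨by have := (L.nbrs v)[i - L.off v].2; omega, ?_⟩
    refine (hstep _ ((L.nbrs v)[i - L.off v]) (s'.setReg 3 _) _ ?_ (h.setReg (by norm_num))
      (by simpa using h') (by simp) ?_ (hI _ _ _ _ (.inr rfl) hinv)).mono ?_
    · rw [← htake]; exact List.take_prefix _ _
    · refine hf.trans ⟨fun x hx => ?_, fun _ _ => rfl⟩
      have : x ≠ 3 := by
        rintro rfl; simp [Prog.forRange, Prog.setsReg] at hx
      simp [this]
    · rintro s'' k'' - ⟨hk, hI'⟩
      exact ⟨by omega, hI'⟩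
  · intro s' k' hf hinv hk
    refine hQ s' k' hf (hin' s' hf).1 ?_ ?_
    · rwa [show L.off (v + 1) - L.off v = (L.nbrs v).length by omega, List.take_length] at hinv
    · simp only [Finset.sum_const, Nat.card_Ico, smul_eq_mul, Expr.cost] at hk
      rw [show L.off (v + 1) - L.off v = (L.nbrs v).length by omega] at hk
      rw [Nat.mul_comm (C + 14)]
      linarith

/-- Run `p` with the register `1` holding the vertices, one after the other. -/
def Prog.forVerts (p : Prog) : Prog := .forRange 1 (.const 0) (.reg 0) p

/-- This is the amortisation behind linear time: a cost of `C + D * degree` per vertex adds up to a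
multiple of `n` plus `D * L.off n`, where `L.off n` is twice the number of edges. -/
theorem wp_forVerts {W : ℕ} {s : State} {k : ℕ} {Q : State → ℕ → Prop} {p : Prog}
    (Inv : ℕ → State → Prop) (C D : ℕ) (hin : Input L s) (hW : n ≤ W)
    (h0p : p.setsReg 0 = false) (h1p : p.setsReg 1 = false)
    (ha : p.setsArr 0 = false ∧ p.setsArr 1 = false)
    (hI : ∀ i s' m, Inv i s' → Inv i (s'.setReg 1 m))
    (h0 : Inv 0 s)
    (hstep : ∀ (v : Fin n) s' k', Input L s' → s'.reg 1 = v → Frame p.forVerts s s' →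
      Inv v s' → wp W p s' k' fun s'' k'' =>
        k'' ≤ k' + (C + D * (L.nbrs v).length) ∧ Inv (v + 1) s'')
    (hQ : ∀ s' k', Frame p.forVerts s s' → Input L s' → Inv n s' →
      k' ≤ k + 6 + (C + 8) * n + D * L.off n → Q s' k') :
    wp W p.forVerts s k Q := by
  have hin' : ∀ s', Frame p.forVerts s s' → Input L s' := fun s' hf =>
    hin.frame hf (by simp [Prog.forVerts, Prog.forRange, Prog.setsReg, h0p])
      (by simp [Prog.forVerts, Prog.forRange, Prog.setsArr, ha.1])
      (by simp [Prog.forVerts, Prog.forRange, Prog.setsArr, ha.2])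
  refine wp_forRange Inv
    (fun i => C + D * if h : i < n then (L.nbrs ⟨i, h⟩).length else 0)
    (lo := 0) (hi := n) rfl (Nat.zero_le _) hW (fun s' hf => (hin' s' hf).reg) h1p hI h0 ?_ ?_
  · intro i s' k' _ hi hi1 hf hinv
    rw [dif_pos hi]
    exact hstep ⟨i, hi⟩ s' k' (hin' s' hf) hi1 hf hinv
  · intro s' k' hf hinv hk
    refine hQ s' k' hf (hin' s' hf) hinv (hk.trans ?_)
    rw [← Finset.range_eq_Ico, Finset.sum_range, ← L.sum_length_nbrs]
    simp only [Fin.is_lt, dif_pos, Fin.eta, Finset.sum_add_distrib, Finset.mul_sum, Finset.sum_const,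
      Finset.card_univ, Fintype.card_fin, smul_eq_mul, Expr.cost]
    nlinarith

end Adjacency

/-! ## Umbrella orders -/

section Umbrella

variable {V : Type*} {G : SimpleGraph V}

/-- A strict linear order in which every edge is also an edge to all vertices in between. -/
structure IsUmbrellaOrder (G : SimpleGraph V) (lt : V → V → Prop) : Prop where
  irrefl : ∀ v, ¬ lt v v
  trans : ∀ {u v w}, lt u v → lt v w → lt u w
  tri : ∀ u v, lt u v ∨ u = v ∨ lt v u
  left : ∀ {u v w}, lt u v → lt v w → G.Adj u w → G.Adj u v
  right : ∀ {u v w}, lt u v → lt v w → G.Adj u w → G.Adj v w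

theorem IsUmbrellaOrder.swap {lt : V → V → Prop} (h : IsUmbrellaOrder G lt) :
    IsUmbrellaOrder G (fun u v => lt v u) where
  irrefl := h.irrefl
  trans h₁ h₂ := h.trans h₂ h₁
  tri u v := by rcases h.tri u v with h | h | h <;> simp [h]
  left h₁ h₂ ha := (h.right h₂ h₁ ha.symm).symm
  right h₁ h₂ ha := (h.left h₂ h₁ ha.symm).symm

/-- Order by left end points and break ties by the index. Adjacency means left end points at
distance at most one, which passes to everything in between. -/
theorem IsUnitInterval.exists_umbrellaOrder {n : ℕ} {G : SimpleGraph (Fin n)}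
    (h : IsUnitInterval G) : ∃ lt, IsUmbrellaOrder G lt := by
  obtain ⟨f, hf⟩ := h
  have hadj : ∀ u v, G.Adj u v ↔ u ≠ v ∧ f u ≤ f v + 1 ∧ f v ≤ f u + 1 := by
    intro u v
    rw [hf, Set.Icc_inter_Icc, Set.nonempty_Icc, sup_le_iff, le_inf_iff, le_inf_iff]
    constructor
    · rintro ⟨h, ⟨-, h1⟩, ⟨h2, -⟩⟩; exact ⟨h, h1, h2⟩
    · rintro ⟨h, h1, h2⟩; exact ⟨h, ⟨by linarith, h1⟩, ⟨h2, by linarith⟩⟩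
  refine ⟨fun u v => f u < f v ∨ f u = f v ∧ u < v, ?_, ?_, ?_, ?_, ?_⟩
  · simp
  · rintro u v w (h | ⟨h, h'⟩) (h1 | ⟨h1, h1'⟩)
    · exact .inl (h.trans h1)
    · exact .inl (h1 ▸ h)
    · exact .inl (h ▸ h1)
    · exact .inr ⟨h.trans h1, h'.trans h1'⟩
  · intro u v
    rcases lt_trichotomy (f u) (f v) with h | h | h
    · simp [h]
    · rcases lt_trichotomy u v with h' | h' | h' <;> simp [h, h']
    · simp [h]
  · intro u v w h1 h2
    rw [hadj, hadj]
    rintro ⟨-, h3, h4⟩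
    have h5 : f u ≤ f v := by rcases h1 with h | h; exacts [h.le, h.1.le]
    have h6 : f v ≤ f w := by rcases h2 with h | h; exacts [h.le, h.1.le]
    refine ⟨?_, by linarith, by linarith⟩
    rintro rfl; simp at h1
  · intro u v w h1 h2
    rw [hadj, hadj]
    rintro ⟨-, h3, h4⟩
    have h5 : f u ≤ f v := by rcases h1 with h | h; exacts [h.le, h.1.le]
    have h6 : f v ≤ f w := by rcases h2 with h | h; exacts [h.le, h.1.le]
    refine ⟨?_, by linarith, by linarith⟩
    rintro rfl; simp at h2

variable {lt : V → V → Prop}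

/-- The nearer of the two vertices lies under the edge from `q` to the farther one. -/
theorem IsUmbrellaOrder.adj_of_right (h : IsUmbrellaOrder G lt) {q u w : V} (hu : G.Adj q u)
    (hw : G.Adj q w) (hqu : lt q u) (hqw : lt q w) (hne : u ≠ w) : G.Adj u w := by
  rcases h.tri u w with huw | huw | huw
  · exact h.right hqu huw hw
  · exact absurd huw hne
  · exact (h.right hqw huw hu).symm

/-- Each side of `q` is a clique within its neighbourhood, so it contributes at most one element; in
other words, the graph has no claw. -/
theorem IsUmbrellaOrder.card_indep_nbrs_le_two [DecidableRel G.Adj] (h : IsUmbrellaOrder G lt)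
    {X : Finset V} (hX : G.IsIndepSet (X : Set V)) (q : V) :
    (X.filter fun x => G.Adj q x).card ≤ 2 := by
  classical
  by_contra hc
  have hle : ∀ lt' : V → V → Prop, IsUmbrellaOrder G lt' →
      ((X.filter fun x => G.Adj q x).filter fun x => lt' q x).card ≤ 1 := by
    intro lt' h'
    rw [Finset.card_le_one]
    simp only [Finset.mem_filter]
    rintro a ⟨⟨haX, ha⟩, ha'⟩ b ⟨⟨hbX, hb⟩, hb'⟩
    by_contra hab
    exact hX haX hbX hab (h'.adj_of_right ha hb ha' hb' hab)
  have h1 := hle lt h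
  have h2 := hle _ h.swap
  have h3 := Finset.card_filter_add_card_filter_not (s := X.filter fun x => G.Adj q x) (lt q ·)
  have h4 : ((X.filter fun x => G.Adj q x).filter fun x => ¬ lt q x).card ≤
      ((X.filter fun x => G.Adj q x).filter fun x => lt x q).card := by
    refine Finset.card_le_card fun x hx => ?_
    simp only [Finset.mem_filter] at hx ⊢
    refine ⟨hx.1, ?_⟩
    rcases h.tri q x with h' | h' | h'
    · exact absurd h' hx.2
    · exact absurd (h' ▸ hx.1.2) (G.irrefl)
    · exact h'
  omega

end Umbrella

/-! ## Minimum vertex covers and maximum independent sets -/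

section Covers

variable {V : Type*} [Fintype V] [DecidableEq V] {G : SimpleGraph V}

theorem isMinVertexCover_iff (C : Finset V) :
    IsMinVertexCover G C ↔ G.IsMaximumIndepSet Cᶜ := by
  have h : ∀ D : Finset V, G.IsVertexCover (D : Set V) ↔ G.IsIndepSet ((Dᶜ : Finset V) : Set V) :=
    fun D => by rw [Finset.coe_compl, SimpleGraph.isIndepSet_compl_iff_isVertexCover]
  constructor
  · rintro ⟨h1, h2⟩
    refine ⟨(h C).1 h1, fun t ht => ?_⟩
    have := h2 tᶜ ((h _).2 (by simpa using ht))
    have h3 := Finset.card_compl_add_card t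
    have h4 := Finset.card_compl_add_card C
    omega
  · rintro ⟨h1, h2⟩
    refine ⟨(h C).2 h1, fun D hD => ?_⟩
    have := h2 Dᶜ ((h _).1 hD)
    have h3 := Finset.card_compl_add_card D
    have h4 := Finset.card_compl_add_card C
    omega

theorem isMinVertexCover_compl (X : Finset V) :
    IsMinVertexCover G Xᶜ ↔ G.IsMaximumIndepSet X := by
  rw [isMinVertexCover_iff, compl_compl]

variable [DecidableRel G.Adj]

/-- The vertices with exactly one neighbour in `X`. -/
def privateNbrs (G : SimpleGraph V) [DecidableRel G.Adj] (X : Finset V) : Finset V :=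
  Finset.univ.filter fun v => (X.filter fun x => G.Adj v x).card = 1

theorem not_mem_of_mem_privateNbrs {X : Finset V} (hX : G.IsIndepSet (X : Set V)) {v : V}
    (hv : v ∈ privateNbrs G X) : v ∉ X := by
  intro hvX
  obtain ⟨x, hx⟩ := Finset.card_eq_one.1 (Finset.mem_filter.1 hv).2
  have hx' : x ∈ X.filter fun x => G.Adj v x := by simp [hx]
  rw [Finset.mem_filter] at hx'
  exact hX hvX hx'.1 hx'.2.ne hx'.2

/-- A set that forces the complement of `X` contains every vertex that can be exchanged for an
element of `X`. -/
theorem privateNbrs_subset {X T : Finset V} (hX : G.IsMaximumIndepSet X) (hTX : T ⊆ Xᶜ)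
    (huniq : ∀ C, IsMinVertexCover G C ∧ T ⊆ C → C = Xᶜ) : privateNbrs G X ⊆ T := by
  intro v hv
  have hvX := not_mem_of_mem_privateNbrs hX.isIndepSet hv
  obtain ⟨x, hx⟩ := Finset.card_eq_one.1 (Finset.mem_filter.1 hv).2
  have hx' : x ∈ X ∧ G.Adj v x := by
    have : x ∈ X.filter fun x => G.Adj v x := by simp [hx]
    simpa using this
  have honly : ∀ y ∈ X, G.Adj v y → y = x := fun y hy hvy => by
    have : y ∈ X.filter fun x => G.Adj v x := by simp [hy, hvy]
    simpa [hx] using this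
  by_contra hvT
  -- Exchanging `x` for `v` gives another maximum independent set; if `v ∉ T`, its complement is a
  -- second minimum cover containing `T`.
  have hY : G.IsMaximumIndepSet (insert v (X.erase x)) := by
    refine ⟨?_, fun t ht => (hX.maximum t ht).trans_eq ?_⟩
    · rw [Finset.coe_insert]
      refine Set.Pairwise.insert (hX.isIndepSet.mono (by simp)) ?_
      intro b hb _
      have hb' : b ≠ x ∧ b ∈ X := by simpa [and_comm] using hb
      exact ⟨fun h => hb'.1 (honly b hb'.2 h), fun h => hb'.1 (honly b hb'.2 h.symm)⟩
    · rw [Finset.card_insert_of_notMem (by simp [hvX]), Finset.card_erase_of_mem hx'.1]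
      have := Finset.card_pos.2 ⟨x, hx'.1⟩
      omega
  have := huniq (insert v (X.erase x))ᶜ ⟨(isMinVertexCover_compl _).2 hY, ?_⟩
  · rw [compl_inj_iff] at this
    exact hvX (this ▸ Finset.mem_insert_self _ _)
  · intro a ha
    have haX := Finset.mem_compl.1 (hTX ha)
    simp only [Finset.mem_compl, Finset.mem_insert, Finset.mem_erase, not_or, not_and]
    exact ⟨fun h => hvT (h ▸ ha), fun _ => haX⟩

theorem sum_card_nbrs_comm (X : Finset V) :
    ∑ v, (X.filter fun x => G.Adj v x).card = ∑ x ∈ X, G.degree x := by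
  have := Finset.sum_card_bipartiteAbove_eq_sum_card_bipartiteBelow
    (s := (Finset.univ : Finset V)) (t := X) G.Adj
  simp only [Finset.bipartiteAbove, Finset.bipartiteBelow] at this
  rw [this]
  refine Finset.sum_congr rfl fun x _ => ?_
  rw [← SimpleGraph.card_neighborFinset_eq_degree]
  congr 1
  ext v
  simp [G.adj_comm]

theorem exists_adj_of_isMaximumIndepSet {X : Finset V} (hX : G.IsMaximumIndepSet X) {v : V}
    (hv : v ∉ X) : ∃ x ∈ X, G.Adj v x := by
  by_contra! h
  have := hX.maximum (insert v X) (by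
    rw [Finset.coe_insert]
    exact Set.Pairwise.insert hX.isIndepSet fun b hb _ => ⟨h b hb, fun h' => h b hb h'.symm⟩)
  rw [Finset.card_insert_of_notMem hv] at this
  omega

variable {lt : V → V → Prop}

/-- A vertex outside `X` has one or two neighbours in `X`, so this number plus the indicator of
being private is always `2`; inside `X` both terms vanish. Since all maximum independent sets have
the same size, few private neighbours means a large degree sum. -/
theorem IsUmbrellaOrder.card_privateNbrs (h : IsUmbrellaOrder G lt) {X : Finset V}
    (hX : G.IsMaximumIndepSet X) :
    (privateNbrs G X).card + ∑ x ∈ X, G.degree x = 2 * Xᶜ.card := by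
  rw [← sum_card_nbrs_comm, privateNbrs, Finset.card_filter, ← Finset.sum_add_distrib,
    ← Finset.sum_compl_add_sum X]
  rw [Finset.sum_eq_zero (s := X), add_zero, Finset.sum_const_nat (m := 2), mul_comm]
  · intro v hv
    obtain ⟨x, hx, hvx⟩ := exists_adj_of_isMaximumIndepSet hX (Finset.mem_compl.1 hv)
    have h1 := h.card_indep_nbrs_le_two hX.isIndepSet v
    have h2 : 0 < (X.filter fun x => G.Adj v x).card :=
      Finset.card_pos.2 ⟨x, by simp [hx, hvx]⟩
    split_ifs <;> omega
  · intro v hv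
    have : (X.filter fun x => G.Adj v x) = ∅ := by
      ext x
      simp only [Finset.mem_filter, Finset.notMem_empty, iff_false, not_and]
      exact fun hx hvx => hX.isIndepSet hv hx hvx.ne hvx
    simp [this]

/-- If `Z ≠ X`, the bipartite graph between `X \ Z` and `Z \ X` is 2-regular. The first vertex of
the symmetric difference then has two neighbours to its right in one independent set, although such
neighbours are adjacent. -/
theorem IsUmbrellaOrder.eq_of_disjoint_privateNbrs (h : IsUmbrellaOrder G lt) {X Z : Finset V}
    (hX : G.IsMaximumIndepSet X) (hZ : G.IsMaximumIndepSet Z)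
    (hd : ∀ z ∈ Z, z ∉ privateNbrs G X) : Z = X := by
  have hcard : X.card = Z.card := le_antisymm (hZ.maximum X hX.isIndepSet)
    (hX.maximum Z hZ.isIndepSet)
  have hdiff : (X \ Z).card = (Z \ X).card := by
    have h1 := Finset.card_sdiff_add_card_inter X Z
    have h2 := Finset.card_sdiff_add_card_inter Z X
    rw [Finset.inter_comm] at h2
    omega
  have hB : ∀ z ∈ Z \ X, ((X \ Z).filter fun x => G.Adj z x).card = 2 := by
    intro z hz
    rw [Finset.mem_sdiff] at hz
    have heq : ((X \ Z).filter fun x => G.Adj z x) = X.filter fun x => G.Adj z x := by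
      ext x
      simp only [Finset.mem_filter, Finset.mem_sdiff]
      exact ⟨fun h => ⟨h.1.1, h.2⟩, fun h => ⟨⟨h.1, fun hxZ =>
        hZ.isIndepSet hz.1 hxZ h.2.ne h.2⟩, h.2⟩⟩
    obtain ⟨x, hx, hzx⟩ := exists_adj_of_isMaximumIndepSet hX hz.2
    have h1 := h.card_indep_nbrs_le_two hX.isIndepSet z
    have h2 : 0 < (X.filter fun x => G.Adj z x).card :=
      Finset.card_pos.2 ⟨x, by simp [hx, hzx]⟩
    have h3 := hd z hz.1
    rw [privateNbrs, Finset.mem_filter] at h3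
    have h4 : (X.filter fun x => G.Adj z x).card ≠ 1 := fun h => h3 ⟨Finset.mem_univ _, h⟩
    rw [heq]; omega
  -- The two sides have equal size and every degree on the `Z` side is `2`, so the degrees on the
  -- `X` side, which are at most `2`, have average `2`.
  have hA : ∀ x ∈ X \ Z, ((Z \ X).filter fun z => G.Adj x z).card = 2 := by
    have hle : ∀ x ∈ X \ Z, ((Z \ X).filter fun z => G.Adj x z).card ≤ 2 := fun x _ =>
      h.card_indep_nbrs_le_two (hZ.isIndepSet.mono (by simp)) x
    have hsum : ∑ x ∈ X \ Z, ((Z \ X).filter fun z => G.Adj x z).card =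
        ∑ x ∈ X \ Z, 2 := by
      have := Finset.sum_card_bipartiteAbove_eq_sum_card_bipartiteBelow (s := X \ Z) (t := Z \ X)
        G.Adj
      simp only [Finset.bipartiteAbove, Finset.bipartiteBelow] at this
      rw [this, Finset.sum_const, hdiff, ← Finset.sum_const]
      refine Finset.sum_congr rfl fun z hz => ?_
      rw [← hB z hz]
      simp_rw [G.adj_comm z]
    exact (Finset.sum_eq_sum_iff_of_le hle).1 hsum
  by_contra hne
  have hwf : WellFounded lt :=
    haveI : IsTrans V lt := ⟨fun _ _ _ => h.trans⟩
    haveI : Std.Irrefl lt := ⟨h.irrefl⟩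
    Finite.wellFounded_of_trans_of_irrefl lt
  have hnon : ((X \ Z ∪ Z \ X : Finset V) : Set V).Nonempty := by
    rw [Finset.coe_nonempty, Finset.nonempty_iff_ne_empty]
    intro h0
    rw [Finset.union_eq_empty, Finset.sdiff_eq_empty_iff_subset,
      Finset.sdiff_eq_empty_iff_subset] at h0
    exact hne (h0.2.antisymm h0.1)
  set q := hwf.min _ hnon with hq
  have hmem := hwf.min_mem _ hnon
  rw [← hq] at hmem
  have hmin : ∀ x ∈ (X \ Z ∪ Z \ X : Finset V), q ≠ x → lt q x := by
    intro x hx hqx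
    have := hwf.not_lt_min ((X \ Z ∪ Z \ X : Finset V) : Set V) hx
    rw [← hq] at this
    rcases h.tri q x with h' | h' | h'
    · exact h'
    · exact absurd h' hqx
    · exact absurd h' this
  have key : ∀ A B : Finset V, G.IsIndepSet (B : Set V) → B ⊆ X \ Z ∪ Z \ X →
      (B.filter fun b => G.Adj q b).card = 2 → False := by
    intro A B hBi hBs hc
    obtain ⟨a, b, hab, habs⟩ := Finset.card_eq_two.1 hc
    have ha : a ∈ B.filter fun b => G.Adj q b := by simp [habs]
    have hb : b ∈ B.filter fun b => G.Adj q b := by simp [habs]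
    rw [Finset.mem_filter] at ha hb
    exact hBi ha.1 hb.1 hab (h.adj_of_right ha.2 hb.2 (hmin a (hBs ha.1) ha.2.ne)
      (hmin b (hBs hb.1) hb.2.ne) hab)
  rcases Finset.mem_union.1 (Finset.mem_coe.1 hmem) with hq' | hq'
  · exact key (X \ Z) (Z \ X) (hZ.isIndepSet.mono (by simp)) Finset.subset_union_right (hA q hq')
  · exact key (Z \ X) (X \ Z) (hX.isIndepSet.mono (by simp)) Finset.subset_union_left (hB q hq')

/-- In a graph with an umbrella order, the vertices with exactly one neighbour in a maximum
independent set of the largest degree sum form a solution. -/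
theorem IsUmbrellaOrder.isSolution_privateNbrs (h : IsUmbrellaOrder G lt) {X : Finset V}
    (hX : G.IsMaximumIndepSet X)
    (hdeg : ∀ Z, G.IsMaximumIndepSet Z → ∑ z ∈ Z, G.degree z ≤ ∑ x ∈ X, G.degree x) :
    IsSolution G (privateNbrs G X) := by
  refine ⟨⟨Xᶜ, ⟨(isMinVertexCover_compl X).2 hX, fun v hv =>
    Finset.mem_compl.2 (not_mem_of_mem_privateNbrs hX.isIndepSet hv)⟩, ?_⟩, ?_⟩
  · rintro C ⟨hC, hSC⟩
    rw [← h.eq_of_disjoint_privateNbrs hX ((isMinVertexCover_iff C).1 hC)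
      fun z hz hzS => Finset.mem_compl.1 hz (hSC hzS), compl_compl]
  · rintro T ⟨C, ⟨hC, hTC⟩, huniq⟩
    -- A competitor `T` contains the private neighbours of its own maximum independent set `Cᶜ`, so
    -- comparing the two private sets is enough.
    have hZ := (isMinVertexCover_iff C).1 hC
    have h1 := Finset.card_le_card (privateNbrs_subset (T := T) hZ
      (by rwa [compl_compl]) (by rwa [compl_compl]))
    have h2 := h.card_privateNbrs hX
    have h3 := h.card_privateNbrs hZ
    have h4 := hdeg _ hZ
    have h5 := hZ.maximum X hX.isIndepSet
    have h6 := hX.maximum _ hZ.isIndepSet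
    rw [Finset.card_compl] at h2 h3
    omega

end Covers

/-! ## Maximum weight independent sets by a perfect elimination order -/

section Elimination

variable {V : Type*} [Fintype V] [DecidableEq V] {G : SimpleGraph V} [DecidableRel G.Adj]

/-- Linear programming duality: give the value `y u` to the clique formed by `u` and its later
neighbours. By `hy` the cliques through `z` have total value at least `wt z`, and an independent set
meets each of them at most once. The greedy set `X` meets every clique of positive value, and the
bound is tight on `X`, because `0 < y x` means that the subtraction was not truncated. -/
theorem isMaxWeight_of_elimination {pos : V → ℕ} (hpos : Function.Injective pos)
    (hpeo : ∀ v u w, G.Adj v u → G.Adj v w → pos v < pos u → pos v < pos w → u ≠ w → G.Adj u w)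
    {wt y : V → ℕ}
    (hy : ∀ v, y v = wt v - ∑ u with G.Adj v u ∧ pos u < pos v, y u)
    {X : Finset V} (hX : ∀ v, v ∈ X ↔ 0 < y v ∧ ∀ u, G.Adj v u → pos v < pos u → u ∉ X) :
    G.IsIndepSet (X : Set V) ∧
      ∀ Z : Finset V, G.IsIndepSet (Z : Set V) → ∑ z ∈ Z, wt z ≤ ∑ x ∈ X, wt x := by
  have hind : G.IsIndepSet (X : Set V) := by
    intro u hu v hv huv hadj
    rcases lt_or_gt_of_ne (hpos.ne huv) with h | h
    · exact ((hX u).1 hu).2 v hadj h hv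
    · exact ((hX v).1 hv).2 u hadj.symm h hu
  refine ⟨hind, fun Z hZ => ?_⟩
  have hcount : ∀ Z : Finset V, ∑ z ∈ Z, (y z + ∑ u with G.Adj z u ∧ pos u < pos z, y u) =
      ∑ u, (Z.filter fun z => z = u ∨ G.Adj z u ∧ pos u < pos z).card * y u := by
    intro Z
    have h1 : ∀ z, y z + ∑ u with G.Adj z u ∧ pos u < pos z, y u =
        ∑ u, if z = u ∨ G.Adj z u ∧ pos u < pos z then y u else 0 := by
      intro z
      rw [← Finset.sum_filter, Finset.filter_or, Finset.sum_union]
      · rw [Finset.filter_eq]; simp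
      · rw [Finset.disjoint_filter]
        rintro u - rfl h
        exact absurd h.2 (lt_irrefl _)
    simp_rw [h1]
    rw [Finset.sum_comm]
    refine Finset.sum_congr rfl fun u _ => ?_
    rw [← Finset.sum_filter, Finset.sum_const, smul_eq_mul]
  calc ∑ z ∈ Z, wt z ≤ ∑ z ∈ Z, (y z + ∑ u with G.Adj z u ∧ pos u < pos z, y u) := by
        refine Finset.sum_le_sum fun z _ => ?_
        have := hy z
        omega
    _ = _ := hcount Z
    _ ≤ ∑ u, (X.filter fun z => z = u ∨ G.Adj z u ∧ pos u < pos z).card * y u := by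
        refine Finset.sum_le_sum fun u _ => ?_
        rcases Nat.eq_zero_or_pos (y u) with h0 | h0
        · simp [h0]
        refine Nat.mul_le_mul_right _ (le_trans (b := 1) ?_ ?_)
        · rw [Finset.card_le_one]
          simp only [Finset.mem_filter]
          rintro a ⟨haZ, ha⟩ b ⟨hbZ, hb⟩
          by_contra hab
          rcases ha with rfl | ⟨ha, ha'⟩ <;> rcases hb with rfl | ⟨hb, hb'⟩
          · exact hab rfl
          · exact hZ haZ hbZ hab hb.symm
          · exact hZ haZ hbZ hab ha
          · exact hZ haZ hbZ hab (hpeo u a b ha.symm hb.symm ha' hb' hab)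
        · rw [Nat.succ_le_iff, Finset.card_pos]
          by_cases hu : u ∈ X
          · exact ⟨u, by simp [hu]⟩
          · have := (hX u).not.1 hu
            push Not at this
            obtain ⟨z, hz, hz', hzX⟩ := this h0
            exact ⟨z, by simp [hzX, hz.symm, hz']⟩
    _ = ∑ z ∈ X, (y z + ∑ u with G.Adj z u ∧ pos u < pos z, y u) := (hcount X).symm
    _ = ∑ x ∈ X, wt x := by
        refine Finset.sum_congr rfl fun x hx => ?_
        have h1 := hy x
        have h2 := ((hX x).1 hx).1
        omega

/-- As `N` exceeds every degree sum, the weights compare sets lexicographically, by size and then by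
degree sum. -/
theorem isMaximumIndepSet_of_isMaxWeight {N : ℕ} (hN : ∑ v, G.degree v < N) {X : Finset V}
    (hX : G.IsIndepSet (X : Set V))
    (hmax : ∀ Z : Finset V, G.IsIndepSet (Z : Set V) →
      ∑ z ∈ Z, (N + G.degree z) ≤ ∑ x ∈ X, (N + G.degree x)) :
    G.IsMaximumIndepSet X ∧
      ∀ Z, G.IsMaximumIndepSet Z → ∑ z ∈ Z, G.degree z ≤ ∑ x ∈ X, G.degree x := by
  simp only [Finset.sum_add_distrib, Finset.sum_const, smul_eq_mul] at hmax
  have hlt : ∑ x ∈ X, G.degree x < N :=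
    (Finset.sum_le_sum_of_subset (Finset.subset_univ _)).trans_lt hN
  have hm : G.IsMaximumIndepSet X := by
    refine ⟨hX, fun Z hZ => ?_⟩
    have := hmax Z hZ
    by_contra! hc
    have : (X.card + 1) * N ≤ Z.card * N := Nat.mul_le_mul_right _ hc
    rw [Nat.add_mul] at this
    omega
  refine ⟨hm, fun Z hZ => ?_⟩
  have h1 := hmax Z hZ.isIndepSet
  rw [le_antisymm (hm.maximum Z hZ.isIndepSet) (hZ.maximum X hX)] at h1
  omega

end Elimination

/-! ## Perfect elimination orders from the layers of a search forest -/

section Layers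

variable {V : Type*} {G : SimpleGraph V}

/-- The levels of a breadth first search forest with the set of roots `R`. -/
structure IsLayering (G : SimpleGraph V) (lev : V → ℕ) (R : Set V) : Prop where
  step : ∀ u v, G.Adj u v → lev u ≤ lev v + 1
  parent : ∀ v, v ∈ R ∨ ∃ p, G.Adj p v ∧ lev p + 1 = lev v
  root : ∀ r ∈ R, ∀ r' ∈ R, G.Reachable r r' → r = r'

variable {lev : V → ℕ} {R : Set V} {lt : V → V → Prop}

/-- Follow the parents; the level drops by one each time. Hence a root lies strictly below all other
vertices of its component. -/
theorem IsLayering.exists_root (h : IsLayering G lev R) (v : V) :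
    ∃ r ∈ R, G.Reachable r v ∧ (r = v ∨ lev r < lev v) := by
  induction hm : lev v using Nat.strong_induction_on generalizing v with
  | _ m ih =>
    subst hm
    rcases h.parent v with hv | ⟨p, hp, hl⟩
    · exact ⟨v, hv, .rfl, .inl rfl⟩
    · obtain ⟨r, hr, hrp, h'⟩ := ih (lev p) (by omega) p rfl
      refine ⟨r, hr, hrp.trans hp.reachable, .inr ?_⟩
      rcases h' with rfl | h' <;> omega

/-- Let `p` be the parent of `w`. If `p` precedes `v`, then `v` lies under the edge from `p` to `w`
and is itself adjacent to `p`; if `p` comes after `v`, induction applies to `p`. -/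
theorem IsLayering.mono (h : IsLayering G lev R) (ho : IsUmbrellaOrder G lt) {r : V} (hr : r ∈ R)
    {v w : V} (hw : G.Reachable r w) (hrv : lt r v) (hvw : lt v w) : lev v ≤ lev w := by
  induction hm : lev w using Nat.strong_induction_on generalizing w with
  | _ m ih =>
    subst hm
    rcases h.parent w with hwR | ⟨p, hp, hl⟩
    · cases h.root r hr w hwR hw
      exact absurd (ho.trans hrv hvw) (ho.irrefl _)
    · rcases ho.tri p v with hpv | rfl | hpv
      · have := h.step v p (ho.left hpv hvw hp).symm
        omega
      · omega
      · have := ih (lev p) (by omega) (hw.trans hp.symm.reachable) hpv rfl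
        omega

variable [Fintype V] [DecidableRel G.Adj]

/-- The number of neighbours of `v` whose level is not larger than that of `v`. -/
def lowDegree (G : SimpleGraph V) [DecidableRel G.Adj] (lev : V → ℕ) (v : V) : ℕ :=
  (Finset.univ.filter fun u => G.Adj v u ∧ lev u ≤ lev v).card

/-- Only the arrangement `u`, `v`, `w` from left to right is not settled by the umbrella property.
There `v` and `w` share a level by monotonicity, and every low neighbour of `w` other than `v` is a
neighbour of `v`: one beyond `w` has its parent no further right than `v`. As the low degree of `w`
is not smaller, the low neighbourhoods agree apart from `v` and `w`, and `u` belongs to both. -/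
theorem IsLayering.adj_of_root_lt (h : IsLayering G lev R) (ho : IsUmbrellaOrder G lt) {r : V}
    (hr : r ∈ R) {v u w : V} (hv : G.Reachable r v) (hrv : lt r v) (hu : G.Adj v u)
    (hw : G.Adj v w) (hlu : lev u ≤ lev v)
    (hlw : lev w < lev v ∨ lev w = lev v ∧ lowDegree G lev v ≤ lowDegree G lev w)
    (huw : lt u w) : G.Adj u w := by
  classical
  rcases ho.tri v u with hvu | rfl | huv
  · exact ho.right hvu huw hw
  · exact hw
  rcases ho.tri w v with hwv | rfl | hvw
  · exact ho.left huw hwv hu.symm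
  · exact hu.symm
  have hw' : G.Reachable r w := hv.trans hw.reachable
  have hlvw := h.mono ho hr hw' hrv hvw
  obtain ⟨hl, hd⟩ : lev w = lev v ∧ lowDegree G lev v ≤ lowDegree G lev w := by
    rcases hlw with h' | h'
    · omega
    · exact h'
  have hsub : ∀ x, G.Adj w x → lev x ≤ lev v → x ≠ v → G.Adj v x := by
    intro x hx hlx hxv
    rcases ho.tri x v with hxv | rfl | hvx
    · exact (ho.left hxv hvw hx.symm).symm
    · exact absurd rfl hxv
    rcases ho.tri x w with hxw | rfl | hwx
    · exact ho.left hvx hxw hw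
    · exact absurd hx G.irrefl
    have hx' : G.Reachable r x := hw'.trans hx.reachable
    have hlwx := h.mono ho hr hx' (ho.trans hrv hvw) hwx
    rcases h.parent x with hxR | ⟨p, hp, hlp⟩
    · cases h.root r hr x hxR hx'
      exact absurd (ho.trans hrv hvx) (ho.irrefl _)
    rcases ho.tri p v with hpv | rfl | hpv
    · exact ho.right hpv hvx hp
    · exact hp
    · have := h.mono ho hr (hx'.trans hp.symm.reachable) hrv hpv
      omega
  have hset : (Finset.univ.filter fun x => G.Adj w x ∧ lev x ≤ lev w).erase v =
      (Finset.univ.filter fun x => G.Adj v x ∧ lev x ≤ lev v).erase w := by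
    refine Finset.eq_of_subset_of_card_le (fun x hx => ?_) ?_
    · simp only [Finset.mem_erase, Finset.mem_filter, Finset.mem_univ, true_and] at hx ⊢
      exact ⟨fun hxw => G.irrefl (hxw ▸ hx.2.1), hsub x hx.2.1 (hl ▸ hx.2.2) hx.1, hl ▸ hx.2.2⟩
    · rw [Finset.card_erase_of_mem (by simp [hw, hl]), Finset.card_erase_of_mem
        (by simp [hw.symm, hl])]
      exact Nat.sub_le_sub_right hd 1
  have hmem : u ∈ (Finset.univ.filter fun x => G.Adj v x ∧ lev x ≤ lev v).erase w := by
    simp only [Finset.mem_erase, Finset.mem_filter, Finset.mem_univ, true_and]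
    exact ⟨fun h' => ho.irrefl w (h' ▸ huw), hu, hlu⟩
  rw [← hset] at hmem
  simp only [Finset.mem_erase, Finset.mem_filter, Finset.mem_univ, true_and] at hmem
  exact hmem.2.1.symm

/-- If the vertices are ordered by decreasing level and, within a level, by increasing low degree,
then the later neighbours of a vertex form a clique. -/
theorem IsLayering.isPerfectElimination (h : IsLayering G lev R) (ho : IsUmbrellaOrder G lt)
    {v u w : V} (hu : G.Adj v u) (hw : G.Adj v w)
    (hlu : lev u < lev v ∨ lev u = lev v ∧ lowDegree G lev v ≤ lowDegree G lev u)
    (hlw : lev w < lev v ∨ lev w = lev v ∧ lowDegree G lev v ≤ lowDegree G lev w)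
    (huw : u ≠ w) : G.Adj u w := by
  obtain ⟨r, hr, hrv, hlr⟩ := h.exists_root v
  have hlu' : lev u ≤ lev v := by omega
  have hlw' : lev w ≤ lev v := by omega
  rcases ho.tri r v with hlt | rfl | hgt
  · rcases ho.tri u w with huw' | huw' | huw'
    · exact h.adj_of_root_lt ho hr hrv hlt hu hw hlu' hlw huw'
    · exact absurd huw' huw
    · exact (h.adj_of_root_lt ho hr hrv hlt hw hu hlw' hlu huw').symm
  -- Here `v` is the root of its component, and all its neighbours have larger levels, so this case
  -- cannot occur.
  · obtain ⟨r', hr', hru, hl'⟩ := h.exists_root u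
    cases h.root _ hr _ hr' (hu.reachable.trans hru.symm)
    rcases hl' with rfl | hl'
    · exact absurd hu G.irrefl
    · omega
  · rcases ho.tri w u with huw' | huw' | huw'
    · exact h.adj_of_root_lt ho.swap hr hrv hgt hu hw hlu' hlw huw'
    · exact absurd huw'.symm huw
    · exact (h.adj_of_root_lt ho.swap hr hrv hgt hw hu hlw' hlu huw').symm

end Layers

/-! ## Split graphs -/

section Split

variable {V : Type*} [Fintype V] [DecidableEq V] {G : SimpleGraph V} [DecidableRel G.Adj]

/-- `A` is a clique, its complement is independent, and no vertex outside of `A` is adjacent to all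
of `A`. -/
structure IsSplitClique (G : SimpleGraph V) (A : Finset V) : Prop where
  clique : G.IsClique (A : Set V)
  indep : ∀ u v, u ∉ A → v ∉ A → ¬ G.Adj u v
  maximal : ∀ b, b ∉ A → ∃ a ∈ A, ¬ G.Adj b a

/-- Take a split partition with the largest clique; a vertex adjacent to the whole clique could be
moved into it. -/
theorem IsSplit.exists_isSplitClique (h : IsSplit G) : ∃ A, IsSplitClique G A := by
  classical
  obtain ⟨A, B, hd, hu, hA, hB⟩ := h
  let P : Finset V → Prop := fun A => G.IsClique (A : Set V) ∧
    ∀ u v, u ∉ A → v ∉ A → ¬ G.Adj u v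
  have hP : P (Finset.univ.filter (· ∈ A)) := by
    refine ⟨by simpa using hA, fun u v hu' hv' huv => ?_⟩
    have hmem : ∀ x, x ∉ Finset.univ.filter (· ∈ A) → x ∈ B := fun x hx => by
      have : x ∈ A ∪ B := hu ▸ Set.mem_univ x
      simp only [Finset.mem_filter, Finset.mem_univ, true_and] at hx
      exact this.resolve_left hx
    exact hB (hmem u hu') (hmem v hv') huv.ne huv
  obtain ⟨A', hA', hmax⟩ := Finset.exists_max_image (Finset.univ.filter P) Finset.card
    ⟨_, Finset.mem_filter.2 ⟨Finset.mem_univ _, hP⟩⟩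
  obtain ⟨h1, h2⟩ := (Finset.mem_filter.1 hA').2
  refine ⟨A', h1, h2, fun b hb => ?_⟩
  by_contra! hall
  have := hmax (insert b A') (Finset.mem_filter.2 ⟨Finset.mem_univ _, ?_, fun u v hu hv =>
    h2 u v (fun h => hu (Finset.mem_insert_of_mem h)) fun h => hv (Finset.mem_insert_of_mem h)⟩)
  · rw [Finset.card_insert_of_notMem hb] at this
    omega
  · rw [Finset.coe_insert]
    exact h1.insert fun a ha _ => hall a ha

/-! ### Minimum vertex covers and forcing sets of split graphs -/

namespace IsSplitClique

variable {A : Finset V} (h : IsSplitClique G A)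
include h

theorem erase_subset {a : V} (ha : a ∈ A) : A.erase a ⊆ G.neighborFinset a := fun b hb => by
  rw [Finset.mem_erase] at hb
  exact (G.mem_neighborFinset _ _).2 (h.clique ha hb.2 hb.1.symm)

theorem card_le_degree {a : V} (ha : a ∈ A) : A.card ≤ G.degree a + 1 := by
  have := Finset.card_le_card (h.erase_subset ha)
  rw [Finset.card_erase_of_mem ha, G.card_neighborFinset_eq_degree] at this
  omega

theorem degree_lt {b : V} (hb : b ∉ A) : G.degree b < A.card := by
  obtain ⟨a, ha, hba⟩ := h.maximal b hb
  rw [← G.card_neighborFinset_eq_degree]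
  refine Finset.card_lt_card ((Finset.ssubset_iff_of_subset fun x hx => ?_).2
    ⟨a, ha, by simpa using hba⟩)
  by_contra hxA
  exact h.indep b x hb hxA (by simpa using hx)

/-- Degrees are at least `A.card - 1` on `A` and less than `A.card` outside, so `A.card` is the
least `k` such that at most `k` vertices have degree at least `k`. The program thus learns the size
of the clique without knowing the partition. -/
theorem threshold_eq {k : ℕ} (hk : (Finset.univ.filter fun v => k ≤ G.degree v).card ≤ k)
    (hk' : ∀ j < k, j < (Finset.univ.filter fun v => j ≤ G.degree v).card) : k = A.card := by
  have h1 : (Finset.univ.filter fun v => A.card ≤ G.degree v).card ≤ A.card :=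
    Finset.card_le_card fun v hv => by
      by_contra hvA
      have := h.degree_lt hvA
      simp only [Finset.mem_filter] at hv
      omega
  rcases lt_trichotomy k A.card with hlt | heq | hgt
  · have : A.card ≤ (Finset.univ.filter fun v => k ≤ G.degree v).card :=
      Finset.card_le_card fun v hv => by
        have := h.card_le_degree hv
        simp only [Finset.mem_filter, Finset.mem_univ, true_and]
        omega
    omega
  · exact heq
  · have := hk' _ hgt
    omega

theorem isVertexCover_self : G.IsVertexCover (A : Set V) := fun u v huv => by
  by_contra! hc
  exact h.indep u v hc.1 hc.2 huv

/-- Outside the neighbourhood of `a` there are only `a` and non-neighbours of `a` in the independent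
part. -/
theorem isVertexCover_nbrs {a : V} (ha : a ∈ A) :
    G.IsVertexCover (G.neighborFinset a : Set V) := fun u v huv => by
  have key : ∀ u v, G.Adj u v → u ∈ A → u ∈ G.neighborFinset a ∨ v ∈ G.neighborFinset a := by
    intro u v huv hu
    by_cases hua : u = a
    · subst hua; exact .inr (by simpa using huv)
    · exact .inl (h.erase_subset ha (Finset.mem_erase.2 ⟨hua, hu⟩))
  rcases h.isVertexCover_self huv with hu | hv
  · exact key u v huv hu
  · exact (key v u huv.symm hv).symm

theorem subset_of_isVertexCover {D : Finset V} (hD : G.IsVertexCover (D : Set V)) :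
    A ⊆ D ∨ ∃ a ∈ A, G.neighborFinset a ⊆ D := by
  by_cases hA : A ⊆ D
  · exact .inl hA
  · obtain ⟨a, ha, haD⟩ := Finset.not_subset.1 hA
    refine .inr ⟨a, ha, fun x hx => ?_⟩
    exact (hD ((G.mem_neighborFinset _ _).1 hx)).resolve_left haD

omit h in
-- The other minimum cover `C'` misses at most `x` from `C`, so only the presence of `x` can keep
-- `T` from being contained in `C'`. All lower bounds for split graphs rest on this.
theorem mem_of_forcesUnique {T C C' : Finset V} (hTC : T ⊆ C)
    (huniq : ∀ D, IsMinVertexCover G D ∧ T ⊆ D → D = C) (hC' : IsMinVertexCover G C')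
    (hne : C' ≠ C) {x : V} (hx : ∀ y ∈ C, y ∉ C' → y = x) : x ∈ T := by
  by_contra hxT
  refine hne (huniq C' ⟨hC', fun y hy => ?_⟩)
  by_contra hyC'
  exact hxT (hx y (hTC hy) hyC' ▸ hy)

/-- A clique vertex of degree `A.card - 1` has neighbourhood `A.erase a`, and no cover is smaller
because neighbourhoods of clique vertices have at least this size. -/
theorem isMinVertexCover_iff_of_degree_lt {a₀ : V} (ha₀ : a₀ ∈ A) (hd : G.degree a₀ < A.card)
    (D : Finset V) : IsMinVertexCover G D ↔ ∃ a ∈ A, G.degree a + 1 = A.card ∧ D = A.erase a := by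
  have hd₀ := h.card_le_degree ha₀
  have heq : ∀ a ∈ A, G.degree a + 1 = A.card → G.neighborFinset a = A.erase a := fun a ha hda =>
    (Finset.eq_of_subset_of_card_le (h.erase_subset ha) (by
      rw [Finset.card_erase_of_mem ha, G.card_neighborFinset_eq_degree]; omega)).symm
  have hlow : ∀ D : Finset V, G.IsVertexCover (D : Set V) → A.card ≤ D.card + 1 := by
    intro D hD
    rcases h.subset_of_isVertexCover hD with hs | ⟨a, ha, hs⟩
    · exact (Finset.card_le_card hs).trans (Nat.le_succ _)
    · have := Finset.card_le_card hs
      rw [G.card_neighborFinset_eq_degree] at this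
      have := h.card_le_degree ha
      omega
  constructor
  · rintro ⟨hD, hmin⟩
    have h1 := hmin _ (h.isVertexCover_nbrs ha₀)
    rw [G.card_neighborFinset_eq_degree] at h1
    rcases h.subset_of_isVertexCover hD with hs | ⟨a, ha, hs⟩
    · have := Finset.card_le_card hs
      omega
    · have h2 := Finset.card_le_card hs
      have h3 := h.card_le_degree ha
      rw [G.card_neighborFinset_eq_degree] at h2
      have hda : G.degree a + 1 = A.card := by omega
      refine ⟨a, ha, hda, ?_⟩
      rw [← heq a ha hda]
      exact (Finset.eq_of_subset_of_card_le hs (by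
        rw [G.card_neighborFinset_eq_degree]; omega)).symm
  · rintro ⟨a, ha, hda, rfl⟩
    refine ⟨heq a ha hda ▸ h.isVertexCover_nbrs ha, fun D hD => ?_⟩
    have := hlow D hD
    rw [Finset.card_erase_of_mem ha]
    omega

/-- The case in which some vertex of the clique has no neighbour outside. -/
theorem isSolution_of_degree_lt {v₀ : V} (hv₀ : v₀ ∈ A) (hd : G.degree v₀ + 1 = A.card) :
    IsSolution G ((A.filter fun v => G.degree v + 1 = A.card).erase v₀) := by
  have hiff := h.isMinVertexCover_iff_of_degree_lt hv₀ (by omega)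
  refine ⟨⟨A.erase v₀, ⟨(hiff _).2 ⟨v₀, hv₀, hd, rfl⟩,
    Finset.erase_subset_erase _ (Finset.filter_subset _ _)⟩, ?_⟩, ?_⟩
  · rintro D ⟨hD, hS⟩
    obtain ⟨a, ha, hda, rfl⟩ := (hiff D).1 hD
    by_contra hne
    have hav : a ≠ v₀ := fun h => hne (h ▸ rfl)
    have := hS (Finset.mem_erase.2 ⟨hav, Finset.mem_filter.2 ⟨ha, hda⟩⟩)
    simp at this
  · rintro T ⟨C, ⟨hC, hTC⟩, huniq⟩
    obtain ⟨a, ha, hda, rfl⟩ := (hiff C).1 hC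
    rw [Finset.card_erase_of_mem (by simp [hv₀, hd]),
      ← Finset.card_erase_of_mem (a := a) (by simp [ha, hda])]
    refine Finset.card_le_card fun x hx => ?_
    simp only [Finset.mem_erase, Finset.mem_filter] at hx
    refine mem_of_forcesUnique hTC huniq (C' := A.erase x)
      ((hiff _).2 ⟨x, hx.2.1, hx.2.2, rfl⟩) (fun he => ?_) ?_
    · have : x ∈ A.erase x := he ▸ Finset.mem_erase.2 ⟨hx.1, hx.2.1⟩
      simp at this
    · intro y hy hy'
      simp only [Finset.mem_erase, not_and'] at hy hy'
      exact not_not.1 (hy' hy.2)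

theorem isMinVertexCover_iff_of_le_degree (hd : ∀ a ∈ A, A.card ≤ G.degree a) (D : Finset V) :
    IsMinVertexCover G D ↔
      D = A ∨ ∃ a, G.degree a = A.card ∧ D = G.neighborFinset a := by
  have hlow : ∀ D : Finset V, G.IsVertexCover (D : Set V) → A.card ≤ D.card := by
    intro D hD
    rcases h.subset_of_isVertexCover hD with hs | ⟨a, ha, hs⟩
    · exact Finset.card_le_card hs
    · have := Finset.card_le_card hs
      rw [G.card_neighborFinset_eq_degree] at this
      exact (hd a ha).trans this
  constructor
  · rintro ⟨hD, hmin⟩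
    have h1 := hmin _ h.isVertexCover_self
    rcases h.subset_of_isVertexCover hD with hs | ⟨a, ha, hs⟩
    · exact .inl (Finset.eq_of_subset_of_card_le hs h1).symm
    · have h2 := Finset.card_le_card hs
      have h3 := hd a ha
      rw [G.card_neighborFinset_eq_degree] at h2
      exact .inr ⟨a, by omega, (Finset.eq_of_subset_of_card_le hs (by
        rw [G.card_neighborFinset_eq_degree]; omega)).symm⟩
  · rintro (rfl | ⟨a, hda, rfl⟩)
    · exact ⟨h.isVertexCover_self, hlow⟩
    · have ha : a ∈ A := by
        by_contra ha
        have := h.degree_lt ha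
        omega
      refine ⟨h.isVertexCover_nbrs ha, fun D hD => ?_⟩
      rw [G.card_neighborFinset_eq_degree, hda]
      exact hlow D hD

theorem mem_of_degree_eq {a : V} (hda : G.degree a = A.card) : a ∈ A := by
  by_contra ha
  have := h.degree_lt ha
  omega

theorem not_mem_of_degree_lt (hd : ∀ a ∈ A, A.card ≤ G.degree a) {b : V}
    (hb : G.degree b < A.card) : b ∉ A := fun hbA => by
  have := hd b hbA
  omega

theorem nbrs_eq_insert {a b : V} (hda : G.degree a = A.card) (hb : b ∉ A) (hab : G.Adj a b) :
    G.neighborFinset a = insert b (A.erase a) := by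
  have ha := h.mem_of_degree_eq hda
  refine (Finset.eq_of_subset_of_card_le
    (Finset.insert_subset (by simpa using hab) (h.erase_subset ha)) ?_).symm
  rw [G.card_neighborFinset_eq_degree, hda, Finset.card_insert_of_notMem (by simp [hb]),
    Finset.card_erase_of_mem ha]
  omega

theorem exists_adj_not_mem {a : V} (hda : G.degree a = A.card) : ∃ b, b ∉ A ∧ G.Adj a b := by
  by_contra! hc
  have : G.neighborFinset a ⊆ A.erase a := fun x hx => by
    have hax : G.Adj a x := by simpa using hx
    refine Finset.mem_erase.2 ⟨hax.ne', ?_⟩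
    by_contra hxA
    exact hc x hxA hax
  have := Finset.card_le_card this
  have ha := h.mem_of_degree_eq hda
  rw [G.card_neighborFinset_eq_degree, hda, Finset.card_erase_of_mem ha] at this
  have := Finset.card_pos.2 ⟨a, ha⟩
  omega

/-- The case in which every vertex of the clique has at least two neighbours outside. -/
theorem isSolution_empty (hd : ∀ a ∈ A, A.card ≤ G.degree a)
    (hno : ∀ u v, G.degree u < A.card → G.Adj u v → G.degree v ≠ A.card) :
    IsSolution G ∅ := by
  have hiff := h.isMinVertexCover_iff_of_le_degree hd
  refine ⟨⟨A, ⟨(hiff A).2 (.inl rfl), Finset.empty_subset _⟩, ?_⟩, fun T _ => by simp⟩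
  rintro D ⟨hD, -⟩
  rcases (hiff D).1 hD with rfl | ⟨a, hda, rfl⟩
  · rfl
  · obtain ⟨b, hb, hab⟩ := h.exists_adj_not_mem hda
    exact absurd hda (hno b a (h.degree_lt hb) hab.symm)

/-- The case in which every vertex of the clique has a neighbour outside, and some vertex of the
clique has exactly one. -/
theorem isSolution_insert (hd : ∀ a ∈ A, A.card ≤ G.degree a) {u v₀ : V}
    (hu : G.degree u < A.card) (huv : G.Adj u v₀) (hv₀ : G.degree v₀ = A.card)
    (hmin : ∀ w v, G.degree w < A.card → G.Adj w v → G.degree v = A.card →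
      (Finset.univ.filter fun v => G.Adj u v ∧ G.degree v = A.card).card ≤
        (Finset.univ.filter fun v => G.Adj w v ∧ G.degree v = A.card).card) :
    IsSolution G
      (insert u ((Finset.univ.filter fun v => G.Adj u v ∧ G.degree v = A.card).erase v₀)) := by
  have hiff := h.isMinVertexCover_iff_of_le_degree hd
  have huA := h.not_mem_of_degree_lt hd hu
  have hcard : ∀ w v, G.degree w < A.card → G.Adj w v → G.degree v = A.card →
      (insert w ((Finset.univ.filter fun v => G.Adj w v ∧ G.degree v = A.card).erase v)).card =
        (Finset.univ.filter fun v => G.Adj w v ∧ G.degree v = A.card).card := by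
    intro w v hw hwv hv
    rw [Finset.card_insert_of_notMem (by simp), Finset.card_erase_of_mem (by simp [hwv, hv])]
    have : 0 < (Finset.univ.filter fun v => G.Adj w v ∧ G.degree v = A.card).card :=
      Finset.card_pos.2 ⟨v, by simp [hwv, hv]⟩
    omega
  refine ⟨⟨G.neighborFinset v₀, ⟨(hiff _).2 (.inr ⟨v₀, hv₀, rfl⟩), ?_⟩, ?_⟩, ?_⟩
  · rw [h.nbrs_eq_insert hv₀ huA huv.symm]
    refine Finset.insert_subset_insert _ (Finset.erase_subset_erase _ fun x hx => ?_)
    exact h.mem_of_degree_eq (Finset.mem_filter.1 hx).2.2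
  · rintro D ⟨hD, hS⟩
    -- The vertex `u` excludes the cover `A` and leaves only neighbourhoods of vertices in its
    -- class; the other preassigned vertices exclude all of these except that of `v₀`.
    have huD := hS (Finset.mem_insert_self _ _)
    rcases (hiff D).1 hD with rfl | ⟨a, hda, rfl⟩
    · exact absurd huD huA
    · have hua : G.Adj u a := by simpa [G.adj_comm] using huD
      by_cases hav : a = v₀
      · rw [hav]
      · have := hS (Finset.mem_insert_of_mem (Finset.mem_erase.2 ⟨hav, by simp [hua, hda]⟩))
        simp at this
  · rintro T ⟨C, ⟨hC, hTC⟩, huniq⟩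
    rw [hcard u v₀ hu huv hv₀]
    rcases (hiff C).1 hC with rfl | ⟨a, hda, rfl⟩
    -- Forcing `A` requires the whole class of `u`, since the neighbourhood of each `v` in it misses
    -- only `v` from `A`.
    · refine Finset.card_le_card fun v hv => ?_
      obtain ⟨huv', hdv⟩ := (Finset.mem_filter.1 hv).2
      have hvA := h.mem_of_degree_eq hdv
      refine mem_of_forcesUnique hTC huniq ((hiff _).2 (.inr ⟨v, hdv, rfl⟩)) (fun he => ?_) ?_
      · have : v ∈ G.neighborFinset v := he ▸ hvA
        simp at this
      · intro y hy hy'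
        by_contra hyv
        exact hy' (h.erase_subset hvA (Finset.mem_erase.2 ⟨hyv, hy⟩))
    -- The forced cover is `A` with `a` replaced by `b`. The cover `A` misses only `b` from it, and
    -- the neighbourhood of another member `x` of the class of `b` misses only `x`; so `T` has at
    -- least as many elements as this class.
    · obtain ⟨b, hb, hab⟩ := h.exists_adj_not_mem hda
      have hdb := h.degree_lt hb
      refine (hmin b a hdb hab.symm hda).trans ?_
      rw [← hcard b a hdb hab.symm hda]
      refine Finset.card_le_card fun x hx => ?_
      rcases Finset.mem_insert.1 hx with rfl | hx
      · refine mem_of_forcesUnique hTC huniq ((hiff A).2 (.inl rfl)) (fun he => ?_) ?_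
        · have : a ∈ G.neighborFinset a := he ▸ h.mem_of_degree_eq hda
          simp at this
        · intro y hy hyA
          rw [h.nbrs_eq_insert hda hb hab] at hy
          rcases Finset.mem_insert.1 hy with hy | hy
          · exact hy
          · exact absurd (Finset.mem_of_mem_erase hy) hyA
      · simp only [Finset.mem_erase, Finset.mem_filter, Finset.mem_univ, true_and] at hx
        obtain ⟨hxa, hbx, hdx⟩ := hx
        refine mem_of_forcesUnique hTC huniq ((hiff _).2 (.inr ⟨x, hdx, rfl⟩)) (fun he => ?_) ?_
        · have hxx : x ∈ G.neighborFinset a := h.erase_subset (h.mem_of_degree_eq hda)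
            (Finset.mem_erase.2 ⟨hxa, h.mem_of_degree_eq hdx⟩)
          rw [← he] at hxx
          simp at hxx
        · intro y hy hy'
          rw [h.nbrs_eq_insert hda hb hab] at hy
          rw [h.nbrs_eq_insert hdx hb hbx.symm] at hy'
          by_contra hyx
          apply hy'
          rcases Finset.mem_insert.1 hy with rfl | hy
          · exact Finset.mem_insert_self _ _
          · exact Finset.mem_insert_of_mem (Finset.mem_erase.2 ⟨hyx, Finset.mem_of_mem_erase hy⟩)

end IsSplitClique

end Split

/-! ## The program for split graphs -/

section SplitProgram

/-- The degree of the vertex in the register `r`. -/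
def Expr.deg (r : ℕ) : Expr := .sub (.get 0 (.add (.reg r) (.const 1))) (.get 0 (.reg r))

/-- An expression that vanishes if and only if `e` and `f` have the same value. -/
def Expr.ne (e f : Expr) : Expr := .add (.sub e f) (.sub f e)

theorem Expr.cost_deg (r : ℕ) : (Expr.deg r).cost = 7 := rfl

theorem Expr.cost_ne (e f : Expr) : (Expr.ne e f).cost = 2 * e.cost + 2 * f.cost + 3 := by
  simp only [Expr.ne, Expr.cost]; omega

theorem Expr.eval_ne_eq_zero {e f : Expr} {s : State} :
    (Expr.ne e f).eval s = 0 ↔ e.eval s = f.eval s := by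
  simp only [Expr.ne, Expr.eval]; omega

theorem Expr.eval_ne_ne_zero {e f : Expr} {s : State} :
    (Expr.ne e f).eval s ≠ 0 ↔ e.eval s ≠ f.eval s := Expr.eval_ne_eq_zero.not

variable {n : ℕ} {G : SimpleGraph (Fin n)} {L : AdjLists G}

theorem Input.eval_deg {s : State} (h : Input L s) {r : ℕ} {v : Fin n} (hr : s.reg r = v) :
    (Expr.deg r).eval s = (L.nbrs v).length := by
  simp only [Expr.deg, Expr.eval, hr]
  rw [h.off v.2, h.off v.2.le, L.off_succ]
  omega

theorem AdjLists.length_nbrs_lt (v : Fin n) : (L.nbrs v).length < n := by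
  classical
  rw [L.length_nbrs]
  simpa using G.degree_lt_card_verts v

theorem card_filter_lt_succ {p : Fin n → Prop} [DecidablePred p] (v : Fin n) :
    (Finset.univ.filter fun u : Fin n => u.val < v.val + 1 ∧ p u).card =
      (Finset.univ.filter fun u : Fin n => u.val < v.val ∧ p u).card + if p v then 1 else 0 := by
  split_ifs with h
  · have heq : (Finset.univ.filter fun u : Fin n => u.val < v.val + 1 ∧ p u) =
        insert v (Finset.univ.filter fun u : Fin n => u.val < v.val ∧ p u) := by
      ext u
      simp only [Finset.mem_filter, Finset.mem_univ, true_and, Finset.mem_insert, Fin.ext_iff]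
      constructor
      · rintro ⟨h1, h2⟩
        by_cases hu : u.val = v.val
        · exact .inl hu
        · exact .inr ⟨by omega, h2⟩
      · rintro (h1 | ⟨h1, h2⟩)
        · cases Fin.ext h1; exact ⟨by omega, h⟩
        · exact ⟨by omega, h2⟩
    rw [heq, Finset.card_insert_of_notMem (by simp)]
  · refine (congrArg Finset.card (Finset.ext fun u => ?_)).trans (Nat.add_zero _).symm
    simp only [Finset.mem_filter, Finset.mem_univ, true_and]
    refine ⟨fun ⟨h1, h2⟩ => ⟨?_, h2⟩, fun ⟨h1, h2⟩ => ⟨by omega, h2⟩⟩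
    have : u.val ≠ v.val := fun hu => h (Fin.ext hu ▸ h2)
    omega

/-- Write the number of vertices of each degree to the array `3`. -/
def degreeCounts : Prog :=
  .forVerts (.put 3 (.deg 1) (.add (.get 3 (.deg 1)) (.const 1)))

theorem wp_degreeCounts {W : ℕ} {s : State} {k : ℕ} (hin : Input L s) (hW : n + L.off n + 2 ≤ W)
    (h3 : ∀ j, s.arr 3 j = 0) :
    wp W degreeCounts s k fun s' k' => k' ≤ k + 6 + 35 * n ∧ Input L s' ∧
      ∀ j, s'.arr 3 j = (Finset.univ.filter fun v => (L.nbrs v).length = j).card := by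
  refine wp_forVerts (fun i s' => ∀ j, s'.arr 3 j =
    (Finset.univ.filter fun v : Fin n => v.val < i ∧ (L.nbrs v).length = j).card) 27 0 hin
    (by omega) rfl rfl ⟨rfl, rfl⟩ (fun _ _ _ h => h) (by simpa using h3) ?_ ?_
  · intro v s' k' hin' hv hf hI
    have hcard : (Finset.univ.filter fun u : Fin n =>
        u.val < v ∧ (L.nbrs u).length = (L.nbrs v).length).card ≤ n :=
      (Finset.card_le_univ _).trans_eq (Fintype.card_fin n)
    have hlt := L.length_nbrs_lt v
    rw [wp_put]
    simp only [Expr.eval, Expr.cost, hin'.eval_deg hv, Expr.cost_deg, hI]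
    refine ⟨by omega, by omega, by omega, fun j => ?_⟩
    rw [card_filter_lt_succ]
    simp only [State.arr_setArr, if_true, Function.update_apply]
    split_ifs with h1 h2 h2
    · rw [h1]
    · exact absurd h1.symm h2
    · exact absurd h2.symm h1
    · rw [hI, Nat.add_zero]
  · intro s' k' hf hin' hI hk
    refine ⟨by omega, hin', fun j => ?_⟩
    rw [hI]
    congr 1
    ext v
    simp

/-- Find the least number `k` such that at most `k` vertices have a degree of at least `k`. The
register `4` receives `k`, and the register `5` the number of these vertices. -/
def threshold : Prog :=
  .set 4 (.const 0) ;; .set 5 (.reg 0) ;;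
  .loop (.sub (.reg 5) (.reg 4))
    (.set 5 (.sub (.reg 5) (.get 3 (.reg 4))) ;; .set 4 (.add (.reg 4) (.const 1)))

theorem wp_threshold {W : ℕ} {s : State} {k : ℕ} (hin : Input L s) (hW : n + L.off n + 2 ≤ W)
    (h3 : ∀ j, s.arr 3 j = (Finset.univ.filter fun v => (L.nbrs v).length = j).card) :
    wp W threshold s k fun s' k' => k' ≤ k + 8 + 13 * n ∧
      s'.reg 5 = (Finset.univ.filter fun v => s'.reg 4 ≤ (L.nbrs v).length).card ∧
      s'.reg 5 ≤ s'.reg 4 ∧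
      ∀ j < s'.reg 4, j < (Finset.univ.filter fun v => j ≤ (L.nbrs v).length).card := by
  have hcard : ∀ j, (Finset.univ.filter fun v : Fin n => j ≤ (L.nbrs v).length).card ≤ n :=
    fun j => (Finset.card_le_univ _).trans_eq (Fintype.card_fin n)
  -- This recurrence lets the register `5` be updated from the degree counts in constant time.
  have hsplit : ∀ j, (Finset.univ.filter fun v : Fin n => j ≤ (L.nbrs v).length).card =
      (Finset.univ.filter fun v : Fin n => (L.nbrs v).length = j).card +
      (Finset.univ.filter fun v : Fin n => j + 1 ≤ (L.nbrs v).length).card := by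
    intro j
    rw [← Finset.card_union_of_disjoint]
    · congr 1
      ext v
      simp only [Finset.mem_filter, Finset.mem_univ, true_and, Finset.mem_union]
      omega
    · rw [Finset.disjoint_filter]
      intros; omega
  unfold threshold
  simp only [wp_seq, wp_set, Expr.eval, Expr.cost]
  refine ⟨by omega, by simp [hin.reg]; omega, ?_⟩
  refine wp_loop (fun s' k' => s'.reg 4 ≤ n ∧ k' ≤ k + 4 + 13 * s'.reg 4 ∧ s'.arr 3 = s.arr 3 ∧
      s'.reg 5 = (Finset.univ.filter fun v => s'.reg 4 ≤ (L.nbrs v).length).card ∧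
      ∀ j < s'.reg 4, j < (Finset.univ.filter fun v => j ≤ (L.nbrs v).length).card)
    (fun s' => n - s'.reg 4) ?_ ?_ ?_
  · simp [hin.reg]
  · rintro s' k' - ⟨h4, hk, ha, h5, hj⟩ hne
    simp only [Expr.eval] at hne
    have hlt : s'.reg 4 < n := by have := hcard (s'.reg 4); omega
    have hs := hsplit (s'.reg 4)
    have hc := hcard (s'.reg 4)
    simp only [wp_seq, wp_set, Expr.eval, Expr.cost, State.reg_setReg, State.arr_setReg, ha, h3,
      h5, if_true, Nat.reduceEqDiff, if_false]
    refine ⟨by omega, by omega, ⟨by omega, by omega, trivial, by omega, fun j hj' => ?_⟩, by omega⟩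
    rcases Nat.lt_succ_iff_lt_or_eq.1 hj' with h | rfl
    · exact hj j h
    · omega
  · rintro s' k' - ⟨h4, hk, ha, h5, hj⟩ he
    simp only [Expr.eval, Expr.cost] at he ⊢
    exact ⟨by omega, h5, by omega, hj⟩

end SplitProgram

/-! ### Output and class counting for split graphs -/

section SplitProgram

variable {n : ℕ} {G : SimpleGraph (Fin n)} {L : AdjLists G}

/-- Output all but the first of the vertices of degree `k - 1`, where `k` is in the register `4`. -/
def outputAllButFirst : Prog :=
  .set 6 (.const 0) ;;
  .forVerts (.ite (.ne (.add (.deg 1) (.const 1)) (.reg 4)) .skip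
    (.ite (.reg 6) (.put 2 (.reg 1) (.const 1)) (.set 6 (.const 1))))

theorem wp_outputAllButFirst {W : ℕ} {s : State} {k : ℕ} (hin : Input L s)
    (hW : n + L.off n + 2 ≤ W) (h2 : ∀ j, s.arr 2 j = 0)
    (hex : ∃ v, (L.nbrs v).length + 1 = s.reg 4) :
    wp W outputAllButFirst s k fun s' k' => k' ≤ k + 8 + 42 * n ∧
      ∃ v₀, (L.nbrs v₀).length + 1 = s.reg 4 ∧ s'.output n =
        (Finset.univ.filter fun v => (L.nbrs v).length + 1 = s.reg 4).erase v₀ := by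
  unfold outputAllButFirst
  simp only [wp_seq, wp_set, Expr.eval, Expr.cost]
  refine ⟨by omega, ?_⟩
  -- The register `6` is a flag: it tells whether the vertex `v₀` to be left out has already been
  -- met.
  refine wp_forVerts (fun i s' =>
    (s'.reg 6 = 0 ∧ (∀ v : Fin n, v.val < i → (L.nbrs v).length + 1 ≠ s.reg 4) ∧
      ∀ j, s'.arr 2 j = 0) ∨
    (s'.reg 6 = 1 ∧ ∃ v₀ : Fin n, v₀.val < i ∧ (L.nbrs v₀).length + 1 = s.reg 4 ∧
      ∀ v : Fin n, s'.arr 2 v = 1 ↔ v.val < i ∧ (L.nbrs v).length + 1 = s.reg 4 ∧ v ≠ v₀))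
    34 0 (hin.setReg (by norm_num)) (by omega) rfl rfl ⟨rfl, rfl⟩ ?_ ?_ ?_ ?_
  · intro i s' m h; simpa using h
  · left; simpa using h2
  · intro v s' k' hin' hv hf hI
    have hv2 := v.2
    have h4 : s'.reg 4 = s.reg 4 := hf.reg 4 rfl
    simp only [wp_ite, wp_skip, wp_put, wp_set, Expr.eval_ne_ne_zero, Expr.eval_ne_eq_zero,
      Expr.cost_ne, Expr.cost, Expr.cost_deg, Expr.eval, hin'.eval_deg hv, hv, h4]
    refine ⟨fun hne => ⟨by omega, ?_⟩, fun heq => ⟨fun h6 => ⟨by omega, by omega, by omega, ?_⟩,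
      fun h6 => ⟨by omega, by omega, ?_⟩⟩⟩
    · rcases hI with ⟨h6, hno, h0⟩ | ⟨h6, v₀, hv₀, hd, hiff⟩
      · refine .inl ⟨h6, fun u hu => ?_, h0⟩
        rcases Nat.lt_succ_iff_lt_or_eq.1 hu with h | h
        · exact hno u h
        · cases Fin.ext h; exact hne
      · refine .inr ⟨h6, v₀, by omega, hd, fun u => ?_⟩
        rw [hiff]
        refine ⟨fun h => ⟨by omega, h.2⟩, fun h => ⟨?_, h.2⟩⟩
        rcases Nat.lt_succ_iff_lt_or_eq.1 h.1 with h' | h'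
        · exact h'
        · cases Fin.ext h'; exact absurd h.2.1 hne
    · rcases hI with ⟨h6', -⟩ | ⟨h6', v₀, hv₀, hd, hiff⟩
      · exact absurd h6' h6
      · refine .inr ⟨h6', v₀, by omega, hd, fun u => ?_⟩
        simp only [State.arr_setArr, if_true, Function.update_apply]
        split_ifs with h
        · cases Fin.ext h
          simp only [true_iff]
          exact ⟨by omega, heq, fun h => by rw [h] at hv₀; omega⟩
        · rw [hiff]
          refine ⟨fun h' => ⟨by omega, h'.2⟩, fun h' => ⟨by omega, h'.2⟩⟩
    · rcases hI with ⟨h6', hno, h0⟩ | ⟨h6', -⟩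
      · refine .inr ⟨by simp, v, by omega, heq, fun u => ?_⟩
        simp only [State.arr_setReg, h0]
        refine ⟨fun h => by omega, fun h => ?_⟩
        rcases Nat.lt_succ_iff_lt_or_eq.1 h.1 with h' | h'
        · exact absurd h.2.1 (hno u h')
        · exact absurd (Fin.ext h') h.2.2
      · omega
  · intro s' k' hf hin' hI hk
    refine ⟨by omega, ?_⟩
    rcases hI with ⟨h6, hno, h0⟩ | ⟨h6, v₀, hv₀, hd, hiff⟩
    · obtain ⟨v, hv⟩ := hex
      exact absurd hv (hno v v.2)
    · refine ⟨v₀, hd, ?_⟩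
      ext v
      simp [State.output, hiff, and_comm]

/-- For each vertex of a degree smaller than `k`, count the neighbours of degree `k`, where `k` is
in the register `4`. The array `4` receives the result. -/
def countClasses : Prog :=
  .forVerts (.ite (.ne (.deg 1) (.reg 4)) .skip
    (.forNbrs (.ite (.sub (.reg 4) (.deg 3))
      (.put 4 (.reg 3) (.add (.get 4 (.reg 3)) (.const 1))) .skip)))

/-- The counts are accumulated from the other side: each vertex of degree `k` adds one at its
neighbours of smaller degree. -/
theorem wp_countClasses {W : ℕ} {s : State} {k : ℕ} (hin : Input L s)
    (hW : n + L.off n + 2 ≤ W) (h4 : ∀ j, s.arr 4 j = 0) :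
    wp W countClasses s k fun s' k' => k' ≤ k + 6 + 60 * n + 40 * L.off n ∧ Input L s' ∧
      ∀ u : Fin n, s'.arr 4 u = (Finset.univ.filter fun v =>
        u ∈ L.nbrs v ∧ (L.nbrs v).length = s.reg 4 ∧ (L.nbrs u).length < s.reg 4).card := by
  refine wp_forVerts (fun i s' => ∀ u : Fin n, s'.arr 4 u =
    (Finset.univ.filter fun v : Fin n => v.val < i ∧ (u ∈ L.nbrs v ∧
      (L.nbrs v).length = s.reg 4 ∧ (L.nbrs u).length < s.reg 4)).card) 52 40 hin
    (by omega) rfl rfl ⟨rfl, rfl⟩ (fun _ _ _ h => h) (by simp [h4]) ?_ ?_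
  · intro v s' k' hin' hv hf hI
    have hr4 : s'.reg 4 = s.reg 4 := hf.reg 4 rfl
    simp only [wp_ite, wp_skip, Expr.eval_ne_ne_zero, Expr.eval_ne_eq_zero,
      Expr.cost_ne, Expr.cost, Expr.cost_deg, Expr.eval, hin'.eval_deg hv, hr4]
    refine ⟨fun hne => ⟨by omega, fun u => ?_⟩, fun heq => ?_⟩
    · rw [card_filter_lt_succ, if_neg (fun h => hne h.2.1), hI]
      exact (Nat.add_zero _).symm
    · have hcard : ∀ u : Fin n, s'.arr 4 u ≤ n := fun u => by
        rw [hI]; exact (Finset.card_le_univ _).trans_eq (Fintype.card_fin n)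
      refine wp_forNbrs (fun l s'' => ∀ u : Fin n, s''.arr 4 u = s'.arr 4 u +
        if u ∈ l ∧ (L.nbrs u).length < s.reg 4 then 1 else 0) 18 hin' v hv (by omega)
        ⟨rfl, rfl, rfl, rfl, rfl⟩ (fun _ _ _ _ _ h => h) (by simp) ?_ ?_
      · intro l u s'' k'' hl hin'' hv'' hu hf'' hI''
        have hul : u ∉ l := fun h => by
          have := (L.nodup v).sublist hl.sublist
          simp [List.nodup_append] at this
          exact this.2 u h rfl
        have hr4' : s''.reg 4 = s.reg 4 := (hf''.reg 4 rfl).trans hr4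
        simp only [wp_ite, wp_skip, wp_put, Expr.cost, Expr.cost_deg, Expr.eval,
          hin''.eval_deg hu, hr4', hu]
        have hu2 := u.2
        have hcu := hcard u
        have hIu := hI'' u
        rw [if_neg (by simp [hul]), add_zero] at hIu
        refine ⟨fun h => ⟨by omega, by omega, by omega, fun w => ?_⟩, fun h => ⟨by omega,
          fun w => ?_⟩⟩
        · simp only [State.arr_setArr, if_true, Function.update_apply]
          by_cases hw : w = u
          · subst hw
            rw [if_pos rfl, if_pos ⟨by simp, by omega⟩, hIu]
          · rw [if_neg (fun h => hw (Fin.ext h)), hI'']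
            simp [hw]
        · rw [hI'' w]
          by_cases hw : w = u
          · subst hw
            rw [if_neg (by simp [hul]), if_neg (fun h' => by omega)]
          · simp [hw]
      · intro s'' k'' hf'' hin'' hI'' hk
        refine ⟨by omega, fun u => ?_⟩
        rw [hI'', hI, card_filter_lt_succ]
        simp [heq]
  · intro s' k' hf hin' hI hk
    refine ⟨by omega, hin', fun u => ?_⟩
    rw [hI]
    congr 1
    ext v
    simp

/-- Find a vertex for which the array `4` has the least nonzero value. The register `8` receives the
vertex, and the register `7` its value, or zero if there is no such vertex. -/
def findLeast : Prog :=
  .set 7 (.const 0) ;;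
  .forVerts (.ite (.get 4 (.reg 1))
    (.ite (.reg 7)
      (.ite (.sub (.reg 7) (.get 4 (.reg 1))) (.set 7 (.get 4 (.reg 1)) ;; .set 8 (.reg 1)) .skip)
      (.set 7 (.get 4 (.reg 1)) ;; .set 8 (.reg 1)))
    .skip)

theorem wp_findLeast {W : ℕ} {s : State} {k : ℕ} (hin : Input L s)
    (hW : n + L.off n + 2 ≤ W) (h4 : ∀ u : Fin n, s.arr 4 u ≤ n) :
    wp W findLeast s k fun s' k' => k' ≤ k + 8 + 40 * n ∧ Input L s' ∧
      ((s'.reg 7 = 0 ∧ ∀ u : Fin n, s.arr 4 u = 0) ∨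
        (s'.reg 7 ≠ 0 ∧ ∃ u₀ : Fin n, s'.reg 8 = u₀ ∧ s.arr 4 u₀ ≠ 0 ∧
          ∀ u : Fin n, s.arr 4 u ≠ 0 → s.arr 4 u₀ ≤ s.arr 4 u)) := by
  unfold findLeast
  simp only [wp_seq, wp_set, Expr.eval, Expr.cost]
  refine ⟨by omega, ?_⟩
  -- Only nonzero values are ever recorded, so a zero in the register `7` also means that no
  -- candidate has been seen.
  refine wp_forVerts (fun i s' =>
    (s'.reg 7 = 0 ∧ ∀ u : Fin n, u.val < i → s.arr 4 u = 0) ∨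
    (∃ u₀ : Fin n, s'.reg 7 = s.arr 4 u₀ ∧ s'.reg 8 = u₀ ∧ s.arr 4 u₀ ≠ 0 ∧
      ∀ u : Fin n, u.val < i → s.arr 4 u ≠ 0 → s.arr 4 u₀ ≤ s.arr 4 u))
    32 0 (hin.setReg (by norm_num)) (by omega) rfl rfl ⟨rfl, rfl⟩ ?_ ?_ ?_ ?_
  · intro i s' m h; simpa using h
  · left; simp
  · intro v s' k' hin' hv hf hI
    have hv2 := v.2
    have hc := h4 v
    have ha : s'.arr 4 = s.arr 4 := hf.arr 4 rfl
    have hupd : (∀ u : Fin n, u.val < v → s.arr 4 u ≠ 0 → s.arr 4 v ≤ s.arr 4 u) →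
        ∀ u : Fin n, u.val < v + 1 → s.arr 4 u ≠ 0 → s.arr 4 v ≤ s.arr 4 u := by
      intro h u hu hu0
      rcases Nat.lt_succ_iff_lt_or_eq.1 hu with h' | h'
      · exact h u h' hu0
      · cases Fin.ext h'; exact le_rfl
    simp only [wp_ite, wp_skip, wp_seq, wp_set, Expr.cost, Expr.eval, hv, ha, State.reg_setReg,
      Nat.reduceEqDiff, if_false, if_true]
    refine ⟨fun h0 => ⟨fun h7 => ⟨fun hlt => ⟨by omega, by omega, by omega, ?_⟩,
      fun hge => ⟨by omega, ?_⟩⟩, fun h7 => ⟨by omega, by omega, by omega, ?_⟩⟩,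
      fun h0 => ⟨by omega, ?_⟩⟩
    · rcases hI with ⟨h7', -⟩ | ⟨u₀, h7', h8, hu₀, hle⟩
      · exact absurd h7' h7
      · refine .inr ⟨v, rfl, rfl, h0, hupd fun u hu hu0 => ?_⟩
        have := hle u hu hu0
        omega
    · rcases hI with ⟨h7', -⟩ | ⟨u₀, h7', h8, hu₀, hle⟩
      · exact absurd h7' h7
      · refine .inr ⟨u₀, h7', h8, hu₀, fun u hu hu0 => ?_⟩
        rcases Nat.lt_succ_iff_lt_or_eq.1 hu with h' | h'
        · exact hle u h' hu0
        · cases Fin.ext h'; omega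
    · rcases hI with ⟨h7', hz⟩ | ⟨u₀, h7', h8, hu₀, hle⟩
      · refine .inr ⟨v, rfl, rfl, h0, hupd fun u hu hu0 => absurd (hz u hu) hu0⟩
      · omega
    · rcases hI with ⟨h7', hz⟩ | ⟨u₀, h7', h8, hu₀, hle⟩
      · refine .inl ⟨h7', fun u hu => ?_⟩
        rcases Nat.lt_succ_iff_lt_or_eq.1 hu with h' | h'
        · exact hz u h'
        · cases Fin.ext h'; exact h0
      · refine .inr ⟨u₀, h7', h8, hu₀, fun u hu hu0 => ?_⟩
        rcases Nat.lt_succ_iff_lt_or_eq.1 hu with h' | h'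
        · exact hle u h' hu0
        · cases Fin.ext h'; exact absurd h0 hu0
  · intro s' k' hf hin' hI hk
    refine ⟨by omega, hin', ?_⟩
    rcases hI with ⟨h7', hz⟩ | ⟨u₀, h7', h8, hu₀, hle⟩
    · exact .inl ⟨h7', fun u => hz u u.2⟩
    · exact .inr ⟨by omega, u₀, h8, hu₀, fun u => hle u u.2⟩

/-- Output the vertex `u` in the register `8` and all but the first of the neighbours of `u` whose
degree is in the register `4`. -/
def outputClass : Prog :=
  .put 2 (.reg 8) (.const 1) ;; .set 1 (.reg 8) ;; .set 6 (.const 0) ;;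
  .forNbrs (.ite (.ne (.deg 3) (.reg 4)) .skip
    (.ite (.reg 6) (.put 2 (.reg 3) (.const 1)) (.set 6 (.const 1))))

theorem wp_outputClass {W : ℕ} {s : State} {k : ℕ} (hin : Input L s)
    (hW : n + L.off n + 2 ≤ W) (h2 : ∀ j, s.arr 2 j = 0) {u : Fin n} (hu : s.reg 8 = u)
    (hex : ∃ v ∈ L.nbrs u, (L.nbrs v).length = s.reg 4) :
    wp W outputClass s k fun s' k' => k' ≤ k + 30 + 60 * n ∧
      ∃ v₀ ∈ L.nbrs u, (L.nbrs v₀).length = s.reg 4 ∧ s'.output n = insert u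
        ((Finset.univ.filter fun v => v ∈ L.nbrs u ∧ (L.nbrs v).length = s.reg 4).erase v₀) := by
  unfold outputClass
  simp only [wp_seq, wp_put, wp_set, Expr.eval, Expr.cost, State.reg_setArr, hu]
  have hu2 := u.2
  refine ⟨by omega, by omega, by omega, by omega, ?_⟩
  refine wp_forNbrs (fun l s' =>
    (s'.reg 6 = 0 ∧ (∀ v ∈ l, (L.nbrs v).length ≠ s.reg 4) ∧
      ∀ v : Fin n, s'.arr 2 v = 1 ↔ v = u) ∨
    (s'.reg 6 = 1 ∧ ∃ v₀ ∈ l, (L.nbrs v₀).length = s.reg 4 ∧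
      ∀ v : Fin n, s'.arr 2 v = 1 ↔ v = u ∨ v ∈ l ∧ (L.nbrs v).length = s.reg 4 ∧ v ≠ v₀))
    30 (L := L) (v := u) ?_ ?_ (by omega) ⟨rfl, rfl, rfl, rfl, rfl⟩ ?_ ?_ ?_ ?_
  · exact ((hin.setArr (by norm_num) (by norm_num)).setReg (by norm_num)).setReg (by norm_num)
  · simp
  · rintro l s' x m (rfl | rfl) h <;> simpa using h
  · left
    simp [Function.update_apply, h2, Fin.ext_iff]
  · intro l v s' k' hl hin' hr1 hv hf hI
    have hv2 := v.2
    have h4 : s'.reg 4 = s.reg 4 := (hf.reg 4 rfl).trans (by simp)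
    have hvl : v ∉ l := fun h => by
      have := (L.nodup u).sublist hl.sublist
      simp [List.nodup_append] at this
      exact this.2 v h rfl
    simp only [wp_ite, wp_skip, wp_put, wp_set, Expr.eval_ne_ne_zero, Expr.eval_ne_eq_zero,
      Expr.cost_ne, Expr.cost, Expr.cost_deg, Expr.eval, hin'.eval_deg hv, hv, h4]
    refine ⟨fun hne => ⟨by omega, ?_⟩, fun heq => ⟨fun h6 => ⟨by omega, by omega, by omega, ?_⟩,
      fun h6 => ⟨by omega, by omega, ?_⟩⟩⟩
    · rcases hI with ⟨h6, hno, h0⟩ | ⟨h6, v₀, hv₀, hd, hiff⟩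
      · refine .inl ⟨h6, fun w hw => ?_, h0⟩
        rcases List.mem_append.1 hw with h | h
        · exact hno w h
        · cases List.mem_singleton.1 h; exact hne
      · refine .inr ⟨h6, v₀, by simp [hv₀], hd, fun w => ?_⟩
        rw [hiff]
        by_cases hw : w = v
        · subst hw; simp [hne]
        · simp [hw]
    · rcases hI with ⟨h6', -⟩ | ⟨h6', v₀, hv₀, hd, hiff⟩
      · exact absurd h6' h6
      · refine .inr ⟨h6', v₀, by simp [hv₀], hd, fun w => ?_⟩
        simp only [State.arr_setArr, if_true, Function.update_apply]
        split_ifs with h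
        · cases Fin.ext h
          simp only [true_iff]
          exact .inr ⟨by simp, heq, fun h => hvl (h ▸ hv₀)⟩
        · have hw : w ≠ v := fun h' => h (h' ▸ rfl)
          rw [hiff]; simp [hw]
    · rcases hI with ⟨h6', hno, h0⟩ | ⟨h6', -⟩
      · refine .inr ⟨by simp, v, by simp, heq, fun w => ?_⟩
        simp only [State.arr_setReg, h0]
        refine ⟨.inl, fun h => h.resolve_right fun h => ?_⟩
        rcases List.mem_append.1 h.1 with h' | h'
        · exact hno w h' h.2.1
        · exact h.2.2 (List.mem_singleton.1 h')
      · omega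
  · intro s' k' hf hin' hI hk
    have := L.length_nbrs_lt u
    refine ⟨by omega, ?_⟩
    rcases hI with ⟨h6, hno, h0⟩ | ⟨h6, v₀, hv₀, hd, hiff⟩
    · obtain ⟨v, hv, hv'⟩ := hex
      exact absurd hv' (hno v hv)
    · refine ⟨v₀, hv₀, hd, ?_⟩
      ext v
      simp only [State.output, Finset.mem_filter, Finset.mem_univ, true_and, hiff,
        Finset.mem_insert, Finset.mem_erase]
      tauto

/-- The program for PAU-VC on split graphs. -/
def splitProgram : Prog :=
  degreeCounts ;; threshold ;;
  .ite (.sub (.reg 4) (.reg 5))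
    (.ite (.sub (.sub (.reg 4) (.reg 5)) (.const 1)) outputAllButFirst .skip)
    (countClasses ;; findLeast ;; .ite (.reg 7) outputClass .skip)

theorem solvableInLinearTime_isSplit : SolvableInLinearTime fun _ G => IsSplit G := by
  classical
  refine ⟨splitProgram, 1000, fun n G hG L => ?_⟩
  have hoff := L.off_eq
  obtain ⟨A, hA⟩ := hG.exists_isSplitClique
  set W := 1000 * (n + G.edgeSet.ncard + 1) with hWdef
  have hW : n + L.off n + 2 ≤ W := by omega
  suffices H : wp W splitProgram L.init 0 fun s' k' => k' ≤ W ∧ IsSolution G (s'.output n) by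
    obtain ⟨t, s, h1, h2, h3⟩ := H
    exact ⟨t, s, h1, by omega, h3⟩
  have hlen : ∀ v, (L.nbrs v).length = G.degree v := L.length_nbrs
  have hmem : ∀ u v, u ∈ L.nbrs v ↔ G.Adj u v := fun u v => (L.mem_nbrs v u).trans (G.adj_comm _ _)
  have hzero : ∀ s : State, s.arr 2 = L.init.arr 2 → s.output n = ∅ := fun s hs => by
    ext v
    simp [State.output, hs, AdjLists.init]
  have hin := L.input_init
  unfold splitProgram
  simp only [wp_seq, wp_ite]
  refine (wp_degreeCounts hin hW (by simp [AdjLists.init])).mono ?_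
  rintro s₁ k₁ hf₁ ⟨hk₁, hin₁, h3⟩
  refine (wp_threshold hin₁ hW h3).mono ?_
  rintro s₂ k₂ hf₂ ⟨hk₂, h5, h54, hthr⟩
  have hin₂ := hin₁.frame hf₂ rfl rfl rfl
  have h2₂ : s₂.arr 2 = L.init.arr 2 := (hf₂.arr 2 rfl).trans (hf₁.arr 2 rfl)
  have h4₂ : s₂.arr 4 = L.init.arr 4 := (hf₂.arr 4 rfl).trans (hf₁.arr 4 rfl)
  have h20 : ∀ j, s₂.arr 2 j = 0 := by simp [h2₂, AdjLists.init]
  simp only [hlen] at h5 hthr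
  have hk : s₂.reg 4 = A.card := hA.threshold_eq (by omega) hthr
  rw [hk] at h5
  have hsub : (Finset.univ.filter fun v => A.card ≤ G.degree v) ⊆ A := fun v hv => by
    by_contra hvA
    have := hA.degree_lt hvA
    simp only [Finset.mem_filter] at hv
    omega
  simp only [Expr.eval, Expr.cost, hk]
  refine ⟨fun hlt => ?_, fun hge => ?_⟩
  -- The register `5` counts the clique vertices with a neighbour outside, so the difference counts
  -- those without.
  · have hfree : (A.filter fun v => G.degree v + 1 = A.card).card = A.card - s₂.reg 5 := by
      rw [h5, ← Finset.card_sdiff_of_subset hsub]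
      congr 1
      ext v
      simp only [Finset.mem_filter, Finset.mem_sdiff, Finset.mem_univ, true_and]
      refine ⟨fun h => ⟨h.1, by omega⟩, fun h => ⟨h.1, ?_⟩⟩
      have := hA.card_le_degree h.1
      omega
    obtain ⟨a₀, ha₀⟩ := Finset.card_pos.1 (show 0 <
      (A.filter fun v => G.degree v + 1 = A.card).card by omega)
    obtain ⟨ha₀A, hda₀⟩ := Finset.mem_filter.1 ha₀
    refine ⟨fun hmany => ?_, fun hone => ?_⟩
    · refine (wp_outputAllButFirst hin₂ hW h20 ⟨a₀, by rw [hlen, hda₀, hk]⟩).mono ?_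
      rintro s₃ k₃ - ⟨hk₃, v₀, hv₀, hout⟩
      refine ⟨by omega, ?_⟩
      -- The program recognises these clique vertices by their degree alone. This is sound once
      -- there are two of them: an outside vertex is adjacent to neither, so its degree is at most
      -- `A.card - 2`. With only one, an outside vertex may have the same degree, but then the
      -- solution is empty; hence the separate test.
      have hmemA : ∀ v, G.degree v + 1 = A.card → v ∈ A := by
        intro v hv
        by_contra hvA
        obtain ⟨a, ha, hne⟩ := Finset.exists_mem_ne (s := A.filter fun v => G.degree v + 1 = A.card)
          (by omega) a₀
        have hsub2 : G.neighborFinset v ⊆ (A.erase a₀).erase a := by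
          intro x hx
          rw [SimpleGraph.mem_neighborFinset] at hx
          have hxA : x ∈ A := by
            by_contra hxA
            exact hA.indep v x hvA hxA hx
          have hnot : ∀ b ∈ A, G.degree b + 1 = A.card → ¬ G.Adj b v := by
            intro b hb hdb hbv
            have : insert v (A.erase b) ⊆ G.neighborFinset b :=
              Finset.insert_subset (by simpa using hbv) (hA.erase_subset hb)
            have := Finset.card_le_card this
            rw [Finset.card_insert_of_notMem (by simp [hvA]), Finset.card_erase_of_mem hb,
              G.card_neighborFinset_eq_degree] at this
            omega
          refine Finset.mem_erase.2 ⟨?_, Finset.mem_erase.2 ⟨?_, hxA⟩⟩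
          · rintro rfl
            exact hnot _ hxA (Finset.mem_filter.1 ha).2 hx.symm
          · rintro rfl
            exact hnot _ hxA hda₀ hx.symm
        have := Finset.card_le_card hsub2
        rw [Finset.card_erase_of_mem (Finset.mem_erase.2 ⟨hne, (Finset.mem_filter.1 ha).1⟩),
          Finset.card_erase_of_mem ha₀A, G.card_neighborFinset_eq_degree] at this
        omega
      simp only [hlen, hk] at hv₀ hout
      have := hA.isSolution_of_degree_lt (hmemA v₀ hv₀) hv₀
      rw [hout]
      convert this using 2
      ext v
      simp only [Finset.mem_filter, Finset.mem_univ, true_and]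
      exact ⟨fun h => ⟨hmemA v h, h⟩, fun h => h.2⟩
    · rw [wp_skip]
      refine ⟨by omega, ?_⟩
      have := hA.isSolution_of_degree_lt ha₀A hda₀
      rw [hzero s₂ h2₂]
      convert this
      rw [eq_comm, ← Finset.card_eq_zero, Finset.card_erase_of_mem ha₀, hfree]
      omega
  · have hcard : A.card = s₂.reg 5 := by omega
    have hd : ∀ a ∈ A, A.card ≤ G.degree a := fun a ha => by
      rw [← Finset.eq_of_subset_of_card_le hsub (by rw [← h5, hcard])] at ha
      exact (Finset.mem_filter.1 ha).2
    refine (wp_countClasses hin₂ hW (by simp [h4₂, AdjLists.init])).mono ?_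
    rintro s₃ k₃ hf₃ ⟨hk₃, hin₃, h4₃⟩
    have h2₃ : s₃.arr 2 = L.init.arr 2 := (hf₃.arr 2 rfl).trans h2₂
    simp only [hlen, hk, hmem] at h4₃
    have hclass : ∀ u, G.degree u < A.card → s₃.arr 4 u =
        (Finset.univ.filter fun v => G.Adj u v ∧ G.degree v = A.card).card := fun u hu => by
      rw [h4₃]; simp [hu]
    have hle : ∀ u : Fin n, s₃.arr 4 u ≤ n := fun u => by
      rw [h4₃]; exact (Finset.card_le_univ _).trans_eq (Fintype.card_fin n)
    refine (wp_findLeast hin₃ hW hle).mono ?_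
    rintro s₄ k₄ hf₄ ⟨hk₄, hin₄, h7⟩
    have h2₄ : s₄.arr 2 = L.init.arr 2 := (hf₄.arr 2 rfl).trans h2₃
    have hr4 : s₄.reg 4 = A.card := ((hf₄.reg 4 rfl).trans (hf₃.reg 4 rfl)).trans hk
    refine ⟨fun hne => ?_, fun he => ?_⟩
    · rcases h7 with ⟨h7, -⟩ | ⟨-, u, h8, hu0, hmin⟩
      · exact absurd h7 hne
      · obtain ⟨v, hv⟩ := Finset.card_ne_zero.1 (h4₃ u ▸ hu0)
        obtain ⟨huv, hdv, hdu⟩ := (Finset.mem_filter.1 hv).2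
        refine (wp_outputClass hin₄ hW (by simp [h2₄, AdjLists.init]) h8
          ⟨v, (hmem _ _).2 huv.symm, by rw [hlen, hdv, hr4]⟩).mono ?_
        rintro s₅ k₅ - ⟨hk₅, v₀, hv₀, hdv₀, hout⟩
        refine ⟨by omega, ?_⟩
        simp only [hlen, hr4, hmem] at hv₀ hdv₀ hout
        have := hA.isSolution_insert hd hdu hv₀.symm hdv₀ fun w x hdw hwx hdx => by
          rw [← hclass u hdu, ← hclass w hdw]
          refine hmin w ?_
          rw [hclass w hdw]
          exact Finset.card_ne_zero.2 ⟨x, by simp [hwx, hdx]⟩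
        rw [hout]
        convert this using 5
        exact G.adj_comm _ _
    · rw [wp_skip]
      refine ⟨by omega, ?_⟩
      rcases h7 with ⟨-, h7⟩ | ⟨h7, -⟩
      · rw [hzero s₄ h2₄]
        refine hA.isSolution_empty hd fun u v hdu huv hdv => ?_
        have := h7 u
        rw [hclass u hdu, Finset.card_eq_zero] at this
        exact Finset.notMem_empty v (this ▸ by simp [huv, hdv])
      · exact absurd he h7

end SplitProgram

/-! ## Breadth first search -/

section Search

/-- The state of a breadth first search in which the vertices of `d` are finished, those of `w` are
waiting, and those of `R` have been chosen as roots. Vertices of level zero are still unvisited. -/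
structure IsSearch {V : Type*} (G : SimpleGraph V) (lev : V → ℕ) (d w : List V) (R : Set V) :
    Prop where
  nodup : (d ++ w).Nodup
  sorted : (d ++ w).Pairwise fun a b => lev a ≤ lev b
  visited : ∀ v, lev v ≠ 0 ↔ v ∈ d ++ w
  bound : ∀ v, lev v ≤ (d ++ w).length
  parent : ∀ v ∈ d ++ w, v ∈ R ∨ ∃ p, lev p ≠ 0 ∧ G.Adj p v ∧ lev p + 1 = lev v
  root : ∀ r ∈ R, ∀ r' ∈ R, G.Reachable r r' → r = r'
  root_mem : ∀ r ∈ R, r ∈ d ++ w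
  closed : ∀ a ∈ d, ∀ u, G.Adj a u → u ∈ d ++ w ∧ lev u ≤ lev a + 1
  near : ∀ v ∈ w.head?, ∀ a ∈ w, lev a ≤ lev v + 1

/-! ### Queue operations preserve the search invariant -/

namespace IsSearch

variable {V : Type*} {G : SimpleGraph V} {lev : V → ℕ} {d w : List V} {R : Set V}

theorem nil : IsSearch G (fun _ => 0) [] [] ∅ where
  nodup := by simp
  sorted := by simp
  visited := by simp
  bound := by simp
  parent := by simp
  root := by simp
  root_mem := by simp
  closed := by simp
  near := by simp

theorem le_of_mem {v : V} (h : IsSearch G lev d (v :: w) R) {a : V} (ha : a ∈ d ++ v :: w) :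
    lev a ≤ lev v + 1 := by
  rcases List.mem_append.1 ha with ha | ha
  · have := (List.pairwise_append.1 h.sorted).2.2 a ha v (by simp)
    omega
  · exact h.near v (by simp) a ha

variable [DecidableEq V]

/-- The levels in the queue exceed that of its head by at most one, so appending a vertex of level
`lev v + 1` keeps the list sorted. -/
theorem push {u v : V} (h : IsSearch G lev d (v :: w) R) (hvu : G.Adj v u)
    (hu : u ∉ d ++ v :: w) :
    IsSearch G (Function.update lev u (lev v + 1)) d (v :: (w ++ [u])) R := by
  have happ : d ++ v :: (w ++ [u]) = (d ++ v :: w) ++ [u] := by simp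
  have hne : ∀ a ∈ d ++ v :: w, Function.update lev u (lev v + 1) a = lev a := fun a ha =>
    Function.update_of_ne (by rintro rfl; exact hu ha) _ _
  have hv : v ∈ d ++ v :: w := by simp
  refine ⟨?_, ?_, ?_, ?_, ?_, h.root, ?_, ?_, ?_⟩ <;> try rw [happ]
  · rw [List.nodup_append]
    refine ⟨h.nodup, by simp, fun a ha b hb hab => ?_⟩
    rw [List.mem_singleton] at hb
    exact hu (hb ▸ hab ▸ ha)
  · rw [List.pairwise_append]
    refine ⟨h.sorted.imp_of_mem fun ha hb hab => by rwa [hne _ ha, hne _ hb], by simp, ?_⟩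
    intro a ha b hb
    rw [List.mem_singleton] at hb
    subst hb
    rw [hne a ha, Function.update_self]
    exact h.le_of_mem ha
  · intro a
    by_cases ha : a = u
    · subst ha; simp
    · rw [Function.update_of_ne ha, h.visited]; simp [ha]
  · intro a
    rw [List.length_append]
    by_cases ha : a = u
    · subst ha
      rw [Function.update_self]
      exact Nat.succ_le_succ (h.bound v)
    · rw [Function.update_of_ne ha]
      exact (h.bound a).trans (Nat.le_add_right _ _)
  · intro a ha
    rcases List.mem_append.1 ha with ha | ha
    · refine (h.parent a ha).imp_right ?_
      rintro ⟨p, hp, hpa, hl⟩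
      exact ⟨p, by rwa [hne p ((h.visited p).1 hp)], hpa, by
        rwa [hne p ((h.visited p).1 hp), hne a ha]⟩
    · rw [List.mem_singleton] at ha
      subst ha
      refine .inr ⟨v, ?_, hvu, ?_⟩
      · rw [hne v hv]; exact (h.visited v).2 hv
      · rw [hne v hv, Function.update_self]
  · exact fun r hr => List.mem_append_left _ (h.root_mem r hr)
  · intro a ha x hax
    obtain ⟨h1, h2⟩ := h.closed a ha x hax
    rw [hne x h1, hne a (List.mem_append_left _ ha)]
    exact ⟨List.mem_append_left _ h1, h2⟩
  · intro x hx a ha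
    simp only [List.head?_cons, Option.mem_def, Option.some.injEq] at hx
    subst hx
    rw [← List.cons_append, List.mem_append, List.mem_singleton] at ha
    rcases ha with ha | rfl
    · rw [hne _ (List.mem_append_right _ ha), hne _ hv]
      exact h.near _ rfl a ha
    · rw [Function.update_self, hne _ hv]

/-- With nothing waiting, the finished vertices form a union of components, so the next root lies in
a new one. -/
theorem mem_of_reachable (h : IsSearch G lev d [] R) {a b : V} (ha : a ∈ d)
    (hab : G.Reachable a b) : b ∈ d := by
  obtain ⟨p⟩ := hab
  induction p with
  | nil => exact ha
  | cons hadj p ih => exact ih (by simpa using (h.closed _ ha _ hadj).1)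

/-- A new root starts at the level `d.length + 1` rather than at a fixed level. By `bound` this is
above all levels used so far, so one sorted queue serves all components, and it is nonzero, which
marks the root as visited. -/
theorem pushRoot {u : V} (h : IsSearch G lev d [] R) (hu : u ∉ d) :
    IsSearch G (Function.update lev u (d.length + 1)) d [u] (insert u R) := by
  have hmem : ∀ a, lev a ≠ 0 ↔ a ∈ d := by simpa using h.visited
  have hbd : ∀ a, lev a ≤ d.length := by simpa using h.bound
  have hne : ∀ a ∈ d, Function.update lev u (d.length + 1) a = lev a := fun a ha =>
    Function.update_of_ne (by rintro rfl; exact hu ha) _ _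
  have hRd : ∀ r ∈ R, r ∈ d := by simpa using h.root_mem
  refine ⟨?_, ?_, ?_, ?_, ?_, ?_, ?_, ?_, ?_⟩
  · rw [List.nodup_append]
    refine ⟨by simpa using h.nodup, by simp, fun a ha b hb hab => ?_⟩
    rw [List.mem_singleton] at hb
    exact hu (hb ▸ hab ▸ ha)
  · rw [List.pairwise_append]
    refine ⟨(by simpa using h.sorted : d.Pairwise fun a b => lev a ≤ lev b).imp_of_mem
      fun ha hb hab => by rwa [hne _ ha, hne _ hb], by simp, ?_⟩
    intro a ha b hb
    rw [List.mem_singleton] at hb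
    subst hb
    rw [hne a ha, Function.update_self]
    exact (hbd a).trans (Nat.le_succ _)
  · intro a
    by_cases ha : a = u
    · subst ha; simp
    · rw [Function.update_of_ne ha, hmem]; simp [ha]
  · intro a
    rw [List.length_append]
    by_cases ha : a = u
    · subst ha; simp
    · rw [Function.update_of_ne ha]
      exact (hbd a).trans (Nat.le_add_right _ _)
  · intro a ha
    rcases List.mem_append.1 ha with ha | ha
    · refine (h.parent a (by simpa using ha)).imp (Set.mem_insert_of_mem _) ?_
      rintro ⟨p, hp, hpa, hl⟩
      exact ⟨p, by rwa [hne p ((hmem p).1 hp)], hpa, by rwa [hne p ((hmem p).1 hp), hne a ha]⟩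
    · rw [List.mem_singleton] at ha
      exact .inl (ha ▸ Set.mem_insert _ _)
  · rintro r (rfl | hr) r' (rfl | hr') hrr
    · rfl
    · exact absurd (h.mem_of_reachable (hRd _ hr') hrr.symm) hu
    · exact absurd (h.mem_of_reachable (hRd _ hr) hrr) hu
    · exact h.root r hr r' hr' hrr
  · rintro r (rfl | hr)
    · simp
    · simp [hRd r hr]
  · intro a ha x hax
    obtain ⟨h1, h2⟩ := h.closed a ha x hax
    rw [List.append_nil] at h1
    rw [hne x h1, hne a ha]
    exact ⟨List.mem_append_left _ h1, h2⟩
  · intro x hx a ha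
    simp only [List.head?_cons, Option.mem_def, Option.some.injEq] at hx
    rw [List.mem_singleton] at ha
    subst hx ha
    omega

omit [DecidableEq V] in
theorem pop {v : V} (h : IsSearch G lev d (v :: w) R)
    (hv : ∀ u, G.Adj v u → u ∈ d ++ v :: w ∧ lev u ≤ lev v + 1) :
    IsSearch G lev (d ++ [v]) w R := by
  have happ : d ++ [v] ++ w = d ++ v :: w := by simp
  refine ⟨?_, ?_, ?_, ?_, ?_, h.root, ?_, ?_, ?_⟩ <;> try rw [happ]
  · exact h.nodup
  · exact h.sorted
  · exact h.visited
  · exact h.bound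
  · exact h.parent
  · exact h.root_mem
  · intro a ha
    rcases List.mem_append.1 ha with ha | ha
    · exact h.closed a ha
    · rw [List.mem_singleton] at ha
      exact ha ▸ hv
  · intro x hx a ha
    have h1 := h.near v (by simp) a (by simp [ha])
    have h2 := (List.pairwise_cons.1 (List.pairwise_append.1 h.sorted).2.1).1 x
      (List.mem_of_mem_head? hx)
    omega

omit [DecidableEq V] in
theorem isLayering (h : IsSearch G lev d [] R) (hall : ∀ v, lev v ≠ 0) : IsLayering G lev R := by
  have hd : ∀ v, v ∈ d := fun v => by simpa using (h.visited v).1 (hall v)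
  refine ⟨fun u v huv => (h.closed v (hd v) u huv.symm).2, fun v => ?_, h.root⟩
  exact (h.parent v ((h.visited v).1 (hall v))).imp_right fun ⟨p, _, h1, h2⟩ => ⟨p, h1, h2⟩

end IsSearch

/-- Visit the vertex in the register `3` if it has not been visited yet. Here the register `1` holds
its parent, the register `5` the number of visited vertices, the array `3` the levels, and the array
`4` the queue. -/
def visitChild : Prog :=
  .ite (.get 3 (.reg 3)) .skip
    (.put 3 (.reg 3) (.add (.get 3 (.reg 1)) (.const 1)) ;; .put 4 (.reg 5) (.reg 3) ;;
      .set 5 (.add (.reg 5) (.const 1)))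

/-- Breadth first search from all vertices that have not been reached before. -/
def search : Prog :=
  .set 4 (.const 0) ;; .set 5 (.const 0) ;; .set 6 (.const 0) ;;
  .loop (.add (.sub (.reg 0) (.reg 6)) (.sub (.reg 5) (.reg 4)))
    (.ite (.sub (.reg 5) (.reg 4))
      (.set 1 (.get 4 (.reg 4)) ;; visitChild.forNbrs ;; .set 4 (.add (.reg 4) (.const 1)))
      (.ite (.get 3 (.reg 6)) .skip
        (.put 4 (.reg 5) (.reg 6) ;; .set 5 (.add (.reg 5) (.const 1)) ;; .put 3 (.reg 6) (.reg 5)) ;;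
        .set 6 (.add (.reg 6) (.const 1))))

variable {n : ℕ} {G : SimpleGraph (Fin n)} {L : AdjLists G}

/-- The array `4` and the register `5` hold the list `q` of vertices and its length. -/
def HoldsQueue (q : List (Fin n)) (s : State) : Prop :=
  s.reg 5 = q.length ∧ ∀ j a, q[j]? = some a → s.arr 4 j = a.val

theorem HoldsQueue.push {q : List (Fin n)} {s s' : State} (h : HoldsQueue q s) {u : Fin n}
    (h5 : s'.reg 5 = q.length + 1) (h4 : s'.arr 4 = Function.update (s.arr 4) q.length u) :
    HoldsQueue (q ++ [u]) s' := by
  refine ⟨by simpa using h5, fun j a hj => ?_⟩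
  rw [h4, Function.update_apply]
  split_ifs with hjq
  · subst hjq
    simp only [List.getElem?_concat_length, Option.some.injEq] at hj
    rw [hj]
  · refine h.2 j a ?_
    rw [List.getElem?_append] at hj
    split_ifs at hj with hlt
    · exact hj
    · obtain ⟨h1, -⟩ := List.getElem?_eq_some_iff.1 hj
      simp at h1
      omega

theorem update_val {f : ℕ → ℕ} {u : Fin n} {x : ℕ} :
    (fun v : Fin n => Function.update f u x v) = Function.update (fun v : Fin n => f v) u x := by
  ext v
  simp [Function.update_apply, Fin.ext_iff]

theorem sum_map_le_sum (f : Fin n → ℕ) {d : List (Fin n)} (hd : d.Nodup) :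
    (d.map f).sum ≤ ∑ v, f v := by
  rw [← List.sum_toFinset _ hd]
  exact Finset.sum_le_sum_of_subset (Finset.subset_univ _)

theorem length_le_of_nodup {d : List (Fin n)} (hd : d.Nodup) : d.length ≤ n := by
  simpa using hd.length_le_card

theorem wp_visitChildren {W : ℕ} {s : State} {k : ℕ} (hin : Input L s) (hW : n + L.off n + 2 ≤ W)
    {v : Fin n} (hv : s.reg 1 = v) {d w : List (Fin n)} {R : Set (Fin n)}
    (hs : IsSearch G (fun v => s.arr 3 v) d (v :: w) R) (hq : HoldsQueue (d ++ v :: w) s) :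
    wp W visitChild.forNbrs s k fun s' k' => k' ≤ k + 10 + 40 * (L.nbrs v).length ∧
      ∃ w', IsSearch G (fun v => s'.arr 3 v) (d ++ [v]) w' R ∧
        HoldsQueue (d ++ [v] ++ w') s' ∧ w ⊆ w' := by
  refine wp_forNbrs (fun l s' => ∃ w', IsSearch G (fun v => s'.arr 3 v) d (v :: w') R ∧
    HoldsQueue (d ++ v :: w') s' ∧ w ⊆ w' ∧ ∀ u ∈ l, u ∈ d ++ v :: w') 26 hin v hv (by omega)
    ⟨rfl, rfl, rfl, rfl, rfl⟩ ?_ ⟨w, hs, hq, List.Subset.refl w, by simp⟩ ?_ ?_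
  · rintro l s' x m (rfl | rfl) h <;> simpa [HoldsQueue] using h
  · rintro l u s' k' hl hin' h1 h3 hf ⟨w', hs', hq', hww, hl'⟩
    have hadj : G.Adj v u := (L.mem_nbrs v u).1 (hl.subset (by simp))
    have hu2 := u.2
    have hlen := length_le_of_nodup hs'.nodup
    have hbd := hs'.bound v
    unfold visitChild
    simp only [wp_ite, wp_skip, wp_seq, wp_put, wp_set, Expr.eval, Expr.cost, h1, h3,
      State.reg_setArr]
    refine ⟨fun h0 => ⟨by omega, w', hs', hq', hww, fun x hx => ?_⟩, fun h0 => ?_⟩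
    · rcases List.mem_append.1 hx with hx | hx
      · exact hl' x hx
      · rw [List.mem_singleton] at hx
        exact hx ▸ (hs'.visited u).1 h0
    · have hu : u ∉ d ++ v :: w' := fun h => (hs'.visited u).2 h h0
      have hlen' : (d ++ v :: w').length < n := by
        have := length_le_of_nodup (hs'.push hadj hu).nodup
        simp only [List.length_append, List.length_cons, List.length_nil] at this ⊢
        omega
      have h5 := hq'.1
      refine ⟨by omega, by omega, by omega, by omega, by omega, by omega, w' ++ [u], ?_, ?_,
        List.subset_append_of_subset_left _ hww, ?_⟩
      · have := hs'.push hadj hu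
        rw [← update_val] at this
        simpa using this
      · rw [← List.cons_append, ← List.append_assoc]
        refine hq'.push (by simp [h5]) (by simp [h5])
      · intro x hx
        rw [← List.cons_append, ← List.append_assoc]
        rcases List.mem_append.1 hx with hx | hx
        · exact List.mem_append_left _ (hl' x hx)
        · exact List.mem_append_right _ hx
  · rintro s' k' hf hin' ⟨w', hs', hq', hww, hl'⟩ hk
    refine ⟨by omega, w', hs'.pop fun u hu => ?_, by simpa using hq', hww⟩
    have := hl' u ((L.mem_nbrs v u).2 hu)
    exact ⟨this, hs'.le_of_mem this⟩

theorem wp_search {W : ℕ} {s : State} {k : ℕ} (hin : Input L s) (hW : n + L.off n + 2 ≤ W)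
    (h3 : ∀ j, s.arr 3 j = 0) :
    wp W search s k fun s' k' => k' ≤ k + 20 + 100 * n + 40 * L.off n ∧ Input L s' ∧
      (∀ v : Fin n, s'.arr 3 v ≤ n) ∧ ∃ R, IsLayering G (fun v => s'.arr 3 v) R := by
  unfold search
  simp only [wp_seq, wp_set, Expr.eval, Expr.cost]
  refine ⟨by omega, by omega, by omega, ?_⟩
  -- The registers `4` and `6` are the head of the queue and the next candidate for a root. Every
  -- round advances one of them, which gives both the measure and the amortised bound on the time.
  refine wp_loop (fun s' k' => Input L s' ∧ ∃ d w R,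
    IsSearch G (fun v => s'.arr 3 v) d w R ∧ HoldsQueue (d ++ w) s' ∧ s'.reg 4 = d.length ∧
    s'.reg 6 ≤ n ∧ (∀ v : Fin n, v.val < s'.reg 6 → v ∈ d ++ w) ∧
    k' ≤ k + 6 + 50 * s'.reg 6 + 50 * d.length + 40 * (d.map fun v => (L.nbrs v).length).sum)
    (fun s' => (n - s'.reg 6) + (n - s'.reg 4)) ?_ ?_ ?_
  · refine ⟨((hin.setReg (by norm_num)).setReg (by norm_num)).setReg (by norm_num), [], [], ∅,
      ?_, ?_, ?_⟩
    · convert IsSearch.nil using 1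
      ext v
      simp [h3]
    · simp [HoldsQueue]
    · simp
  · rintro s' k' - ⟨hin', d, w, R, hs, hq, h4, h6, hr, hk⟩ hne
    have hlen := length_le_of_nodup hs.nodup
    have hq5 := hq.1
    rw [List.length_append] at hlen hq5
    simp only [Expr.eval, hin'.reg, hq5, h4] at hne
    rw [wp_ite]
    simp only [Expr.eval, Expr.cost, hq5, h4]
    refine ⟨fun hw => ?_, fun hw => ?_⟩
    · obtain ⟨v, w, rfl⟩ : ∃ v w', w = v :: w' := List.exists_cons_of_ne_nil (by
        rintro rfl; simp at hw)
      have hv : s'.arr 4 d.length = v := hq.2 _ _ (by simp)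
      have hv2 := v.2
      simp only [wp_seq, wp_set, Expr.eval, Expr.cost, h4, hv]
      refine ⟨by omega, ?_⟩
      refine (wp_visitChildren (v := v) (hin'.setReg (by norm_num)) hW (by simp) (by simpa using hs)
        (by simpa [HoldsQueue] using hq)).mono ?_
      rintro s'' k'' hf ⟨hk'', w', hs', hq', hww⟩
      have hin'' := (hin'.setReg (x := 1) (k := v) (by norm_num)).frame hf rfl rfl rfl
      have h4' : s''.reg 4 = d.length := (hf.reg 4 rfl).trans (by simpa using h4)
      have h6' : s''.reg 6 = s'.reg 6 := (hf.reg 6 rfl).trans (by simp)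
      have hlen' := length_le_of_nodup hs'.nodup
      simp only [List.length_append, List.length_cons, List.length_nil] at hlen hlen'
      simp only [h4', h6', State.reg_setReg, if_true, Nat.reduceEqDiff, if_false]
      refine ⟨by omega, ⟨hin''.setReg (by norm_num), d ++ [v], w', R, hs', ?_, by simp, h6, ?_,
        ?_⟩, by omega⟩
      · simpa [HoldsQueue] using hq'
      · intro x hx
        have := hr x hx
        simp only [List.mem_append, List.mem_cons, List.not_mem_nil, or_false] at this ⊢
        rcases this with h | h | h
        · exact .inl (.inl h)
        · exact .inl (.inr h)
        · exact .inr (hww h)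
      · simp only [List.length_append, List.length_cons, List.length_nil, List.map_append,
          List.map_cons, List.map_nil, List.sum_append, List.sum_cons, List.sum_nil]
        omega
    · obtain rfl : w = [] := List.length_eq_zero_iff.1 (by omega)
      have hr6 : s'.reg 6 < n := by omega
      simp only [List.append_nil] at hr hq
      simp only [List.length_nil, Nat.add_zero] at hq5 hlen
      simp only [wp_seq, wp_ite, wp_skip, wp_put, wp_set, Expr.eval, Expr.cost, hq5,
        State.reg_setReg, State.reg_setArr, if_true, Nat.reduceEqDiff, if_false]
      refine ⟨fun h0 => ⟨by omega, ⟨hin'.setReg (by norm_num), d, [], R, hs, ?_, h4, by omega, ?_,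
        by omega⟩, by omega⟩, fun h0 => ?_⟩
      · simpa [HoldsQueue] using hq
      · intro x hx
        rw [List.append_nil]
        rcases Nat.lt_succ_iff_lt_or_eq.1 hx with hx | hx
        · exact hr x hx
        · rw [← hx] at h0
          simpa using (hs.visited x).1 h0
      · have hu : (⟨s'.reg 6, hr6⟩ : Fin n) ∉ d := fun h =>
          (hs.visited _).2 (by simpa using h) h0
        have hs' := hs.pushRoot hu
        have hlen' := length_le_of_nodup hs'.nodup
        simp only [List.length_append, List.length_cons, List.length_nil] at hlen'
        refine ⟨by omega, by omega, by omega, by omega, by omega, by omega,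
          ⟨?_, d, [⟨s'.reg 6, hr6⟩], insert ⟨s'.reg 6, hr6⟩ R, ?_, ?_, h4, by omega, ?_,
          by omega⟩, by omega⟩
        · exact (((hin'.setArr (by norm_num) (by norm_num)).setReg (by norm_num)).setArr
            (by norm_num) (by norm_num)).setReg (by norm_num)
        · rw [← update_val] at hs'
          simpa using hs'
        · exact hq.push (by simp) (by simp)
        · intro x hx
          rcases Nat.lt_succ_iff_lt_or_eq.1 hx with hx | hx
          · exact List.mem_append_left _ (hr x hx)
          · exact List.mem_append_right _ (List.mem_singleton.2 (Fin.ext hx))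
  · rintro s' k' - ⟨hin', d, w, R, hs, hq, h4, h6, hr, hk⟩ he
    have hlen := length_le_of_nodup hs.nodup
    have hq5 := hq.1
    rw [List.length_append] at hlen hq5
    simp only [Expr.eval, hin'.reg, hq5, h4, Expr.cost] at he ⊢
    obtain rfl : w = [] := List.length_eq_zero_iff.1 (by omega)
    have hsum := sum_map_le_sum (fun v => (L.nbrs v).length) (by simpa using hs.nodup : d.Nodup)
    rw [L.sum_length_nbrs] at hsum
    refine ⟨by omega, hin', fun v => (hs.bound v).trans (length_le_of_nodup hs.nodup), R,
      hs.isLayering fun v => (hs.visited v).2 (hr v (by have := v.2; omega))⟩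

end Search

/-! ## Counting sort -/

section CountingSort

variable {n : ℕ} {G : SimpleGraph (Fin n)} {L : AdjLists G}

/-- The permutation that stably sorts by the key `K`. -/
theorem exists_rank (K : Fin n → ℕ) : ∃ ρ : Equiv.Perm (Fin n),
    (∀ j, (ρ j).val = (Finset.univ.filter fun i => K i < K j).card +
      (Finset.univ.filter fun i : Fin n => i.val < j.val ∧ K i = K j).card) ∧
    ∀ a b, ρ a < ρ b → K a < K b ∨ K a = K b ∧ a < b := by
  -- The items sorted before `j`. Its size is the rank of `j`, and ranks are distinct because these
  -- sets are strictly nested.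
  let B : Fin n → Finset (Fin n) := fun j =>
    Finset.univ.filter fun i => K i < K j ∨ i.val < j.val ∧ K i = K j
  have hB : ∀ i j, i ∈ B j ↔ K i < K j ∨ i.val < j.val ∧ K i = K j := fun i j => by simp [B]
  have hcard : ∀ j, (B j).card = (Finset.univ.filter fun i => K i < K j).card +
      (Finset.univ.filter fun i : Fin n => i.val < j.val ∧ K i = K j).card := by
    intro j
    rw [← Finset.card_union_of_disjoint, ← Finset.filter_or]
    rw [Finset.disjoint_filter]
    intros; omega
  have hmono : ∀ i j, i ∈ B j → (B i).card < (B j).card := by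
    intro i j hij
    refine Finset.card_lt_card ((Finset.ssubset_iff_of_subset fun x hx => ?_).2 ⟨i, hij, ?_⟩)
    · rw [hB] at *; omega
    · rw [hB]; omega
  have htri : ∀ i j, i ∈ B j ∨ i = j ∨ j ∈ B i := fun i j => by
    rw [hB, hB, Fin.ext_iff]; omega
  have hlt : ∀ j, (B j).card < n := fun j => by
    have : (B j).card < (Finset.univ : Finset (Fin n)).card :=
      Finset.card_lt_card ((Finset.ssubset_iff_of_subset (Finset.subset_univ _)).2
        ⟨j, Finset.mem_univ _, by rw [hB]; omega⟩)
    simpa using this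
  have hinj : Function.Injective fun j => (⟨(B j).card, hlt j⟩ : Fin n) := by
    intro i j hij
    have hij' : (B i).card = (B j).card := by simpa using hij
    rcases htri i j with h | h | h
    · have := hmono _ _ h; omega
    · exact h
    · have := hmono _ _ h; omega
  refine ⟨Equiv.ofBijective _ (Finite.injective_iff_bijective.1 hinj), fun j => hcard j,
    fun a b hab => ?_⟩
  have hab' : (B a).card < (B b).card := by simpa using hab
  rcases htri a b with h | h | h
  · rw [hB] at h
    rcases h with h | h
    · exact .inl h
    · exact .inr ⟨h.2, h.1⟩
  · rw [h] at hab'; omega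
  · have := hmono _ _ h; omega

/-- Sort the list of all vertices in the array `7` stably by the keys in the array `5`. The array
`8` receives the sorted list. -/
def countingSort : Prog :=
  .forRange 4 (.const 0) (.add (.reg 0) (.const 1)) (.put 6 (.reg 4) (.const 0)) ;;
  .forVerts (.put 6 (.get 5 (.reg 1)) (.add (.get 6 (.get 5 (.reg 1))) (.const 1))) ;;
  .set 5 (.const 0) ;;
  .forRange 4 (.const 0) (.add (.reg 0) (.const 1))
    (.set 6 (.get 6 (.reg 4)) ;; .put 6 (.reg 4) (.reg 5) ;; .set 5 (.add (.reg 5) (.reg 6))) ;;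
  .forVerts (.set 4 (.get 7 (.reg 1)) ;; .set 5 (.get 5 (.reg 4)) ;;
    .put 8 (.get 6 (.reg 5)) (.reg 4) ;; .put 6 (.reg 5) (.add (.get 6 (.reg 5)) (.const 1)))

/-- Ties keep their order in `σ`; this stability is what turns two passes into a lexicographic sort.
-/
theorem wp_countingSort {W : ℕ} {s : State} {k : ℕ} (hin : Input L s) (hW : n + L.off n + 2 ≤ W)
    (hK : ∀ v : Fin n, s.arr 5 v ≤ n) (σ : Equiv.Perm (Fin n))
    (hσ : ∀ j : Fin n, s.arr 7 j = σ j) :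
    wp W countingSort s k fun s' k' => k' ≤ k + 100 + 100 * n ∧ Input L s' ∧
      ∃ σ' : Equiv.Perm (Fin n), (∀ j : Fin n, s'.arr 8 j = σ' j) ∧
        ∀ u v, σ'.symm u < σ'.symm v → s.arr 5 u < s.arr 5 v ∨
          s.arr 5 u = s.arr 5 v ∧ σ.symm u < σ.symm v := by
  have hle : ∀ (p : Fin n → Prop) [DecidablePred p], (Finset.univ.filter p).card ≤ n :=
    fun p _ => (Finset.card_le_univ _).trans_eq (Fintype.card_fin n)
  have hlt : ∀ (p : Fin n → Prop) [DecidablePred p] (v : Fin n), ¬ p v →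
      (Finset.univ.filter p).card < n := fun p _ v hv => by
    have := Finset.card_lt_card (Finset.filter_ssubset.2 ⟨v, Finset.mem_univ v, hv⟩)
    simpa using this
  obtain ⟨ρ, hρ, hρlt⟩ := exists_rank fun j => s.arr 5 (σ j)
  have hcount : ∀ m, (Finset.univ.filter fun i => s.arr 5 (σ i) < m).card =
      (Finset.univ.filter fun v : Fin n => s.arr 5 v < m).card := fun m =>
    Finset.card_equiv σ (by simp)
  unfold countingSort
  rw [wp_seq]
  refine wp_forRange (fun i s' => ∀ j < i, s'.arr 6 j = 0) (fun _ => 3) (lo := 0) (hi := n + 1)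
    rfl (Nat.zero_le _) (by omega) ?_ rfl (fun _ _ _ h => h) (by simp) ?_ ?_
  · intro s' hf
    simp only [Expr.eval]
    rw [hf.reg 0 rfl, hin.reg]
  · intro i s' k' _ hi h4 hf hI
    rw [wp_put]
    simp only [Expr.eval, Expr.cost, h4]
    refine ⟨by omega, by omega, by omega, fun j hj => ?_⟩
    simp only [State.arr_setArr, if_true, Function.update_apply]
    split_ifs with h
    · rfl
    · exact hI j (by omega)
  rintro s₁ k₁ hf₁ h6₁ hk₁
  simp only [Finset.sum_const, Nat.card_Ico, smul_eq_mul, Expr.cost] at hk₁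
  have hin₁ := hin.frame hf₁ rfl rfl rfl
  have h5₁ : s₁.arr 5 = s.arr 5 := hf₁.arr 5 rfl
  have h7₁ : s₁.arr 7 = s.arr 7 := hf₁.arr 7 rfl
  rw [wp_seq]
  refine wp_forVerts (fun i s' => ∀ j ≤ n, s'.arr 6 j =
    (Finset.univ.filter fun v : Fin n => v.val < i ∧ s.arr 5 v = j).card) 10 0 hin₁ (by omega)
    rfl rfl ⟨rfl, rfl⟩ (fun _ _ _ h => h) (fun j hj => by simp [h6₁ j (by omega)]) ?_ ?_
  · intro v s' k' hin' hv hf hI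
    have h5 : s'.arr 5 = s.arr 5 := (hf.arr 5 rfl).trans h5₁
    have hKv := hK v
    have hc := hle fun u : Fin n => u.val < v ∧ s.arr 5 u = s.arr 5 v
    rw [wp_put]
    simp only [Expr.eval, Expr.cost, hv, h5, hI _ (hK v)]
    refine ⟨by omega, by omega, by omega, fun j hj => ?_⟩
    rw [card_filter_lt_succ]
    simp only [State.arr_setArr, if_true, Function.update_apply]
    split_ifs with h1 h2 h2
    · rw [h1]
    · exact absurd h1.symm h2
    · exact absurd h2.symm h1
    · rw [hI j hj, Nat.add_zero]
  rintro s₂ k₂ hf₂ hin₂ h6₂ hk₂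
  have h5₂ : s₂.arr 5 = s.arr 5 := (hf₂.arr 5 rfl).trans h5₁
  have h7₂ : s₂.arr 7 = s.arr 7 := (hf₂.arr 7 rfl).trans h7₁
  simp only [Fin.is_lt, true_and] at h6₂
  rw [wp_seq, wp_set, wp_seq]
  simp only [Expr.eval, Expr.cost]
  refine ⟨by omega, ?_⟩
  -- Prefix sums in place: cells below `i` already hold the number of smaller keys, the others still
  -- hold the frequency of their key. Keys run from `0` to `n`, hence `n + 1` cells.
  refine wp_forRange (fun i s' =>
    s'.reg 5 = (Finset.univ.filter fun v : Fin n => s.arr 5 v < i).card ∧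
    ∀ j ≤ n, s'.arr 6 j = if j < i then (Finset.univ.filter fun v : Fin n => s.arr 5 v < j).card
      else (Finset.univ.filter fun v : Fin n => s.arr 5 v = j).card)
    (fun _ => 12) (lo := 0) (hi := n + 1) rfl (Nat.zero_le _) (by omega) ?_ rfl ?_ ?_ ?_ ?_
  · intro s' hf
    simp only [Expr.eval]
    rw [hf.reg 0 rfl]
    simp [hin₂.reg]
  · intro i s' m h; simpa using h
  · simpa using h6₂
  · rintro i s' k' - hi h4 hf ⟨h5, h6⟩
    have hsum : (Finset.univ.filter fun v : Fin n => s.arr 5 v < i + 1).card =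
        (Finset.univ.filter fun v : Fin n => s.arr 5 v < i).card +
        (Finset.univ.filter fun v : Fin n => s.arr 5 v = i).card := by
      rw [← Finset.card_union_of_disjoint, ← Finset.filter_or]
      · simp only [Nat.lt_succ_iff_lt_or_eq]
      · rw [Finset.disjoint_filter]
        intros; omega
    have h6i := h6 i (by omega)
    rw [if_neg (lt_irrefl i)] at h6i
    have h1 := hle fun v : Fin n => s.arr 5 v < i
    have h2 := hle fun v : Fin n => s.arr 5 v = i
    have h3 := hle fun v : Fin n => s.arr 5 v < i + 1
    simp only [wp_seq, wp_set, wp_put, Expr.eval, Expr.cost, h4, h5, h6i, State.reg_setReg,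
      State.reg_setArr, Nat.reduceEqDiff, if_true, if_false]
    refine ⟨by omega, by omega, by omega, by omega, by omega, hsum.symm, fun j hj => ?_⟩
    simp only [State.arr_setArr, State.arr_setReg, if_true, Function.update_apply]
    by_cases hji : j = i
    · subst hji; simp
    · rw [if_neg hji, h6 j hj]
      by_cases hlt : j < i
      · rw [if_pos hlt, if_pos (by omega)]
      · rw [if_neg hlt, if_neg (by omega)]
  rintro s₃ k₃ hf₃ ⟨-, h6₃⟩ hk₃
  simp only [Finset.sum_const, Nat.card_Ico, smul_eq_mul, Expr.cost] at hk₃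
  have hin₃ := (hin₂.setReg (x := 5) (k := 0) (by norm_num)).frame hf₃ rfl rfl rfl
  have h5₃ : s₃.arr 5 = s.arr 5 := (hf₃.arr 5 rfl).trans h5₂
  have h7₃ : s₃.arr 7 = s.arr 7 := (hf₃.arr 7 rfl).trans h7₂
  -- The cell of a key points to the next free position of its bucket, which is the rank `ρ j` when
  -- item `j` is placed.
  refine wp_forVerts (fun i s' =>
    (∀ m ≤ n, s'.arr 6 m = (Finset.univ.filter fun v : Fin n => s.arr 5 v < m).card +
      (Finset.univ.filter fun j : Fin n => j.val < i ∧ s.arr 5 (σ j) = m).card) ∧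
    ∀ j : Fin n, j.val < i → s'.arr 8 (ρ j) = σ j) 20 0 hin₃ (by omega) rfl rfl ⟨rfl, rfl⟩
    (fun _ _ _ h => h) ?_ ?_ ?_
  · refine ⟨fun m hm => ?_, by simp⟩
    rw [h6₃ m hm, if_pos (by omega)]
    simp
  · rintro v s' k' hin' hv hf ⟨h6, h8⟩
    have h5 : s'.arr 5 = s.arr 5 := (hf.arr 5 rfl).trans h5₃
    have h7 : s'.arr 7 = s.arr 7 := (hf.arr 7 rfl).trans h7₃
    have hKv := hK (σ v)
    have hr : s'.arr 6 (s.arr 5 (σ v)) = ρ v := by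
      rw [h6 _ hKv, hρ v, hcount]
    have hv2 := (ρ v).2
    have hv3 := (σ v).2
    simp only [wp_seq, wp_set, wp_put, Expr.eval, Expr.cost, hv, h5, h7, hσ, State.reg_setReg,
      State.arr_setReg, State.reg_setArr, State.arr_setArr, Nat.reduceEqDiff, if_true, if_false, hr]
    refine ⟨by omega, by omega, by omega, by omega, by omega, by omega, by omega,
      fun m hm => ?_, fun j hj => ?_⟩
    · rw [card_filter_lt_succ, Function.update_apply]
      split_ifs with h1 h2 h2
      · rw [h1, ← hr, h6 _ hKv]; omega
      · exact absurd h1.symm h2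
      · exact absurd h2.symm h1
      · rw [h6 m hm, Nat.add_zero]
    · rw [Function.update_apply]
      split_ifs with h
      · rw [ρ.injective (Fin.ext h)]
      · refine h8 j ?_
        have : j.val ≠ v.val := fun h' => h (by rw [Fin.ext h'])
        omega
  rintro s₄ k₄ hf₄ hin₄ ⟨-, h8⟩ hk₄
  refine ⟨by omega, hin₄, ρ.symm.trans σ, fun j => ?_, fun u v huv => ?_⟩
  · have := h8 (ρ.symm j) (Fin.is_lt _)
    simpa using this
  · have := hρlt (σ.symm u) (σ.symm v) (by simpa using huv)
    simpa using this

end CountingSort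

/-! ## The elimination order -/

section EliminationOrder

variable {n : ℕ} {G : SimpleGraph (Fin n)} {L : AdjLists G}

/-- Compute the low degrees with respect to the levels in the array `3`. The array `5` receives
them, and the array `7` receives the list of all vertices. -/
def lowDegrees : Prog :=
  .forVerts (.set 7 (.const 0) ;;
    .forNbrs (.ite (.sub (.get 3 (.reg 3)) (.get 3 (.reg 1))) .skip
      (.set 7 (.add (.reg 7) (.const 1)))) ;;
    .put 5 (.reg 1) (.reg 7) ;; .put 7 (.reg 1) (.reg 1))

theorem wp_lowDegrees [DecidableRel G.Adj] {W : ℕ} {s : State} {k : ℕ} (hin : Input L s)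
    (hW : n + L.off n + 2 ≤ W) :
    wp W lowDegrees s k fun s' k' => k' ≤ k + 10 + 40 * n + 40 * L.off n ∧ Input L s' ∧
      ∀ v : Fin n, s'.arr 5 v = lowDegree G (fun v : Fin n => s.arr 3 v) v ∧ s'.arr 7 v = v := by
  refine wp_forVerts (fun i s' => ∀ v : Fin n, v.val < i →
    s'.arr 5 v = lowDegree G (fun v : Fin n => s.arr 3 v) v ∧ s'.arr 7 v = v) 30 40 hin
    (by omega) rfl rfl ⟨rfl, rfl⟩ (fun _ _ _ h => h) (by simp) ?_ ?_
  · intro v s' k' hin' hv hf hI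
    have hv2 := v.2
    simp only [wp_seq, wp_set, Expr.eval, Expr.cost]
    refine ⟨by omega, ?_⟩
    refine wp_forNbrs (fun l s'' => s''.reg 7 =
      (l.filter fun u : Fin n => s.arr 3 u ≤ s.arr 3 v).length) 20
      (hin'.setReg (by norm_num)) v (by simpa using hv) (by omega) ⟨rfl, rfl, rfl, rfl, rfl⟩ ?_ ?_
      ?_ ?_
    · rintro l s' x m (rfl | rfl) h <;> simpa using h
    · simp
    · intro l u s'' k'' hl hin'' hv'' hu hf'' hI''
      have h3 : s''.arr 3 = s.arr 3 := (hf''.arr 3 rfl).trans (hf.arr 3 rfl)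
      have hlen : l.length ≤ n := length_le_of_nodup
        ((L.nodup v).sublist ((List.prefix_append l [u]).trans hl).sublist)
      have hfil := List.length_filter_le (fun u : Fin n => decide (s.arr 3 u ≤ s.arr 3 v)) l
      simp only [wp_ite, wp_skip, wp_set, Expr.eval, Expr.cost, hv'', hu, h3, hI'',
        List.filter_append, List.length_append]
      refine ⟨fun h => ⟨by omega, ?_⟩, fun h => ⟨by omega, by omega, ?_⟩⟩
      · rw [List.filter_cons_of_neg (by simpa using by omega)]
        simp
      · rw [List.filter_cons_of_pos (by simpa using by omega)]
        simp
    · intro s'' k'' hf'' hin'' hI'' hk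
      have hr1 : s''.reg 1 = v := (hf''.reg 1 rfl).trans (by simpa using hv)
      have h5 : s''.arr 5 = s'.arr 5 := hf''.arr 5 rfl
      have h7 : s''.arr 7 = s'.arr 7 := hf''.arr 7 rfl
      have hlow : s''.reg 7 = lowDegree G (fun v : Fin n => s.arr 3 v) v := by
        rw [hI'', lowDegree, ← List.toFinset_card_of_nodup ((L.nodup v).filter _)]
        congr 1
        ext u
        simp [L.mem_nbrs]
      have hle : s''.reg 7 ≤ n := by
        rw [hlow]; exact (Finset.card_le_univ _).trans_eq (Fintype.card_fin n)
      simp only [wp_put, Expr.eval, Expr.cost, State.reg_setArr, hr1]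
      refine ⟨by omega, by omega, by omega, by omega, by omega, fun u hu => ?_⟩
      simp only [State.arr_setArr, Nat.reduceEqDiff, if_true, if_false, Function.update_apply, h5,
        h7]
      rcases Nat.lt_succ_iff_lt_or_eq.1 hu with h | h
      · rw [if_neg (by omega), if_neg (by omega)]
        exact hI u h
      · cases Fin.ext h
        simp [hlow]
  · intro s' k' hf hin' hI hk
    exact ⟨by omega, hin', fun v => hI v v.2⟩

/-- Prepare for sorting by decreasing level. -/
def levelKeys : Prog :=
  .forVerts (.put 7 (.reg 1) (.get 8 (.reg 1)) ;;
    .put 5 (.reg 1) (.sub (.reg 0) (.get 3 (.reg 1))))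

theorem wp_levelKeys {W : ℕ} {s : State} {k : ℕ} (hin : Input L s) (hW : n + L.off n + 2 ≤ W)
    (σ : Equiv.Perm (Fin n)) (hσ : ∀ j : Fin n, s.arr 8 j = σ j) :
    wp W levelKeys s k fun s' k' => k' ≤ k + 10 + 30 * n ∧ Input L s' ∧
      ∀ v : Fin n, s'.arr 5 v = n - s.arr 3 v ∧ s'.arr 7 v = σ v := by
  refine wp_forVerts (fun i s' => ∀ v : Fin n, v.val < i →
    s'.arr 5 v = n - s.arr 3 v ∧ s'.arr 7 v = σ v) 20 0 hin
    (by omega) rfl rfl ⟨rfl, rfl⟩ (fun _ _ _ h => h) (by simp) ?_ ?_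
  · intro v s' k' hin' hv hf hI
    have hv2 := v.2
    have hσ2 := (σ v).2
    have h3 : s'.arr 3 = s.arr 3 := hf.arr 3 rfl
    have h8 : s'.arr 8 = s.arr 8 := hf.arr 8 rfl
    simp only [wp_seq, wp_put, Expr.eval, Expr.cost, hv, h8, hσ, State.reg_setArr, hin'.reg,
      State.arr_setArr, Nat.reduceEqDiff, if_true, if_false, h3]
    refine ⟨by omega, by omega, by omega, by omega, by omega, fun u hu => ?_⟩
    rw [Function.update_apply, Function.update_apply]
    rcases Nat.lt_succ_iff_lt_or_eq.1 hu with h | h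
    · rw [if_neg (by omega), if_neg (by omega)]
      exact hI u h
    · cases Fin.ext h
      simp
  · intro s' k' hf hin' hI hk
    exact ⟨by omega, hin', fun v => hI v v.2⟩

/-- Compute an elimination order. The array `8` receives it. -/
def eliminationOrder : Prog :=
  search ;; lowDegrees ;; countingSort ;; levelKeys ;; countingSort

theorem wp_eliminationOrder [DecidableRel G.Adj] {lt : Fin n → Fin n → Prop}
    (ho : IsUmbrellaOrder G lt) {W : ℕ} {s : State} {k : ℕ} (hin : Input L s)
    (hW : n + L.off n + 2 ≤ W) (h3 : ∀ j, s.arr 3 j = 0) :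
    wp W eliminationOrder s k fun s' k' => k' ≤ k + 300 + 500 * n + 100 * L.off n ∧ Input L s' ∧
      ∃ σ : Equiv.Perm (Fin n), (∀ j : Fin n, s'.arr 8 j = σ j) ∧
        ∀ v u w, G.Adj v u → G.Adj v w → σ.symm v < σ.symm u → σ.symm v < σ.symm w → u ≠ w →
          G.Adj u w := by
  unfold eliminationOrder
  simp only [wp_seq]
  refine (wp_search hin hW h3).mono ?_
  rintro s₁ k₁ - ⟨hk₁, hin₁, hlev, R, hlay⟩
  refine (wp_lowDegrees hin₁ hW).mono ?_
  rintro s₂ k₂ hf₂ ⟨hk₂, hin₂, hlow⟩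
  have h3₂ : s₂.arr 3 = s₁.arr 3 := hf₂.arr 3 rfl
  refine (wp_countingSort hin₂ hW (fun v => ?_) (Equiv.refl _) (fun v => (hlow v).2)).mono ?_
  · rw [(hlow v).1]
    exact (Finset.card_le_univ _).trans_eq (Fintype.card_fin n)
  rintro s₃ k₃ hf₃ ⟨hk₃, hin₃, σ, hσ, hlt⟩
  have h3₃ : s₃.arr 3 = s₁.arr 3 := (hf₃.arr 3 rfl).trans h3₂
  refine (wp_levelKeys hin₃ hW σ hσ).mono ?_
  rintro s₄ k₄ hf₄ ⟨hk₄, hin₄, hkey⟩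
  refine (wp_countingSort hin₄ hW (fun v => ?_) σ (fun v => (hkey v).2)).mono ?_
  · rw [(hkey v).1]
    exact Nat.sub_le _ _
  rintro s₅ k₅ - ⟨hk₅, hin₅, τ, hτ, hτlt⟩
  refine ⟨by omega, hin₅, τ, hτ, fun v u w hu hw hvu hvw huw => ?_⟩
  -- The second pass sorts by `n` minus the level and preserves the order by low degree within a
  -- level. Levels are at most `n`, so the key loses nothing by truncation.
  have hlater : ∀ x, τ.symm v < τ.symm x → s₁.arr 3 x < s₁.arr 3 v ∨
      s₁.arr 3 x = s₁.arr 3 v ∧ lowDegree G (fun v : Fin n => s₁.arr 3 v) v ≤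
        lowDegree G (fun v : Fin n => s₁.arr 3 v) x := by
    intro x hx
    have h1 := hτlt v x hx
    have h2 := hlev v
    have h4 := hlev x
    rw [(hkey v).1, (hkey x).1, h3₃] at h1
    rcases h1 with h1 | ⟨h1, h1'⟩
    · exact .inl (by omega)
    · refine .inr ⟨by omega, ?_⟩
      have := hlt v x h1'
      rw [(hlow v).1, (hlow x).1] at this
      omega
  exact hlay.isPerfectElimination ho hu hw (hlater u hvu) (hlater w hvw) huw

end EliminationOrder

/-! ## The program for unit interval graphs -/

section UnitIntervalProgram

variable {n : ℕ} {G : SimpleGraph (Fin n)} {L : AdjLists G}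

/-- Run `p` with the value of `e` in the register `1`, for all values of the register `4` from zero
up to the number of vertices. -/
def Prog.forOrder (e : Expr) (p : Prog) : Prog := .forRange 4 (.const 0) (.reg 0) (.set 1 e ;; p)

theorem wp_forOrder {W : ℕ} {s : State} {k : ℕ} {Q : State → ℕ → Prop} {e : Expr} {p : Prog}
    (τ : Equiv.Perm (Fin n)) (Inv : ℕ → State → Prop) (C D : ℕ) (hin : Input L s) (hW : n ≤ W)
    (he : ∀ s' (j : Fin n), Frame (p.forOrder e) s s' → s'.reg 4 = j → e.eval s' = τ j)
    (h0p : p.setsReg 0 = false) (h1p : p.setsReg 4 = false)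
    (ha : p.setsArr 0 = false ∧ p.setsArr 1 = false)
    (hI : ∀ i s' x m, x = 1 ∨ x = 4 → Inv i s' → Inv i (s'.setReg x m))
    (h0 : Inv 0 s)
    (hstep : ∀ (j : Fin n) s' k', Input L s' → s'.reg 1 = τ j → Frame (p.forOrder e) s s' →
      Inv j s' → wp W p s' k' fun s'' k'' =>
        k'' ≤ k' + (C + D * (L.nbrs (τ j)).length) ∧ Inv (j + 1) s'')
    (hQ : ∀ s' k', Frame (p.forOrder e) s s' → Input L s' → Inv n s' →
      k' ≤ k + 6 + (C + e.cost + 9) * n + D * L.off n → Q s' k') :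
    wp W (p.forOrder e) s k Q := by
  have hin' : ∀ s', Frame (p.forOrder e) s s' → Input L s' := fun s' hf =>
    hin.frame hf (by simp [Prog.forOrder, Prog.forRange, Prog.setsReg, h0p])
      (by simp [Prog.forOrder, Prog.forRange, Prog.setsArr, ha.1])
      (by simp [Prog.forOrder, Prog.forRange, Prog.setsArr, ha.2])
  refine wp_forRange Inv
    (fun i => C + e.cost + 1 + D * if h : i < n then (L.nbrs (τ ⟨i, h⟩)).length else 0)
    (lo := 0) (hi := n) rfl (Nat.zero_le _) hW (fun s' hf => (hin' s' hf).reg)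
    (by simp [Prog.setsReg, h1p])
    (fun i s' m => hI i s' 4 m (.inr rfl)) h0 ?_ ?_
  · intro i s' k' _ hi hi4 hf hinv
    rw [dif_pos hi, wp_seq, wp_set, he s' ⟨i, hi⟩ hf hi4]
    have hlt := (τ ⟨i, hi⟩).2
    refine ⟨by omega, ?_⟩
    refine (hstep ⟨i, hi⟩ (s'.setReg 1 _) _ ((hin' s' hf).setReg (by norm_num)) (by simp) ?_
      (hI _ _ _ _ (.inl rfl) hinv)).mono ?_
    · refine hf.trans ⟨fun x hx => ?_, fun _ _ => rfl⟩
      have : x ≠ 1 := by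
        rintro rfl; simp [Prog.forRange, Prog.setsReg] at hx
      simp [this]
    · rintro s'' k'' - ⟨hk, hI'⟩
      exact ⟨by omega, hI'⟩
  · intro s' k' hf hinv hk
    refine hQ s' k' hf (hin' s' hf) hinv (hk.trans ?_)
    rw [← Finset.range_eq_Ico, Finset.sum_range, ← L.sum_length_nbrs,
      ← Equiv.sum_comp τ fun v => (L.nbrs v).length]
    simp only [Fin.is_lt, dif_pos, Fin.eta, Finset.sum_add_distrib, Finset.mul_sum, Finset.sum_const,
      Finset.card_univ, Fintype.card_fin, smul_eq_mul, Expr.cost]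
    nlinarith

/-- The weights of the vertices: they compare independent sets first by their size, and then by
their degree sum. -/
def initWeights : Prog :=
  .forVerts (.put 9 (.reg 1) (.add (.add (.get 0 (.reg 0)) (.const 1)) (.deg 1)))

/-- The base weight is one more than the cell `n` of the array `0`, which holds the sum of all
degrees. -/
theorem wp_initWeights {W : ℕ} {s : State} {k : ℕ} (hin : Input L s)
    (hW : 2 * n + L.off n + 2 ≤ W) :
    wp W initWeights s k fun s' k' => k' ≤ k + 10 + 30 * n ∧ Input L s' ∧
      ∀ v : Fin n, s'.arr 9 v = L.off n + 1 + (L.nbrs v).length := by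
  refine wp_forVerts (fun i s' => ∀ v : Fin n, v.val < i →
    s'.arr 9 v = L.off n + 1 + (L.nbrs v).length) 20 0 hin
    (by omega) rfl rfl ⟨rfl, rfl⟩ (fun _ _ _ h => h) (by simp) ?_ ?_
  · intro v s' k' hin' hv hf hI
    have hv2 := v.2
    have hlt := L.length_nbrs_lt v
    simp only [wp_put, Expr.eval, Expr.cost, hv, hin'.reg, hin'.off le_rfl, hin'.eval_deg hv,
      Expr.cost_deg]
    refine ⟨by omega, by omega, by omega, fun u hu => ?_⟩
    simp only [State.arr_setArr, if_true, Function.update_apply]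
    rcases Nat.lt_succ_iff_lt_or_eq.1 hu with h | h
    · rw [if_neg (by omega)]
      exact hI u h
    · cases Fin.ext h
      simp
  · intro s' k' hf hin' hI hk
    exact ⟨by omega, hin', fun v => hI v v.2⟩

/-- Subtract the remaining weight of each vertex from the weights of its neighbours. -/
def reduceWeights : Prog :=
  .forOrder (.get 8 (.reg 4)) (.set 7 (.get 9 (.reg 1)) ;; .put 10 (.reg 1) (.reg 7) ;;
    .forNbrs (.put 9 (.reg 3) (.sub (.get 9 (.reg 3)) (.reg 7))))

theorem sum_filter_lt_succ {σ : Equiv.Perm (Fin n)} {p : Fin n → Prop} [DecidablePred p]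
    (f : Fin n → ℕ) (j : Fin n) :
    ∑ u with p u ∧ (σ.symm u).val < j + 1, f u =
      (∑ u with p u ∧ (σ.symm u).val < j, f u) + if p (σ j) then f (σ j) else 0 := by
  simp only [Finset.sum_filter]
  have h : (if p (σ j) then f (σ j) else 0) =
      ∑ u, if u = σ j then (if p u then f u else 0) else 0 := by simp
  rw [h, ← Finset.sum_add_distrib]
  refine Finset.sum_congr rfl fun u _ => ?_
  by_cases hu : u = σ j
  · subst hu; simp
  · have : (σ.symm u).val ≠ j.val := fun h => hu (by
      rw [← σ.apply_symm_apply u, Fin.ext h])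
    rw [if_neg hu, add_zero]
    have : (σ.symm u).val < j + 1 ↔ (σ.symm u).val < j := by omega
    simp only [this]

/-- Successive truncated subtractions amount to one truncated subtraction of the sum. The value is
also subtracted at earlier neighbours; this is harmless, as their own values are already saved in
the array `10`. -/
theorem wp_reduceWeights [DecidableRel G.Adj] {W : ℕ} {s : State} {k : ℕ} (hin : Input L s)
    (hW : 2 * n + L.off n + 2 ≤ W) (σ : Equiv.Perm (Fin n)) (hσ : ∀ j : Fin n, s.arr 8 j = σ j)
    {wt y : Fin n → ℕ} (hwt : ∀ v : Fin n, s.arr 9 v = wt v) (hwW : ∀ v, wt v ≤ W)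
    (hy : ∀ v, y v = wt v - ∑ u with G.Adj v u ∧ σ.symm u < σ.symm v, y u) :
    wp W reduceWeights s k fun s' k' => k' ≤ k + 10 + 50 * n + 40 * L.off n ∧ Input L s' ∧
      ∀ v : Fin n, s'.arr 10 v = y v := by
  refine wp_forOrder σ (fun i s' =>
    (∀ v : Fin n, s'.arr 9 v = wt v - ∑ u with G.Adj v u ∧ (σ.symm u).val < i, y u) ∧
    ∀ v : Fin n, (σ.symm v).val < i → s'.arr 10 v = y v) 30 30 hin (by omega) ?_ rfl rfl
    ⟨rfl, rfl⟩ (fun _ _ _ _ _ h => h) (by simpa using hwt) ?_ ?_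
  · intro s' j hf h4
    simp only [Expr.eval, h4]
    rw [hf.arr 8 rfl, hσ]
  · rintro j s' k' hin' h1 hf ⟨h9, h10⟩
    have hx : s'.arr 9 (σ j) = y (σ j) := by
      rw [h9, hy]; simp
    have hyW : y (σ j) ≤ W := by
      rw [hy]; exact (Nat.sub_le _ _).trans (hwW _)
    have hσ2 := (σ j).2
    simp only [wp_seq, wp_set, wp_put, Expr.eval, Expr.cost, h1, hx, State.reg_setReg, if_true,
      Nat.reduceEqDiff, if_false]
    refine ⟨by omega, by omega, by omega, ?_⟩
    refine wp_forNbrs (fun l s'' => ∀ u : Fin n,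
      s''.arr 9 u = s'.arr 9 u - if u ∈ l then y (σ j) else 0) 10
      ((hin'.setReg (by norm_num)).setArr (by norm_num) (by norm_num)) (σ j)
      (by simpa using h1) (by omega) ⟨rfl, rfl, rfl, rfl, rfl⟩ (fun _ _ _ _ _ h => h) (by simp) ?_ ?_
    · intro l u s'' k'' hl hin'' hv'' hu hf'' hI''
      have hul : u ∉ l := fun h => by
        have := (L.nodup (σ j)).sublist hl.sublist
        simp [List.nodup_append] at this
        exact this.2 u h rfl
      have h7 : s''.reg 7 = y (σ j) := (hf''.reg 7 rfl).trans (by simp)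
      have hu2 := u.2
      have hIu := hI'' u
      rw [if_neg hul, Nat.sub_zero] at hIu
      have h9W : s'.arr 9 u ≤ W := by
        rw [h9]; exact (Nat.sub_le _ _).trans (hwW _)
      simp only [wp_put, Expr.eval, Expr.cost, hu, h7, hIu]
      refine ⟨by omega, by omega, by omega, fun w => ?_⟩
      simp only [State.arr_setArr, if_true, Function.update_apply]
      by_cases hw : w = u
      · subst hw; simp
      · rw [if_neg (fun h => hw (Fin.ext h)), hI'']
        simp [hw]
    · intro s'' k'' hf'' hin'' hI'' hk
      have h10' : s''.arr 10 = Function.update (s'.arr 10) (σ j) (y (σ j)) :=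
        (hf''.arr 10 rfl).trans (by simp)
      refine ⟨by omega, fun u => ?_, fun u hu => ?_⟩
      · rw [hI'', h9, sum_filter_lt_succ, Nat.sub_sub]
        simp only [L.mem_nbrs, G.adj_comm u]
      · rw [h10', Function.update_apply]
        split_ifs with h
        · rw [Fin.ext h]
        · refine h10 u ?_
          have : (σ.symm u).val ≠ j.val := fun h' => h (by
            rw [← Fin.ext h', σ.apply_symm_apply])
          omega
  · rintro s' k' hf hin' ⟨-, h10⟩ hk
    simp only [Expr.cost] at hk
    exact ⟨by omega, hin', fun v => h10 v (Fin.is_lt _)⟩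

/-- Collect the independent set greedily in the reverse elimination order, and count, for each
vertex, the neighbours in the set. -/
def countIndepNbrs : Prog :=
  .forOrder (.get 8 (.sub (.sub (.reg 0) (.const 1)) (.reg 4)))
    (.ite (.get 10 (.reg 1))
      (.ite (.get 2 (.reg 1)) .skip
        (.forNbrs (.put 2 (.reg 3) (.add (.get 2 (.reg 3)) (.const 1)))))
      .skip)

/-- The array `2` plays two roles. When a vertex is reached, its cell counts the later neighbours in
`X`, so zero means that the vertex is not blocked; at the end it counts all neighbours in `X`, and
the cells equal to `1` are exactly the private neighbours, which is the output. -/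
theorem wp_countIndepNbrs [DecidableRel G.Adj] {W : ℕ} {s : State} {k : ℕ} (hin : Input L s)
    (hW : 2 * n + L.off n + 2 ≤ W) (σ : Equiv.Perm (Fin n)) (hσ : ∀ j : Fin n, s.arr 8 j = σ j)
    {y : Fin n → ℕ} (hy : ∀ v : Fin n, s.arr 10 v = y v) (h2 : ∀ j, s.arr 2 j = 0)
    {X : Finset (Fin n)}
    (hX : ∀ v, v ∈ X ↔ 0 < y v ∧ ∀ u, G.Adj v u → σ.symm v < σ.symm u → u ∉ X) :
    wp W countIndepNbrs s k fun s' k' => k' ≤ k + 10 + 60 * n + 40 * L.off n ∧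
      s'.output n = privateNbrs G X := by
  refine wp_forOrder (Fin.revPerm.trans σ) (fun i s' => ∀ v : Fin n, s'.arr 2 v =
    (Finset.univ.filter fun j : Fin n => j.val < i ∧
      (G.Adj v (σ j.rev) ∧ σ j.rev ∈ X)).card) 40 30 hin (by omega) ?_ rfl rfl
    ⟨rfl, rfl⟩ (fun _ _ _ _ _ h => h) (by simpa using fun v : Fin n => h2 v) ?_ ?_
  · intro s' j hf h4
    have hr : n - 1 - j.val = (j.rev).val := by
      rw [Fin.val_rev]; omega
    simp only [Expr.eval, h4]
    rw [hf.arr 8 rfl, hf.reg 0 rfl, hin.reg, hr, hσ]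
    simp
  · rintro j s' k' hin' h1 hf hI
    have h10 : s'.arr 10 = s.arr 10 := hf.arr 10 rfl
    simp only [Equiv.trans_apply, Fin.revPerm_apply] at h1 ⊢
    -- In reverse order, the vertices treated so far are those later in the elimination order.
    have hmem : σ j.rev ∈ X ↔ y (σ j.rev) ≠ 0 ∧ s'.arr 2 (σ j.rev) = 0 := by
      rw [hX, hI, Finset.card_eq_zero, Nat.pos_iff_ne_zero, Finset.filter_eq_empty_iff]
      refine and_congr_right fun _ => ⟨fun h i _ hi => ?_, fun h u hu hlt huX => ?_⟩
      · refine h _ hi.2.1 ?_ hi.2.2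
        have := hi.1
        simp only [Equiv.symm_apply_apply, Fin.lt_def, Fin.val_rev]
        omega
      · refine h (Finset.mem_univ (σ.symm u).rev) ⟨?_, by simpa using hu, by simpa using huX⟩
        simp only [Equiv.symm_apply_apply, Fin.lt_def, Fin.val_rev] at hlt ⊢
        omega
    simp only [wp_ite, wp_skip, Expr.eval, Expr.cost, h1, h10, hy]
    refine ⟨fun hy0 => ⟨fun h20 => ⟨by omega, fun u => ?_⟩, fun h20 => ?_⟩,
      fun hy0 => ⟨by omega, fun u => ?_⟩⟩
    · rw [card_filter_lt_succ, if_neg (fun h => h20 (hmem.1 h.2).2), Nat.add_zero, hI]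
    · have hjX := hmem.2 ⟨hy0, h20⟩
      refine wp_forNbrs (fun l s'' => ∀ u : Fin n,
        s''.arr 2 u = s'.arr 2 u + if u ∈ l then 1 else 0) 10 hin' (σ j.rev) h1 (by omega)
        ⟨rfl, rfl, rfl, rfl, rfl⟩ (fun _ _ _ _ _ h => h) (by simp) ?_ ?_
      · intro l u s'' k'' hl hin'' hv'' hu hf'' hI''
        have hul : u ∉ l := fun h => by
          have := (L.nodup (σ j.rev)).sublist hl.sublist
          simp [List.nodup_append] at this
          exact this.2 u h rfl
        have hu2 := u.2
        have hIu := hI'' u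
        rw [if_neg hul, Nat.add_zero] at hIu
        have h2n : s'.arr 2 u ≤ n := by
          rw [hI]; exact (Finset.card_le_univ _).trans_eq (Fintype.card_fin n)
        simp only [wp_put, Expr.eval, Expr.cost, hu, hIu]
        refine ⟨by omega, by omega, by omega, fun w => ?_⟩
        simp only [State.arr_setArr, if_true, Function.update_apply]
        by_cases hw : w = u
        · subst hw; simp
        · rw [if_neg (fun h => hw (Fin.ext h)), hI'']
          simp [hw]
      · intro s'' k'' hf'' hin'' hI'' hk
        refine ⟨by omega, fun u => ?_⟩
        rw [hI'', hI, card_filter_lt_succ]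
        simp [hjX, L.mem_nbrs, G.adj_comm u]
    · rw [card_filter_lt_succ, if_neg (fun h => (hmem.1 h.2).1 hy0), Nat.add_zero, hI]
  · rintro s' k' hf hin' hI hk
    simp only [Expr.cost] at hk
    refine ⟨by omega, ?_⟩
    ext v
    have hc : (Finset.univ.filter fun j : Fin n => j.val < n ∧
        (G.Adj v (σ j.rev) ∧ σ j.rev ∈ X)).card = (X.filter fun x => G.Adj v x).card :=
      Finset.card_equiv (Fin.revPerm.trans σ) (by simp [and_comm])
    simp only [State.output, privateNbrs, Finset.mem_filter, Finset.mem_univ, true_and]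
    rw [hI, hc]

/-- The program for PAU-VC on unit interval graphs. -/
def unitIntervalProgram : Prog :=
  eliminationOrder ;; initWeights ;; reduceWeights ;; countIndepNbrs

theorem exists_reduced [DecidableRel G.Adj] (σ : Equiv.Perm (Fin n)) (wt : Fin n → ℕ) :
    ∃ y : Fin n → ℕ, ∀ v, y v = wt v - ∑ u with G.Adj v u ∧ σ.symm u < σ.symm v, y u := by
  have hwf : WellFounded fun u v => σ.symm u < σ.symm v := InvImage.wf σ.symm wellFounded_lt
  refine ⟨hwf.fix fun v ih => wt v - ∑ u with G.Adj v u ∧ σ.symm u < σ.symm v,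
    if h : σ.symm u < σ.symm v then ih u h else 0, fun v => ?_⟩
  rw [hwf.fix_eq]
  congr 1
  refine Finset.sum_congr rfl fun u hu => ?_
  rw [dif_pos (Finset.mem_filter.1 hu).2.2]

theorem exists_greedy (σ : Equiv.Perm (Fin n)) (y : Fin n → ℕ) :
    ∃ X : Finset (Fin n),
      ∀ v, v ∈ X ↔ 0 < y v ∧ ∀ u, G.Adj v u → σ.symm v < σ.symm u → u ∉ X := by
  classical
  have hwf : WellFounded fun u v => σ.symm v < σ.symm u := InvImage.wf σ.symm wellFounded_gt
  let P : Fin n → Prop := hwf.fix fun v ih =>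
    0 < y v ∧ ∀ u, G.Adj v u → ∀ h : σ.symm v < σ.symm u, ¬ ih u h
  refine ⟨Finset.univ.filter P, fun v => ?_⟩
  simp only [Finset.mem_filter, Finset.mem_univ, true_and]
  exact iff_of_eq (hwf.fix_eq _ v)

theorem solvableInLinearTime_isUnitInterval :
    SolvableInLinearTime fun _ G => IsUnitInterval G := by
  classical
  refine ⟨unitIntervalProgram, 2000, fun n G hG L => ?_⟩
  have hoff := L.off_eq
  obtain ⟨lt, ho⟩ := hG.exists_umbrellaOrder
  set W := 2000 * (n + G.edgeSet.ncard + 1) with hWdef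
  have hW : 2 * n + L.off n + 2 ≤ W := by omega
  suffices H : wp W unitIntervalProgram L.init 0 fun s' k' =>
      k' ≤ W ∧ IsSolution G (s'.output n) by
    obtain ⟨t, s, h1, h2, h3⟩ := H
    exact ⟨t, s, h1, by omega, h3⟩
  have hin := L.input_init
  unfold unitIntervalProgram
  simp only [wp_seq]
  refine (wp_eliminationOrder ho hin (by omega) (by simp [AdjLists.init])).mono ?_
  rintro s₁ k₁ hf₁ ⟨hk₁, hin₁, σ, hσ, hpeo⟩
  refine (wp_initWeights hin₁ hW).mono ?_
  rintro s₂ k₂ hf₂ ⟨hk₂, hin₂, h9⟩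
  have h8₂ : s₂.arr 8 = s₁.arr 8 := hf₂.arr 8 rfl
  have hlen : ∀ v, (L.nbrs v).length = G.degree v := L.length_nbrs
  simp only [hlen] at h9
  obtain ⟨y, hy⟩ := exists_reduced (G := G) σ fun v => L.off n + 1 + G.degree v
  obtain ⟨X, hX⟩ := exists_greedy (G := G) σ y
  refine (wp_reduceWeights hin₂ hW σ (fun j => by rw [h8₂, hσ]) h9 (fun v => ?_) hy).mono ?_
  · have := L.length_nbrs_lt v
    rw [hlen] at this
    omega
  rintro s₃ k₃ hf₃ ⟨hk₃, hin₃, h10⟩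
  have h8₃ : s₃.arr 8 = s₁.arr 8 := (hf₃.arr 8 rfl).trans h8₂
  have h2₃ : s₃.arr 2 = L.init.arr 2 :=
    ((hf₃.arr 2 rfl).trans (hf₂.arr 2 rfl)).trans (hf₁.arr 2 rfl)
  refine (wp_countIndepNbrs hin₃ hW σ (fun j => by rw [h8₃, hσ]) h10
    (by simp [h2₃, AdjLists.init]) hX).mono ?_
  rintro s₄ k₄ - ⟨hk₄, hout⟩
  refine ⟨by omega, ?_⟩
  obtain ⟨hind, hmax⟩ := isMaxWeight_of_elimination (G := G)
    (pos := fun v => (σ.symm v).val) (Fin.val_injective.comp σ.symm.injective) hpeo hy hX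
  have hN : ∑ v, G.degree v < L.off n + 1 := by
    rw [← L.sum_length_nbrs, Finset.sum_congr rfl fun v _ => hlen v]
    omega
  obtain ⟨h1, h2⟩ := isMaximumIndepSet_of_isMaxWeight hN hind hmax
  rw [hout]
  exact ho.isSolution_privateNbrs h1 h2

end UnitIntervalProgram

end PAUVC

theorem theorem2 :
    PAUVC.SolvableInLinearTime (fun _ G => PAUVC.IsUnitInterval G) ∧
    PAUVC.SolvableInLinearTime (fun _ G => PAUVC.IsSplit G) :=
  ⟨PAUVC.solvableInLinearTime_isUnitInterval, PAUVC.solvableInLinearTime_isSplit⟩
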